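/- **Setting.** Let $\mathcal V$ be a finite ground set with $n=|\mathcal V|$, let $f:2^{\mathcal V}\to\mathbb R_{\ge 0}$ be monotone and submodular, given by an oracle that returns $f(A)$ for a queried set $A\subseteq\mathcal V$, and let $w:\mathcal V\to[1,\rho]$. Let $0<\epsilon<1/10$ and $0<\epsilon_{\rm del}<\epsilon/16$. Write $d(e\mid G)=\frac{f(G\cup\{e\})-f(G)}{w(e)}$ and $d(e)=f(\{e\})/w(e)$. A sequence of updates (each inserts or deletes one element of $\mathcal V$) is fixed in advance (oblivious adversary); $V$ is the set of present elements, initially empty. Consider the following randomized algorithm. *Runs.* For each $i\in\mathbb Z$ there is a run with threshold $\tau=(1+\epsilon)^i$. A run stores sets $L_\ell,\overline L_\ell,G_\ell,B_\ell$ for levels $\ell\ge 0$, a set $D$, and a number $T$; initially all sets are empty and $T=0$. On an update of $e$, $V$ is updated, $d(e)$ is queried, and the update is passed to all runs $i$ with $\log_{1+\epsilon}\frac{d(e)\,\epsilon}{n\rho(1+\epsilon)}\le i\le\log_{1+\epsilon}d(e)$ (to none if $d(e)=0$). *Insert$(e)$ in a run.* Remove $e$ from $D$ and add it to $\overline L_0$.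 For $i=1,\dots,T+1$: if $d(e\mid G_{i-1})<\tau$, stop; otherwise add $e$ to $\overline L_i$, and if $i=T+1$ or $|\overline L_i|\ge\frac32|L_i|$, call Reconstruct$(i)$ and stop. *Delete$(e)$ in a run.* Add $e$ to $D$. For $i=1,\dots,T$: if $|D\cap B_i|\ge\epsilon_{\rm del}|B_i|$, call Reconstruct$(i)$ and stop. *Reconstruct$(i)$.* Set $L_i\leftarrow\overline L_i\setminus D$ and $\overline L_i\leftarrow L_i$. While $L_i\neq\emptyset$: put each $e\in L_i$ into the bucket with index $\big(\lfloor\log_{1+\epsilon}\frac{d(e\mid G_{i-1})}{\tau}\rfloor,\lfloor\log_{1+\epsilon}w(e)\rfloor\big)$; let $B_i$ be a largest bucket (ties broken by a fixed rule), $b$ the first coordinate of its index, and $\tau_i=(1+\epsilon)^{b}\tau$; let $m_i$ be the output of CalcSampleSize$(B_i,G_{i-1},\tau_i)$; draw a uniformly random sequence of $m_i$ distinct elements of $B_i$; starting from $G_i\leftarrow G_{i-1}$, go through the sequence and add $e$ to $G_i$ whenever $d(e\mid G_i)\ge\tau_i$; set $L_{i+1}\leftarrow\{e\in L_i:d(e\mid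 G_i)\ge\tau\}$, $\overline L_{i+1}\leftarrow L_{i+1}$, and $i\leftarrow i+1$. Finally set $T\leftarrow i-1$. *CalcSampleSize$(L',G',\tau')$.* Repeat the following simulation $t=\lceil\frac4{\epsilon^2}\log\frac{n^{12}}{\epsilon}\rceil$ times independently: go through $L'$ in a uniformly random order and, starting from $G''\leftarrow G'$, accept $e$ and add it to $G''$ if $d(e\mid G'')\ge\tau'$, and reject it otherwise. Return $m'-1$, where $m'\in\{1,\dots,|L'|+1\}$ is the least index such that the fraction of simulations in which the $m'$-th element was accepted is less than $1-\epsilon$ (a nonexistent $(|L'|+1)$-st element counts as rejected). *Solution retrieval.* After each update, query $f(V)$. If $V=\emptyset$ or $f(V)=0$, the solution is $\emptyset$. Otherwise query $f(G_T)$ for the runs $i$ with $\lfloor\log_{1+\epsilon}\frac{f(V)\epsilon}{|V|\rho}\rfloor\le i\le\lfloor\log_{1+\epsilon}(f(V)\epsilon)\rfloor$; the solution is the set $G_T\setminus D$ of least total weight among those runs with $f(G_T)\ge(1-\epsilon)f(V)$ (and $\emptyset$ if there is no such run). The query complexity is the number of oracle queries made by all of these steps; every evaluation of a marginal density $d(e\mid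 G)$ counts as two queries, and evaluating $d(e)$ counts as one. **Theorem.** Let $\eta=\frac{1+\epsilon}{\epsilon}\,n\rho$. The expected amortized query complexity of the algorithm per update is at most $\mathrm{poly}(\log\eta,\frac1\epsilon)\cdot\frac{\epsilon}{\epsilon_{\rm del}}$; in particular it is $\mathrm{poly}(\log\eta,\frac1\epsilon)$ when $\epsilon_{\rm del}=\Theta(\epsilon)$. Precisely: there is a real polynomial $p$ in two variables such that, for all $\mathcal V,f,w,\rho,\epsilon,\epsilon_{\rm del}$ as above and every fixed sequence of $N$ updates, the expected total number of oracle queries made by the algorithm on this sequence is at most $N\cdot p(\log\eta,\frac1\epsilon)\cdot\frac{\epsilon}{\epsilon_{\rm del}}$. -/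

import Mathlib

/-! ### Randomized algorithms with a value oracle -/

/-- Randomized algorithms that see a set function on `E` only through value queries: a step either
stops with a result, asks the oracle for the value of a set, or draws a uniformly random ordering
of a finite set. -/
inductive QueryAlg (E : Type) (α : Type) : Type
  | ret (a : α) : QueryAlg E α
  | query (S : Finset E) (k : ℝ → QueryAlg E α) : QueryAlg E α
  | shuffle (S : Finset E) (k : List E → QueryAlg E α) : QueryAlg E α

namespace QueryAlg

/-- Sequential composition. -/
def bind {E α β : Type} : QueryAlg E α → (α → QueryAlg E β) → QueryAlg E β
  | ret a, g => g a
  | query S k, g => query S fun x => bind (k x) g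
  | shuffle S k, g => shuffle S fun l => bind (k l) g

instance {E : Type} : Monad (QueryAlg E) where
  pure := ret
  bind := bind

/-- The oracle call `f(S)`. -/
def ask {E : Type} (S : Finset E) : QueryAlg E ℝ := query S ret

/-- A uniformly random ordering of `S`. -/
def randomOrder {E : Type} (S : Finset E) : QueryAlg E (List E) := shuffle S ret

/-- The lists that enumerate `S` without repetition. -/
def orderings {E : Type} [DecidableEq E] (S : Finset E) : Finset (List E) := S.val.lists.toFinset

theorem orderings_nonempty {E : Type} [DecidableEq E] (S : Finset E) : (orderings S).Nonempty :=
  ⟨S.toList, by simp [orderings, Multiset.mem_lists_iff]⟩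

/-- Joint law of the result and of the number of oracle calls, when the oracle answers with `f`. -/
noncomputable def run {E α : Type} [DecidableEq E] (f : Finset E → ℝ) :
    QueryAlg E α → PMF (α × ℕ)
  | ret a => PMF.pure (a, 0)
  | query S k => (run f (k (f S))).map fun x => (x.1, x.2 + 1)
  | shuffle S k => (PMF.uniformOfFinset (orderings S) (orderings_nonempty S)).bind fun l => run f (k l)

/-- Expected number of oracle calls. -/
noncomputable def expectedQueries {E α : Type} [DecidableEq E] (f : Finset E → ℝ)
    (p : QueryAlg E α) : ENNReal :=
  ∑' x : α × ℕ, run f p x * (x.2 : ENNReal)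

/-- The results of `t` independent executions of `p`. -/
def iterate {E α : Type} (p : QueryAlg E α) : ℕ → QueryAlg E (List α)
  | 0 => pure []
  | t + 1 => do
    let x ← p
    let xs ← iterate p t
    return x :: xs

end QueryAlg

/-! ### The dynamic submodular cover algorithm -/

namespace SubmodularCover

open QueryAlg

/-- The data known to the algorithm: the weights, the upper bound `ρ` on the weights, the accuracy
`ε`, and the deletion threshold `ε_del`. -/
structure Params (E : Type) where
  w : E → ℝ
  rho : ℝ
  eps : ℝ
  epsDel : ℝ

/-- The leveled data structure of one run. Level `i` consists of `L i`, its extension `Lbar i`, the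
sampling bucket `B i` and the selected set `G i`; `D` is the set of deleted elements and `T` the
index of the last nonempty level. -/
structure LevelData (E : Type) where
  L : ℕ → Finset E
  Lbar : ℕ → Finset E
  G : ℕ → Finset E
  B : ℕ → Finset E
  D : Finset E
  T : ℕ

/-- The data structure initialized with no elements. -/
def LevelData.empty (E : Type) : LevelData E where
  L := fun _ => ∅
  Lbar := fun _ => ∅
  G := fun _ => ∅
  B := fun _ => ∅
  D := ∅
  T := 0

section Algorithm

variable {E : Type} [Fintype E] [DecidableEq E]

/-- Marginal density `d(e | G) = (f(G ∪ {e}) - f(G)) / w(e)`, obtained with two oracle calls. -/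
noncomputable def density (P : Params E) (e : E) (G : Finset E) : QueryAlg E ℝ := do
  let a ← ask (insert e G)
  let b ← ask G
  return (a - b) / P.w e

/-- `{e ∈ L : d(e | G) ≥ τ}`. -/
noncomputable def filterDense (P : Params E) (τ : ℝ) (L G : Finset E) : QueryAlg E (Finset E) :=
  L.toList.foldlM (fun acc e => do
    let d ← density P e G
    return if τ ≤ d then insert e acc else acc) ∅

/-- Sorts the elements of `L` into the buckets `(j, k)`, with
`j = ⌊log_{1+ε} (d(e | G) / τ)⌋` and `k = ⌊log_{1+ε} w(e)⌋`. -/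
noncomputable def bucketize (P : Params E) (τ : ℝ) (L G : Finset E) :
    QueryAlg E (ℤ × ℤ → Finset E) :=
  L.toList.foldlM (fun buck e => do
    let d ← density P e G
    let j := ⌊Real.logb (1 + P.eps) (d / τ)⌋
    let k := ⌊Real.logb (1 + P.eps) (P.w e)⌋
    return Function.update buck (j, k) (insert e (buck (j, k)))) fun _ => ∅

/-- The index of a largest bucket (ties are broken by a fixed rule). -/
noncomputable def largestBucket (buck : ℤ × ℤ → Finset E) : ℤ × ℤ :=
  Classical.epsilon fun b => ∀ c, (buck c).card ≤ (buck b).card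

/-- Goes through a list of elements and adds each one to the current set if its marginal density
is at least `τ`. Returns the accept / reject decisions, in order, and the final set. -/
noncomputable def addGreedily (P : Params E) (τ : ℝ) :
    Finset E → List E → QueryAlg E (List Bool × Finset E)
  | G, [] => pure ([], G)
  | G, e :: es => do
    let d ← density P e G
    if τ ≤ d then
      let r ← addGreedily P τ (insert e G) es
      return (true :: r.1, r.2)
    else
      let r ← addGreedily P τ G es
      return (false :: r.1, r.2)

/-- One simulation: the accept / reject decisions along a random order of `L`. -/
noncomputable def applyAndRevert (P : Params E) (τ : ℝ) (L G : Finset E) :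
    QueryAlg E (List Bool) := do
  let l ← randomOrder L
  let r ← addGreedily P τ G l
  return r.1

/-- The sample size: with `t = ⌈(4 / ε ^ 2) log (n ^ 12 / ε)⌉` simulations, the least `m` such that
the fraction of simulations whose `(m + 1)`-st element was accepted is less than `1 - ε`. In a
simulation, the element after the last one counts as rejected. -/
noncomputable def calcSampleSize (P : Params E) (τ : ℝ) (L G : Finset E) : QueryAlg E ℕ := do
  let t := ⌈4 / P.eps ^ 2 * Real.log ((Fintype.card E : ℝ) ^ 12 / P.eps)⌉₊
  let X ← iterate (applyAndRevert P τ L G) t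
  return sInf {m : ℕ | (X.countP (fun x => x.getD m false) : ℝ) / t < 1 - P.eps}

/-- The while loop that builds the levels `i, i + 1, …` from `L i` and `G (i - 1)`, and finally sets
`T`. The first argument bounds the number of tests of the loop condition. Every pass makes `L`
strictly smaller (the first sampled element is always accepted, and then its marginal density is
`0`), so the bound `|L i| + 1`, used below, is never exhausted. -/
noncomputable def buildLevels (P : Params E) (τ : ℝ) :
    ℕ → ℕ → LevelData E → QueryAlg E (LevelData E)
  | 0, i, s => pure { s with T := i - 1 }
  | fuel + 1, i, s =>
    if s.L i = ∅ then pure { s with T := i - 1 }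
    else do
      let buck ← bucketize P τ (s.L i) (s.G (i - 1))
      let b := largestBucket buck
      let Bi := buck b
      let τi := (1 + P.eps) ^ b.1 * τ
      let m ← calcSampleSize P τi Bi (s.G (i - 1))
      -- the first `m` entries of a random order: a uniform sequence of `m` distinct elements
      let l ← randomOrder Bi
      let r ← addGreedily P τi (s.G (i - 1)) (l.take m)
      let Gi := r.2
      let Lnext ← filterDense P τ (s.L i) Gi
      buildLevels P τ fuel (i + 1)
        { s with
          B := Function.update s.B i Bi
          G := Function.update s.G i Gi
          L := Function.update s.L (i + 1) Lnext
          Lbar := Function.update s.Lbar (i + 1) Lnext }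

/-- Rebuilds the levels from level `i` on. -/
noncomputable def reconstruct (P : Params E) (τ : ℝ) (i : ℕ) (s : LevelData E) :
    QueryAlg E (LevelData E) :=
  let Li := s.Lbar i \ s.D
  buildLevels P τ (Li.card + 1) i
    { s with L := Function.update s.L i Li, Lbar := Function.update s.Lbar i Li }

/-- The loop of an insertion, from level `i` on; the first argument is the number of levels left. -/
noncomputable def insertLoop (P : Params E) (τ : ℝ) (e : E) :
    ℕ → ℕ → LevelData E → QueryAlg E (LevelData E)
  | 0, _, s => pure s
  | k + 1, i, s => do
    let d ← density P e (s.G (i - 1))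
    if d < τ then
      return s
    else
      let s1 : LevelData E := { s with Lbar := Function.update s.Lbar i (insert e (s.Lbar i)) }
      if i = s1.T + 1 ∨ (3 / 2 : ℝ) * (s1.L i).card ≤ (s1.Lbar i).card then
        reconstruct P τ i s1
      else
        insertLoop P τ e k (i + 1) s1

/-- Insertion of `e` into one run: a loop over the levels `1, …, T + 1`. -/
noncomputable def insertElem (P : Params E) (τ : ℝ) (e : E) (s : LevelData E) :
    QueryAlg E (LevelData E) :=
  insertLoop P τ e (s.T + 1) 1
    { s with D := s.D.erase e, Lbar := Function.update s.Lbar 0 (insert e (s.Lbar 0)) }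

/-- The loop of a deletion, from level `i` on; the first argument is the number of levels left. -/
noncomputable def deleteLoop (P : Params E) (τ : ℝ) :
    ℕ → ℕ → LevelData E → QueryAlg E (LevelData E)
  | 0, _, s => pure s
  | k + 1, i, s =>
    if P.epsDel * ((s.B i).card : ℝ) ≤ ((s.D ∩ s.B i).card : ℝ) then
      reconstruct P τ i s
    else
      deleteLoop P τ k (i + 1) s

/-- Deletion of `e` from one run: a loop over the levels `1, …, T`. -/
noncomputable def deleteElem (P : Params E) (τ : ℝ) (e : E) (s : LevelData E) :
    QueryAlg E (LevelData E) :=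
  deleteLoop P τ s.T 1 { s with D := insert e s.D }

end Algorithm

/-- An update of the set of present elements. -/
inductive Update (E : Type)
  | ins (e : E) : Update E
  | del (e : E) : Update E

/-- The state of the whole algorithm: the set `V` of present elements and the parallel runs. Run `i`
has threshold `τ = (1 + ε) ^ i`. -/
structure State (E : Type) where
  V : Finset E
  inst : ℤ → LevelData E

/-- The state before the first update. -/
def State.start (E : Type) : State E := ⟨∅, fun _ => LevelData.empty E⟩

/-- The element concerned by an update. -/
def Update.elem {E : Type} : Update E → E
  | .ins e => e
  | .del e => e

section Parallel

variable {E : Type} [Fintype E] [DecidableEq E]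

/-- The set of present elements after an update. -/
def Update.applySet (u : Update E) (V : Finset E) : Finset E :=
  match u with
  | .ins e => insert e V
  | .del e => V.erase e

/-- The effect of an update on one run. -/
noncomputable def Update.applyRun (P : Params E) (τ : ℝ) (u : Update E) (s : LevelData E) :
    QueryAlg E (LevelData E) :=
  match u with
  | .ins e => insertElem P τ e s
  | .del e => deleteElem P τ e s

/-- The runs that are concerned by an element of density `d`: the integers `i` with
`log_{1+ε} (d ε / (n ρ (1 + ε))) ≤ i ≤ log_{1+ε} d`; there are none if `d = 0`. -/
noncomputable def relevantRuns (P : Params E) (d : ℝ) : Finset ℤ :=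
  if 0 < d then
    Finset.Icc
      ⌈Real.logb (1 + P.eps) (d * P.eps / ((Fintype.card E : ℝ) * P.rho * (1 + P.eps)))⌉
      ⌊Real.logb (1 + P.eps) d⌋
  else ∅

/-- An update: the density `d(e) = f({e}) / w(e)` is queried, and the relevant runs are updated. -/
noncomputable def globalUpdate (P : Params E) (u : Update E) (s : State E) :
    QueryAlg E (State E) := do
  let a ← ask {u.elem}
  (relevantRuns P (a / P.w u.elem)).toList.foldlM (fun s1 i => do
    let r ← u.applyRun P ((1 + P.eps) ^ i) (s1.inst i)
    return { s1 with inst := Function.update s1.inst i r }) { s with V := u.applySet s.V }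

/-- The cost of a set. -/
noncomputable def cost (P : Params E) (S : Finset E) : ℝ := ∑ e ∈ S, P.w e

/-- Retrieval of the solution: among the runs `i` between `⌊log_{1+ε} (f(V) ε / (|V| ρ))⌋` and
`⌊log_{1+ε} (f(V) ε)⌋` with `f(G_T) ≥ (1 - ε) f(V)`, one for which `G_T \ D` has the lowest cost.
If `V` is empty or `f(V) = 0`, the solution is empty. -/
noncomputable def retrieve (P : Params E) (s : State E) : QueryAlg E (Finset E) := do
  let v ← ask s.V
  if s.V.Nonempty ∧ 0 < v then
    let best ← (Finset.Icc
        ⌊Real.logb (1 + P.eps) (v * P.eps / ((s.V.card : ℝ) * P.rho))⌋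
        ⌊Real.logb (1 + P.eps) (v * P.eps)⌋).toList.foldlM
      (fun (best : Option (Finset E)) i => do
        let GT := (s.inst i).G (s.inst i).T
        let sol := GT \ (s.inst i).D
        let g ← ask GT
        return if (1 - P.eps) * v ≤ g ∧ ∀ S ∈ best, cost P sol < cost P S then some sol else best)
      none
    return best.getD ∅
  else
    return ∅

/-- Runs the algorithm from the state `s` on a sequence of updates: after each update the solution
is retrieved. The result is the list of these solutions. -/
noncomputable def dynamicCover (P : Params E) :
    List (Update E) → State E → QueryAlg E (List (Finset E))
  | [], _ => pure []
  | u :: us, s => do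
    let s1 ← globalUpdate P u s
    let sol ← retrieve P s1
    let rest ← dynamicCover P us s1
    return sol :: rest

end Parallel

end SubmodularCover

/-! The cost is amortized within each run, and the amortized cost of an update is proportional to
the number of levels of the run, so the expected number of levels must be bounded at every fixed
time.

One pass shrinks a potential. After the first `m` elements of a random order of a bucket have been
processed, none of them is dense any more, and the next element is uniform among the others. Hence
the expected number of survivors is at most the bucket size times the probability that position `m`
is accepted (`avg_survivors_le`). The simulations choose an `m` for which this probability is at
most `1 - ε/8` on average (`expect_acceptProb_le`, by an exponential moment and a union bound). Give
each element one more than the first coordinate of its bucket. An element of the sampled bucket that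
does not survive loses at least one unit. As the largest of `κ ^ 2` buckets is sampled, the
potential drops in expectation by a factor `1 - 1 / D` with `D = 12 κ ^ 3 / ε`
(`expect_potential_add_le`). Summing over passes, a reconstruction costs a polylogarithmic number of
queries per element (`cost_reconstruct_le`).

Reconstructions are paid by credits: elements added to a level since it was built pay when the level
has grown by half, and deleted elements of its bucket pay when they form an `ε_del` fraction of it.
The latter is the source of the factor `1 / ε_del`. An update deposits a bounded credit on each
level (`expect_applyRun_le`).

For the number of levels, conditioning on the history is the difficulty: level `i` may have been
built long ago, and its survival could bias the set selected there. It does not, by deferred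
decisions. The updates being fixed in advance, what happens at levels up to `i` never reads `G i`; a
rebuild from a level `≤ i` draws it afresh, and work above `i` leaves it alone. So redrawing `G i`
at the end does not change the law of levels up to `i` (`expect_runSeq_resample`). The expected
potential therefore decays geometrically in the level at every time, and a nonempty level has
potential at least one, which gives `O(D log (n κ))` expected levels (`expect_T_le`). An update
reaches at most `κ` runs, each of which, seen alone, processes its own subsequence of the updates
(`expect_globalSeq_marginal`). Multiplying the bounds yields the polynomial. -/

open scoped ENNReal
set_option linter.unusedSectionVars false

/-! ### Expectation calculus for query algorithms and random orders -/

namespace QueryAlg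

section Expectation

variable {E α β : Type} [DecidableEq E]

/-- The average of `g` over the orderings of `S`. -/
noncomputable def avgOrder (S : Finset E) (g : List E → ℝ≥0∞) : ℝ≥0∞ :=
  ((orderings S).card : ℝ≥0∞)⁻¹ * ∑ l ∈ orderings S, g l

/-- Expected number of oracle calls, each counted `c` times, plus the expectation of `g` at the
result. -/
noncomputable def expect (f : Finset E → ℝ) (c : ℝ≥0∞) : QueryAlg E α → (α → ℝ≥0∞) → ℝ≥0∞
  | ret a, g => g a
  | query S k, g => c + expect f c (k (f S)) g
  | shuffle S k, g => avgOrder S fun l => expect f c (k l) g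

/-- `Q` holds for every possible result. -/
def All (f : Finset E → ℝ) : QueryAlg E α → (α → Prop) → Prop
  | ret a, Q => Q a
  | query S k, Q => All f (k (f S)) Q
  | shuffle S k, Q => ∀ l ∈ orderings S, All f (k l) Q

theorem mem_orderings {S : Finset E} {l : List E} : l ∈ orderings S ↔ (l : Multiset E) = S.val := by
  simp [orderings, Multiset.mem_lists_iff, eq_comm]

theorem mem_of_mem_orderings {S : Finset E} {l : List E} (h : l ∈ orderings S) {e : E} :
    e ∈ l ↔ e ∈ S := by
  rw [← Multiset.mem_coe, mem_orderings.1 h]; rfl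

theorem length_of_mem_orderings {S : Finset E} {l : List E} (h : l ∈ orderings S) :
    l.length = S.card := by
  rw [← Multiset.coe_card, mem_orderings.1 h]; rfl

theorem card_orderings_ne_zero (S : Finset E) : ((orderings S).card : ℝ≥0∞) ≠ 0 := by
  simpa using (orderings_nonempty S).ne_empty

theorem avgOrder_mono {S : Finset E} {g h : List E → ℝ≥0∞} (H : ∀ l ∈ orderings S, g l ≤ h l) :
    avgOrder S g ≤ avgOrder S h := by
  unfold avgOrder; gcongr with l hl; exact H l hl

theorem avgOrder_congr {S : Finset E} {g h : List E → ℝ≥0∞} (H : ∀ l ∈ orderings S, g l = h l) :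
    avgOrder S g = avgOrder S h := by
  unfold avgOrder; rw [Finset.sum_congr rfl H]

@[simp] theorem avgOrder_const (S : Finset E) (a : ℝ≥0∞) : avgOrder S (fun _ => a) = a := by
  rw [avgOrder, Finset.sum_const, nsmul_eq_mul, ← mul_assoc,
    ENNReal.inv_mul_cancel (card_orderings_ne_zero S) (by simp), one_mul]

theorem avgOrder_add (S : Finset E) (g h : List E → ℝ≥0∞) :
    avgOrder S (fun l => g l + h l) = avgOrder S g + avgOrder S h := by
  simp [avgOrder, Finset.sum_add_distrib, mul_add]

theorem avgOrder_mul_left (S : Finset E) (a : ℝ≥0∞) (g : List E → ℝ≥0∞) :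
    avgOrder S (fun l => a * g l) = a * avgOrder S g := by
  simp only [avgOrder, ← Finset.mul_sum]; ring

theorem avgOrder_tsum {ι : Type*} (S : Finset E) (g : ι → List E → ℝ≥0∞) :
    avgOrder S (fun l => ∑' i, g i l) = ∑' i, avgOrder S (g i) := by
  simp only [avgOrder]
  rw [ENNReal.tsum_mul_left, Summable.tsum_finsetSum fun _ _ => ENNReal.summable]

variable (f : Finset E → ℝ) (c : ℝ≥0∞)

@[simp] theorem expect_pure (a : α) (g : α → ℝ≥0∞) :
    expect f c (pure a : QueryAlg E α) g = g a := rfl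

@[simp] theorem expect_bind (p : QueryAlg E α) (k : α → QueryAlg E β) (g : β → ℝ≥0∞) :
    expect f c (p >>= k) g = expect f c p fun a => expect f c (k a) g := by
  change expect f c (bind p k) g = _
  induction p with
  | ret a => rfl
  | query S q ih => simp only [bind, expect, ih]
  | shuffle S q ih => simp only [bind, expect, ih]

@[simp] theorem expect_ask (S : Finset E) (g : ℝ → ℝ≥0∞) :
    expect f c (ask S) g = c + g (f S) := rfl

@[simp] theorem expect_randomOrder (S : Finset E) (g : List E → ℝ≥0∞) :
    expect f c (randomOrder S) g = avgOrder S g := rfl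

@[simp] theorem all_pure (a : α) (Q : α → Prop) : All f (pure a : QueryAlg E α) Q ↔ Q a := Iff.rfl

@[simp] theorem all_bind (p : QueryAlg E α) (k : α → QueryAlg E β) (Q : β → Prop) :
    All f (p >>= k) Q ↔ All f p fun a => All f (k a) Q := by
  change All f (bind p k) Q ↔ _
  induction p with
  | ret a => rfl
  | query S q ih => simp only [bind, All, ih]
  | shuffle S q ih => simp only [bind, All, ih]

@[simp] theorem all_randomOrder (S : Finset E) (Q : List E → Prop) :
    All f (randomOrder S) Q ↔ ∀ l ∈ orderings S, Q l := Iff.rfl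

variable {f c}

theorem All.mono {p : QueryAlg E α} {Q R : α → Prop} (h : All f p Q) (H : ∀ a, Q a → R a) :
    All f p R := by
  induction p with
  | ret a => exact H a h
  | query S q ih => exact ih _ h
  | shuffle S q ih => exact fun l hl => ih l (h l hl)

theorem All.and {p : QueryAlg E α} {Q R : α → Prop} (h : All f p Q) (h' : All f p R) :
    All f p (fun a => Q a ∧ R a) := by
  induction p with
  | ret a => exact ⟨h, h'⟩
  | query S q ih => exact ih _ h h'
  | shuffle S q ih => exact fun l hl => ih l (h l hl) (h' l hl)

theorem all_of_forall {p : QueryAlg E α} {Q : α → Prop} (H : ∀ a, Q a) : All f p Q := by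
  induction p with
  | ret a => exact H a
  | query S q ih => exact ih _
  | shuffle S q ih => exact fun l _ => ih l

theorem All.expect_le {p : QueryAlg E α} {g h : α → ℝ≥0∞} (H : All f p fun a => g a ≤ h a) :
    expect f c p g ≤ expect f c p h := by
  induction p with
  | ret a => exact H
  | query S q ih => exact add_le_add le_rfl (ih _ H)
  | shuffle S q ih => exact avgOrder_mono fun l hl => ih l (H l hl)

theorem expect_mono {p : QueryAlg E α} {g h : α → ℝ≥0∞} (H : ∀ a, g a ≤ h a) :
    expect f c p g ≤ expect f c p h := (all_of_forall H).expect_le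

theorem All.expect_eq {p : QueryAlg E α} {g h : α → ℝ≥0∞} (H : All f p fun a => g a = h a) :
    expect f c p g = expect f c p h :=
  le_antisymm (H.mono fun _ h => h.le).expect_le (H.mono fun _ h => h.ge).expect_le

variable (f c)

theorem expect_const (p : QueryAlg E α) (a : ℝ≥0∞) : expect f 0 p (fun _ => a) = a := by
  induction p with
  | ret => rfl
  | query S q ih => simp only [expect, ih, zero_add]
  | shuffle S q ih => simp only [expect, ih, avgOrder_const]

/-- The queries may be charged only once, hence the price `0` in the second summand. This separates
the cost of a program from the expectation of what follows it. -/
theorem expect_add (p : QueryAlg E α) (g h : α → ℝ≥0∞) :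
    expect f c p (fun a => g a + h a) = expect f c p g + expect f 0 p h := by
  induction p with
  | ret => rfl
  | query S q ih => simp only [expect, ih, zero_add, add_assoc]
  | shuffle S q ih => simp only [expect, ih, avgOrder_add]

theorem expect_eq_cost_add (p : QueryAlg E α) (g : α → ℝ≥0∞) :
    expect f c p g = expect f c p 0 + expect f 0 p g := by
  rw [← expect_add]; simp

theorem expect_add_const (p : QueryAlg E α) (g : α → ℝ≥0∞) (a : ℝ≥0∞) :
    expect f c p (fun x => g x + a) = expect f c p g + a := by
  rw [expect_add, expect_const]

theorem expect_mul_left (p : QueryAlg E α) (a : ℝ≥0∞) (g : α → ℝ≥0∞) :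
    expect f 0 p (fun x => a * g x) = a * expect f 0 p g := by
  induction p with
  | ret => rfl
  | query S q ih => simp only [expect, ih, zero_add]
  | shuffle S q ih => simp only [expect, ih, avgOrder_mul_left]

theorem expect_tsum {ι : Type*} (p : QueryAlg E α) (g : ι → α → ℝ≥0∞) :
    expect f 0 p (fun x => ∑' i, g i x) = ∑' i, expect f 0 p (g i) := by
  induction p with
  | ret => rfl
  | query S q ih => simp only [expect, ih, zero_add]
  | shuffle S q ih => simp only [expect, ih, avgOrder_tsum]

theorem expect_sum {ι : Type*} (p : QueryAlg E α) (s : Finset ι) (g : ι → α → ℝ≥0∞) :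
    expect f 0 p (fun x => ∑ i ∈ s, g i x) = ∑ i ∈ s, expect f 0 p (g i) := by
  classical
  induction s using Finset.induction_on with
  | empty => simpa using expect_const f p 0
  | insert i s hi ih => simp only [Finset.sum_insert hi, expect_add, ih]

theorem tsum_pmf_map {α β : Type*} (μ : PMF α) (φ : α → β) (h : β → ℝ≥0∞) :
    ∑' y, (μ.map φ) y * h y = ∑' x, μ x * h (φ x) := by
  classical
  simp only [PMF.map_apply, ← ENNReal.tsum_mul_right]
  rw [ENNReal.tsum_comm]
  refine tsum_congr fun x => ?_
  rw [tsum_eq_single (φ x) (by intro y hy; simp [hy])]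
  simp

/-- The only bridge to the probabilistic semantics: from here on, the recursion `expect` replaces
the joint law of result and query count. -/
theorem tsum_run_mul (p : QueryAlg E α) (g : α → ℝ≥0∞) :
    ∑' x : α × ℕ, run f p x * (g x.1 + c * x.2) = expect f c p g := by
  induction p with
  | ret a =>
    classical
    rw [tsum_eq_single (a, 0) (by intro y hy; simp [run, PMF.pure_apply, hy])]
    simp [run, expect, PMF.pure_apply]
  | query S k ih =>
    simp only [run, expect, ← ih, tsum_pmf_map]
    have : ∀ x : α × ℕ, run f (k (f S)) x * (g x.1 + c * ((x.2 + 1 : ℕ) : ℝ≥0∞))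
        = c * run f (k (f S)) x + run f (k (f S)) x * (g x.1 + c * x.2) := by
      intro x; push_cast; ring
    rw [tsum_congr this, ENNReal.tsum_add, ENNReal.tsum_mul_left, PMF.tsum_coe, mul_one]
  | shuffle S k ih =>
    simp only [run, expect, ← ih, PMF.bind_apply, ← ENNReal.tsum_mul_right]
    rw [ENNReal.tsum_comm]
    simp only [mul_assoc, ENNReal.tsum_mul_left, avgOrder, Finset.mul_sum]
    rw [tsum_eq_sum (s := orderings S)
      (by intro l hl; rw [PMF.uniformOfFinset_apply_of_notMem _ hl, zero_mul])]
    exact Finset.sum_congr rfl fun l hl => by rw [PMF.uniformOfFinset_apply_of_mem _ hl]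

theorem expectedQueries_eq (p : QueryAlg E α) : expectedQueries f p = expect f 1 p 0 := by
  rw [← tsum_run_mul]; simp [expectedQueries]

/-- Splitting by the head of the list is a bijection onto pairs of a first element and an ordering
of the rest. -/
theorem orderings_sum {S : Finset E} (hS : S.Nonempty) {M : Type*} [AddCommMonoid M]
    (g : List E → M) :
    ∑ l ∈ orderings S, g l = ∑ e ∈ S, ∑ l ∈ orderings (S.erase e), g (e :: l) := by
  rw [Finset.sum_sigma']
  symm
  refine Finset.sum_bij (fun x _ => x.1 :: x.2) ?_ ?_ ?_ ?_
  · rintro ⟨e, l⟩ h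
    simp only [Finset.mem_sigma, mem_orderings] at h ⊢
    rw [← Multiset.cons_coe, h.2, Finset.erase_val]
    exact Multiset.cons_erase h.1
  · rintro ⟨e, l⟩ _ ⟨e', l'⟩ _ h
    simp only [List.cons.injEq] at h
    simp [h.1, h.2]
  · rintro l h
    rcases l with _ | ⟨e, l⟩
    · have := length_of_mem_orderings h
      simp [eq_comm, hS.ne_empty] at this
    · refine ⟨⟨e, l⟩, ?_, rfl⟩
      have he : e ∈ S := (mem_of_mem_orderings h).1 (by simp)
      simp only [Finset.mem_sigma, he, true_and, mem_orderings, Finset.erase_val]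
      rw [← mem_orderings.1 h, ← Multiset.cons_coe, Multiset.erase_cons_head]
  · intros; rfl

theorem card_orderings (S : Finset E) : (orderings S).card = S.card.factorial := by
  induction h : S.card generalizing S with
  | zero =>
    rw [Finset.card_eq_zero.1 h]
    exact Finset.card_eq_one.2 ⟨[], by ext l; simp [mem_orderings]⟩
  | succ n ih =>
    have hS : S.Nonempty := by rw [← Finset.card_pos]; omega
    rw [Finset.card_eq_sum_ones, orderings_sum hS]
    simp only [← Finset.card_eq_sum_ones]
    rw [Finset.sum_congr rfl fun e he => ih (S.erase e) (by rw [Finset.card_erase_of_mem he]; omega)]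
    simp [h, Nat.factorial_succ]

/-- Conditioning on the first element: it is uniform in `S`, and the remaining order is uniform
given it. -/
theorem avgOrder_cons {S : Finset E} (hS : S.Nonempty) (g : List E → ℝ≥0∞) :
    avgOrder S g = (S.card : ℝ≥0∞)⁻¹ * ∑ e ∈ S, avgOrder (S.erase e) fun l => g (e :: l) := by
  simp only [avgOrder, orderings_sum hS, card_orderings]
  obtain ⟨n, hn⟩ : ∃ n, S.card = n + 1 := Nat.exists_eq_succ_of_ne_zero hS.card_ne_zero
  have : ∀ e ∈ S, (S.erase e).card = n := fun e he => by rw [Finset.card_erase_of_mem he]; omega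
  have h : ∑ e ∈ S, ((S.erase e).card.factorial : ℝ≥0∞)⁻¹ * ∑ l ∈ orderings (S.erase e), g (e :: l)
      = (n.factorial : ℝ≥0∞)⁻¹ * ∑ e ∈ S, ∑ l ∈ orderings (S.erase e), g (e :: l) := by
    rw [Finset.mul_sum]
    exact Finset.sum_congr rfl fun e he => by rw [this e he]
  rw [h, ← mul_assoc, hn, Nat.factorial_succ, Nat.cast_mul, ENNReal.mul_inv (by simp) (by simp)]

end Expectation

end QueryAlg

/-! ### Deterministic programs and independent repetitions -/

namespace QueryAlg

variable {E α β γ : Type} [DecidableEq E] {f : Finset E → ℝ}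

/-- `p` has the single possible result `a` and makes `n` oracle calls. -/
def Computes (f : Finset E → ℝ) (p : QueryAlg E α) (n : ℕ) (a : α) : Prop :=
  (∀ c g, expect f c p g = n * c + g a) ∧ ∀ Q, All f p Q ↔ Q a

theorem Computes.pure (a : α) : Computes f (pure a : QueryAlg E α) 0 a :=
  ⟨fun c g => by simp, fun Q => Iff.rfl⟩

theorem Computes.ask (S : Finset E) : Computes f (ask S) 1 (f S) :=
  ⟨fun c g => by simp, fun Q => Iff.rfl⟩

theorem Computes.bind {p : QueryAlg E α} {k : α → QueryAlg E β} {n m : ℕ} {a : α} {b : β}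
    (hp : Computes f p n a) (hk : Computes f (k a) m b) : Computes f (p >>= k) (n + m) b :=
  ⟨fun c g => by rw [expect_bind, hp.1, hk.1]; push_cast; ring,
    fun Q => by rw [all_bind, hp.2, hk.2]⟩

theorem Computes.foldlM {F : β → γ → QueryAlg E β} {n : ℕ} {G : β → γ → β}
    (h : ∀ b x, Computes f (F b x) n (G b x)) (l : List γ) (b : β) :
    Computes f (l.foldlM F b) (n * l.length) (l.foldl G b) := by
  induction l generalizing b with
  | nil => exact .pure b
  | cons x l ih =>
    have := (h b x).bind (k := fun b => l.foldlM F b) (ih _)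
    rw [List.foldlM_cons]
    rwa [List.foldl_cons, List.length_cons, mul_add, mul_one, add_comm]

theorem expect_iterate_nil (p : QueryAlg E α) (c : ℝ≥0∞) (g : List α → ℝ≥0∞) :
    expect f c (iterate p 0) g = g [] := rfl

theorem expect_iterate_succ (p : QueryAlg E α) (t : ℕ) (c : ℝ≥0∞) (g : List α → ℝ≥0∞) :
    expect f c (iterate p (t + 1)) g
      = expect f c p fun x => expect f c (iterate p t) fun xs => g (x :: xs) := by
  simp [iterate]

theorem all_iterate {p : QueryAlg E α} {Q : α → Prop} (h : All f p Q) (t : ℕ) :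
    All f (iterate p t) fun X => X.length = t ∧ ∀ x ∈ X, Q x := by
  induction t with
  | zero => simp [iterate]
  | succ t ih =>
    simp only [iterate, all_bind, all_pure]
    refine h.mono fun x hx => ih.mono fun X hX => ?_
    simp [hX.1, hx]; exact hX.2

/-- Independence, in the form needed for the exponential-moment bound on the simulations. -/
theorem expect_iterate_prod (p : QueryAlg E α) (h : α → ℝ≥0∞) (t : ℕ) :
    expect f 0 (iterate p t) (fun X => (X.map h).prod) = expect f 0 p h ^ t := by
  induction t with
  | zero => simp [expect_iterate_nil]
  | succ t ih =>
    simp only [expect_iterate_succ, List.map_cons, List.prod_cons, expect_mul_left, ih]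
    simp only [mul_comm (h _), expect_mul_left, pow_succ]

theorem cost_iterate (p : QueryAlg E α) (c : ℝ≥0∞) (t : ℕ) :
    expect f c (iterate p t) 0 = t * expect f c p 0 := by
  induction t with
  | zero => simp [expect_iterate_nil]
  | succ t ih =>
    rw [expect_iterate_succ]
    have : (fun x : α => expect f c (iterate p t) fun xs => (0 : List α → ℝ≥0∞) (x :: xs))
        = fun x => (0 : α → ℝ≥0∞) x + t * expect f c p 0 := by
      funext x; rw [← ih]; simp; rfl
    rw [this, expect_add_const]; push_cast; ring

end QueryAlg

/-! ### Deterministic counterparts of the subroutines and their query counts -/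

namespace SubmodularCover

open QueryAlg

section Pure

variable {E : Type} [DecidableEq E] (f : Finset E → ℝ) (P : Params E)

/-- The marginal density `d(e | G)`. -/
noncomputable def dens (e : E) (G : Finset E) : ℝ := (f (insert e G) - f G) / P.w e

/-- The index of the bucket of `e`. -/
noncomputable def bucketIndex (τ : ℝ) (G : Finset E) (e : E) : ℤ × ℤ :=
  (⌊Real.logb (1 + P.eps) (dens f P e G / τ)⌋, ⌊Real.logb (1 + P.eps) (P.w e)⌋)

/-- The buckets of `L`. -/
noncomputable def buckets (τ : ℝ) (L G : Finset E) (b : ℤ × ℤ) : Finset E :=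
  L.filter fun e => bucketIndex f P τ G e = b

/-- The index of the bucket that is sampled from. -/
noncomputable def topIndex (τ : ℝ) (L G : Finset E) : ℤ × ℤ := largestBucket (buckets f P τ L G)

/-- The bucket that is sampled from. -/
noncomputable def topBucket (τ : ℝ) (L G : Finset E) : Finset E :=
  buckets f P τ L G (topIndex f P τ L G)

/-- The threshold of the bucket that is sampled from. -/
noncomputable def topThreshold (τ : ℝ) (L G : Finset E) : ℝ :=
  (1 + P.eps) ^ (topIndex f P τ L G).1 * τ

/-- The accept / reject decisions along a list and the final set. -/
noncomputable def greedy (τ : ℝ) : Finset E → List E → List Bool × Finset E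
  | G, [] => ([], G)
  | G, e :: es =>
    if τ ≤ dens f P e G then
      (true :: (greedy τ (insert e G) es).1, (greedy τ (insert e G) es).2)
    else (false :: (greedy τ G es).1, (greedy τ G es).2)

variable {f P}

theorem computes_density (e : E) (G : Finset E) : Computes f (density P e G) 2 (dens f P e G) :=
  (Computes.ask (insert e G)).bind
    (k := fun a => do let b ← ask G; return (a - b) / P.w e)
    ((Computes.ask G).bind (k := fun b => pure ((f (insert e G) - b) / P.w e)) (.pure _))

theorem foldl_filter (Q : E → Prop) [DecidablePred Q] (l : List E) (S : Finset E) :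
    l.foldl (fun acc e => if Q e then insert e acc else acc) S = S ∪ l.toFinset.filter Q := by
  induction l generalizing S with
  | nil => simp
  | cons e l ih =>
    rw [List.foldl_cons, ih, List.toFinset_cons, Finset.filter_insert]
    split_ifs <;> simp [Finset.insert_union]

theorem computes_filterDense (τ : ℝ) (L G : Finset E) :
    Computes f (filterDense P τ L G) (2 * L.card) (L.filter fun e => τ ≤ dens f P e G) := by
  have := Computes.foldlM (f := f)
    (F := fun (acc : Finset E) e => do
      let d ← density P e G
      return if τ ≤ d then insert e acc else acc)
    (G := fun acc e => if τ ≤ dens f P e G then insert e acc else acc)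
    (fun b x => (computes_density x G).bind (.pure _)) L.toList ∅
  rw [foldl_filter] at this
  simpa [filterDense] using this

theorem foldl_update {ι : Type} [DecidableEq ι] (h : E → ι) (l : List E) (buck : ι → Finset E) :
    l.foldl (fun buck e => Function.update buck (h e) (insert e (buck (h e)))) buck
      = fun b => buck b ∪ l.toFinset.filter fun e => h e = b := by
  induction l generalizing buck with
  | nil => simp
  | cons e l ih =>
    rw [List.foldl_cons, ih]
    funext b
    rw [List.toFinset_cons, Finset.filter_insert]
    by_cases hb : h e = b
    · subst hb; simp [Finset.insert_union]
    · simp [hb, Function.update_of_ne (Ne.symm hb)]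

theorem computes_bucketize (τ : ℝ) (L G : Finset E) :
    Computes f (bucketize P τ L G) (2 * L.card) (buckets f P τ L G) := by
  have := Computes.foldlM (f := f)
    (F := fun (buck : ℤ × ℤ → Finset E) e => do
      let d ← density P e G
      let j := ⌊Real.logb (1 + P.eps) (d / τ)⌋
      let k := ⌊Real.logb (1 + P.eps) (P.w e)⌋
      return Function.update buck (j, k) (insert e (buck (j, k))))
    (G := fun buck e => Function.update buck (bucketIndex f P τ G e)
      (insert e (buck (bucketIndex f P τ G e))))
    (fun b x => (computes_density x G).bind (.pure _)) L.toList fun _ => ∅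
  rw [foldl_update] at this
  have h : (fun b => (fun _ => ∅ : ℤ × ℤ → Finset E) b ∪
      L.toList.toFinset.filter fun e => bucketIndex f P τ G e = b) = buckets f P τ L G := by
    funext b; simp [buckets]
  rw [h] at this
  simpa [bucketize] using this

theorem computes_addGreedily (τ : ℝ) (G : Finset E) (l : List E) :
    Computes f (addGreedily P τ G l) (2 * l.length) (greedy f P τ G l) := by
  induction l generalizing G with
  | nil => exact .pure _
  | cons e l ih =>
    rw [List.length_cons, mul_add, add_comm]
    unfold addGreedily greedy
    refine (computes_density e G).bind ?_
    split_ifs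
    · exact (ih _).bind (k := fun r => pure (true :: r.1, r.2)) (.pure _)
    · exact (ih _).bind (k := fun r => pure (false :: r.1, r.2)) (.pure _)

theorem length_greedy (τ : ℝ) (G : Finset E) (l : List E) :
    (greedy f P τ G l).1.length = l.length := by
  induction l generalizing G with
  | nil => rfl
  | cons e l ih => unfold greedy; split_ifs <;> simp [ih]

theorem subset_greedy (τ : ℝ) (G : Finset E) (l : List E) : G ⊆ (greedy f P τ G l).2 := by
  induction l generalizing G with
  | nil => exact subset_rfl
  | cons e l ih =>
    unfold greedy; split_ifs
    · exact (Finset.subset_insert e G).trans (ih _)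
    · exact ih _

end Pure

end SubmodularCover

/-! ### Sample size: survivors, acceptance probabilities and concentration -/

namespace SubmodularCover

open QueryAlg

section Sampling

variable {E : Type} [Fintype E] [DecidableEq E] {f : Finset E → ℝ} {P : Params E} {τ : ℝ}

/-- The standing assumptions on the instance. -/
structure Admissible (f : Finset E → ℝ) (P : Params E) : Prop where
  nonneg : ∀ A, 0 ≤ f A
  mono : ∀ A B, A ⊆ B → f A ≤ f B
  submod : ∀ A B, f (A ∪ B) + f (A ∩ B) ≤ f A + f B
  weight : ∀ e, 1 ≤ P.w e ∧ P.w e ≤ P.rho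
  eps_pos : 0 < P.eps
  eps_lt : P.eps < 1 / 10
  del_pos : 0 < P.epsDel
  del_lt : P.epsDel < P.eps / 16

theorem dens_of_mem {e : E} {G : Finset E} (he : e ∈ G) : dens f P e G = 0 := by
  simp [dens, Finset.insert_eq_of_mem he]

namespace Admissible

variable (h : Admissible f P)
include h

theorem w_pos (e : E) : 0 < P.w e := by linarith [(h.weight e).1]

theorem dens_nonneg (e : E) (G : Finset E) : 0 ≤ dens f P e G :=
  div_nonneg (sub_nonneg.2 (h.mono _ _ (Finset.subset_insert e G))) (h.w_pos e).le

/-- Diminishing returns, from submodularity for `insert e G` and `G'`. If `e ∈ G'`, the left side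
vanishes and monotonicity is enough. -/
theorem dens_anti (e : E) {G G' : Finset E} (hG : G ⊆ G') : dens f P e G' ≤ dens f P e G := by
  by_cases he : e ∈ G'
  · rw [dens_of_mem he]; exact h.dens_nonneg e G
  · have := h.submod (insert e G) G'
    rw [Finset.insert_union, Finset.union_eq_right.2 hG, Finset.insert_inter_of_notMem he,
      Finset.inter_eq_left.2 hG] at this
    have hw := h.w_pos e
    unfold dens
    gcongr 1
    linarith

/-- Compare with the empty set; `f ∅` is only known to be nonnegative, so even at `G = ∅` this need
not be an equality. -/
theorem dens_le (e : E) (G : Finset E) : dens f P e G ≤ f {e} / P.w e := by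
  refine (h.dens_anti e (Finset.empty_subset G)).trans ?_
  have hw := h.w_pos e
  unfold dens
  gcongr 1
  simpa using h.nonneg ∅

end Admissible

/-- The probability that the element at position `m` of a random order of `S` is accepted. -/
noncomputable def acceptProb (f : Finset E → ℝ) (P : Params E) (τ : ℝ) (S G : Finset E) (m : ℕ) :
    ℝ≥0∞ :=
  avgOrder S fun l => if (greedy f P τ G l).1.getD m false then 1 else 0

/-- An examined element is never dense afterwards, so survivors lie among the `|S| - m` unexamined
elements. The next element of the order is uniform among these, and it is accepted exactly when it
is dense. The induction peels off the first element; for `m = 0` both sides count the dense elements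
of `S`. -/
theorem avg_survivors_le (h : Admissible f P) (hτ : 0 < τ) (m : ℕ) (S G : Finset E) :
    avgOrder S (fun l =>
        ((S.filter fun e => τ ≤ dens f P e (greedy f P τ G (l.take m)).2).card : ℝ≥0∞))
      ≤ (S.card - m : ℕ) * acceptProb f P τ S G m := by
  induction m generalizing S G with
  | zero =>
    rcases S.eq_empty_or_nonempty with rfl | hS
    · simp only [Finset.filter_empty, Finset.card_empty, Nat.cast_zero, avgOrder_const, zero_le]
    have h0 : (S.card : ℝ≥0∞) ≠ 0 := by simpa using hS.ne_empty
    have h1 : ∀ e ∈ S, avgOrder (S.erase e) (fun l =>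
        if (greedy f P τ G (e :: l)).1.getD 0 false then (1 : ℝ≥0∞) else 0)
          = if τ ≤ dens f P e G then 1 else 0 := by
      intro e _
      rw [← avgOrder_const (S.erase e) (if τ ≤ dens f P e G then 1 else 0)]
      refine avgOrder_congr fun l _ => ?_
      unfold greedy
      split_ifs <;> simp_all
    have h2 : acceptProb f P τ S G 0
        = (S.card : ℝ≥0∞)⁻¹ * (S.filter fun e => τ ≤ dens f P e G).card := by
      rw [acceptProb, avgOrder_cons hS, Finset.sum_congr rfl h1]; simp
    rw [h2, Nat.sub_zero, ← mul_assoc, ENNReal.mul_inv_cancel h0 (by simp), one_mul]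
    simp [greedy]
  | succ m ih =>
    rcases S.eq_empty_or_nonempty with rfl | hS
    · simp
    rw [avgOrder_cons hS]
    have hR := avgOrder_cons hS fun l =>
      if (greedy f P τ G l).1.getD (m + 1) false then (1 : ℝ≥0∞) else 0
    rw [acceptProb, hR, mul_left_comm]
    refine le_of_le_of_eq ?_ (congrArg _ (Finset.mul_sum _ _ _).symm)
    refine mul_le_mul_right (Finset.sum_le_sum fun e he => ?_) _
    have hcard : (S.card - (m + 1)) = (S.erase e).card - m := by
      rw [Finset.card_erase_of_mem he]; omega
    -- The head `e` can be dropped from the survivors: its final density is `0` if it was accepted,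
    -- and below `τ` by `dens_anti` if it was rejected.
    have hfil : ∀ G' : Finset E, dens f P e G' < τ →
        (S.filter fun a => τ ≤ dens f P a G') = (S.erase e).filter fun a => τ ≤ dens f P a G' := by
      intro G' hG'
      ext a
      by_cases ha : a = e
      · subst ha; simp [hG']
      · simp [ha]
    rw [hcard]
    by_cases hd : τ ≤ dens f P e G
    · have h1 : ∀ l, greedy f P τ G (e :: l)
          = (true :: (greedy f P τ (insert e G) l).1, (greedy f P τ (insert e G) l).2) :=
        fun l => by rw [greedy, if_pos hd]
      simp only [List.take_succ_cons, h1, List.getD_cons_succ]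
      refine (avgOrder_mono fun l _ => ?_).trans (ih (S.erase e) (insert e G))
      rw [hfil]
      rw [dens_of_mem (subset_greedy _ _ _ (Finset.mem_insert_self _ _))]
      exact hτ
    · have h1 : ∀ l, greedy f P τ G (e :: l)
          = (false :: (greedy f P τ G l).1, (greedy f P τ G l).2) :=
        fun l => by rw [greedy, if_neg hd]
      simp only [List.take_succ_cons, h1, List.getD_cons_succ]
      refine (avgOrder_mono fun l _ => ?_).trans (ih (S.erase e) G)
      rw [hfil]
      exact (h.dens_anti e (subset_greedy _ _ _)).trans_lt (not_le.1 hd)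

theorem expect_applyAndRevert (S G : Finset E) (c : ℝ≥0∞) (g : List Bool → ℝ≥0∞) :
    expect f c (applyAndRevert P τ S G) g
      = 2 * S.card * c + avgOrder S fun l => g (greedy f P τ G l).1 := by
  have : avgOrder S (fun _ => 2 * S.card * c) = 2 * S.card * c := avgOrder_const _ _
  simp only [applyAndRevert, expect_bind, expect_randomOrder, expect_pure]
  rw [← this, ← avgOrder_add]
  refine avgOrder_congr fun l hl => ?_
  rw [(computes_addGreedily τ G l).1, length_of_mem_orderings hl]; push_cast; rfl

theorem all_applyAndRevert (S G : Finset E) :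
    All f (applyAndRevert P τ S G) fun x => ∃ l ∈ orderings S, x = (greedy f P τ G l).1 := by
  simp only [applyAndRevert, all_bind, all_randomOrder, all_pure]
  intro l hl
  rw [(computes_addGreedily τ G l).2]
  exact ⟨l, hl, rfl⟩

/-- The number of simulations. -/
noncomputable def simCount (E : Type) [Fintype E] (ε : ℝ) : ℕ :=
  ⌈4 / ε ^ 2 * Real.log ((Fintype.card E : ℝ) ^ 12 / ε)⌉₊

/-- The positions whose fraction of acceptances is too small. -/
def badPositions (ε : ℝ) (t : ℕ) (X : List (List Bool)) : Set ℕ :=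
  {m : ℕ | (X.countP (fun x => x.getD m false) : ℝ) / t < 1 - ε}

theorem calcSampleSize_eq (S G : Finset E) :
    calcSampleSize P τ S G =
      iterate (applyAndRevert P τ S G) (simCount E P.eps) >>= fun X =>
        pure (sInf (badPositions P.eps (simCount E P.eps) X)) := rfl

theorem log_simCount_pos (h : Admissible f P) [Nonempty E] :
    1 ≤ Real.log ((Fintype.card E : ℝ) ^ 12 / P.eps) := by
  have h0 := h.eps_pos
  have h1 := h.eps_lt
  have hn : (1 : ℝ) ≤ (Fintype.card E : ℝ) ^ 12 :=
    one_le_pow₀ (by exact_mod_cast Fintype.card_pos)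
  rw [Real.le_log_iff_exp_le (by positivity)]
  have : Real.exp 1 ≤ 3 := by linarith [Real.exp_one_lt_d9]
  rw [le_div_iff₀ h0]
  nlinarith

theorem simCount_ge (P : Params E) :
    4 / P.eps ^ 2 * Real.log ((Fintype.card E : ℝ) ^ 12 / P.eps) ≤ simCount E P.eps :=
  Nat.le_ceil _

theorem simCount_pos (h : Admissible f P) [Nonempty E] : 0 < simCount E P.eps := by
  have h0 := h.eps_pos
  have := log_simCount_pos h
  exact Nat.ceil_pos.2 (by positivity)

/-- Positions count from zero, so position `|S|` lies past the end of every decision list and reads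
the default `false`. The infimum defining the sample size is thus attained and at most `|S|`. -/
theorem card_mem_badPositions (h : Admissible f P) (S G : Finset E) (t : ℕ) {X : List (List Bool)}
    (hX : ∀ x ∈ X, ∃ l ∈ orderings S, x = (greedy f P τ G l).1) :
    S.card ∈ badPositions P.eps t X := by
  have : X.countP (fun x => x.getD S.card false) = 0 := by
    rw [List.countP_eq_zero]
    intro x hx
    obtain ⟨l, hl, rfl⟩ := hX x hx
    rw [List.getD_eq_default _ _ (by rw [length_greedy, length_of_mem_orderings hl])]
    simp
  simp only [badPositions, Set.mem_ofPred_eq, this]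
  have := h.eps_lt
  simp; linarith

-- Chernoff bound for stopping at a position that is almost surely accepted. Such a stop needs more
-- than `ε t` rejections, while each simulation rejects with probability below `ε / 4`.
open Classical in
theorem rejection_tail (h : Admissible f P) [Nonempty E] (S G : Finset E) (m : ℕ)
    (hm : 1 - ENNReal.ofReal (P.eps / 4) < acceptProb f P τ S G m) :
    expect f 0 (iterate (applyAndRevert P τ S G) (simCount E P.eps))
        (fun X => if m ∈ badPositions P.eps (simCount E P.eps) X then 1 else 0)
      ≤ ENNReal.ofReal (Real.exp (-(P.eps * simCount E P.eps / 2))) := by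
  set t := simCount E P.eps with ht
  have h0 := h.eps_pos
  have h1 := h.eps_lt
  have htpos : (0 : ℝ) < t := by exact_mod_cast simCount_pos h
  -- The base `3` exceeds `e`, so more than `ε t` rejections give a product above `exp (ε t)`; and
  -- the mean of `w` is `3 - 2 p`, at most `1 + ε / 2` for `p ≥ 1 - ε / 4`.
  let w : List Bool → ℝ≥0∞ := fun x => if x.getD m false then 1 else 3
  have hpt : All f (iterate (applyAndRevert P τ S G) t) fun X =>
      (if m ∈ badPositions P.eps t X then (1 : ℝ≥0∞) else 0)
        ≤ ENNReal.ofReal (Real.exp (-(P.eps * t))) * (X.map w).prod := by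
    refine (all_iterate (all_applyAndRevert S G) t).mono fun X hX => ?_
    split_ifs with hb
    swap; · simp
    have hprod : ∀ Y : List (List Bool), (Y.map w).prod
        = 3 ^ (Y.length - Y.countP (fun x => x.getD m false)) := by
      intro Y
      induction Y with
      | nil => simp
      | cons y Y ih =>
        have hle : Y.countP (fun x => x.getD m false) ≤ Y.length := List.countP_le_length
        simp only [List.map_cons, List.prod_cons, ih, List.length_cons, List.countP_cons, w]
        split_ifs with hy
        · simp
        · have : Y.length + 1 - (Y.countP (fun x => x.getD m false) + 0)
              = Y.length - Y.countP (fun x => x.getD m false) + 1 := by omega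
          rw [this, pow_succ, mul_comm]
    rw [hprod, hX.1]
    set a := X.countP (fun x => x.getD m false) with ha
    have hat : a ≤ t := by rw [← hX.1]; exact List.countP_le_length
    simp only [badPositions, Set.mem_ofPred_eq, div_lt_iff₀ htpos] at hb
    have h3 : (3 : ℝ≥0∞) ^ (t - a) = ENNReal.ofReal (3 ^ (t - a)) := by
      rw [ENNReal.ofReal_pow (by norm_num)]; norm_num
    rw [h3, ← ENNReal.ofReal_mul (Real.exp_pos _).le, ENNReal.one_le_ofReal]
    have h4 : Real.exp ((t - a : ℕ) : ℝ) ≤ 3 ^ (t - a) := by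
      rw [← Real.exp_one_pow]
      gcongr
      linarith [Real.exp_one_lt_d9]
    have h5 : (1 : ℝ) ≤ Real.exp (-(P.eps * t)) * Real.exp ((t - a : ℕ) : ℝ) := by
      rw [← Real.exp_add]
      apply Real.one_le_exp
      rw [Nat.cast_sub hat]
      have : (X.countP (fun x => x.getD m false) : ℝ) = (a : ℝ) := rfl
      rw [this] at hb
      nlinarith
    exact h5.trans (by gcongr)
  refine hpt.expect_le.trans ?_
  rw [expect_mul_left, expect_iterate_prod]
  have hw : expect f 0 (applyAndRevert P τ S G) w ≤ ENNReal.ofReal (Real.exp (P.eps / 2)) := by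
    rw [expect_applyAndRevert, mul_zero, zero_add]
    have e1 : avgOrder S (fun l => w (greedy f P τ G l).1) + 2 * acceptProb f P τ S G m = 3 := by
      rw [acceptProb, ← avgOrder_mul_left, ← avgOrder_add, ← avgOrder_const S 3]
      refine avgOrder_congr fun l _ => ?_
      simp only [w]
      split_ifs <;> norm_num
    have hp1 : acceptProb f P τ S G m ≤ 1 := by
      rw [acceptProb, ← avgOrder_const S 1]
      exact avgOrder_mono fun l _ => by split_ifs <;> simp
    set p := acceptProb f P τ S G m
    have hp : p ≠ ⊤ := ne_top_of_le_ne_top ENNReal.one_ne_top hp1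
    set q := avgOrder S (fun l => w (greedy f P τ G l).1)
    have hq : q ≠ ⊤ := fun hq => by rw [hq] at e1; simp at e1
    rw [ENNReal.le_ofReal_iff_toReal_le hq (Real.exp_pos _).le]
    have e2 : q.toReal + 2 * p.toReal = 3 := by
      have := congrArg ENNReal.toReal e1
      rw [ENNReal.toReal_add hq (ENNReal.mul_ne_top (by simp) hp), ENNReal.toReal_mul] at this
      simpa using this
    have e3 : 1 - P.eps / 4 ≤ p.toReal := by
      have : ENNReal.ofReal (1 - P.eps / 4) ≤ p := by
        rw [ENNReal.ofReal_sub _ (by positivity)]; simpa using hm.le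
      exact (ENNReal.ofReal_le_iff_le_toReal hp).1 this
    linarith [Real.add_one_le_exp (P.eps / 2)]
  calc _ ≤ ENNReal.ofReal (Real.exp (-(P.eps * t))) * ENNReal.ofReal (Real.exp (P.eps / 2)) ^ t := by
        gcongr
    _ = _ := by
        rw [← ENNReal.ofReal_pow (Real.exp_pos _).le, ← Real.exp_nat_mul,
          ← ENNReal.ofReal_mul (Real.exp_pos _).le, ← Real.exp_add]
        congr 2; ring

/-- The number of simulations makes the tail at most `(ε / n ^ 12) ^ 2`, which absorbs a union bound
over `n` positions with room to spare. -/
theorem card_mul_tail_le (h : Admissible f P) [Nonempty E] :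
    (Fintype.card E : ℝ) * Real.exp (-(P.eps * simCount E P.eps / 2)) ≤ P.eps / 10 := by
  have h0 := h.eps_pos
  have h1 := h.eps_lt
  have hl := log_simCount_pos h
  have hs := simCount_ge P
  have hn : (1 : ℝ) ≤ Fintype.card E := by exact_mod_cast Fintype.card_pos
  set n : ℝ := (Fintype.card E : ℝ)
  set t : ℝ := (simCount E P.eps : ℝ)
  have hx : 0 < n ^ 12 / P.eps := by positivity
  have h2 : 2 * Real.log (n ^ 12 / P.eps) ≤ P.eps * t / 2 := by
    have : P.eps * (4 / P.eps ^ 2 * Real.log (n ^ 12 / P.eps)) ≤ P.eps * t := by gcongr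
    have e : P.eps * (4 / P.eps ^ 2 * Real.log (n ^ 12 / P.eps))
        = 4 / P.eps * Real.log (n ^ 12 / P.eps) := by field_simp
    have : 4 ≤ 4 / P.eps := by rw [le_div_iff₀ h0]; linarith
    nlinarith
  have h3 : Real.exp (-(P.eps * t / 2)) ≤ (P.eps / n ^ 12) ^ 2 := by
    calc _ ≤ Real.exp (-(2 * Real.log (n ^ 12 / P.eps))) := by gcongr
      _ = _ := by
        rw [← inv_div (n ^ 12), inv_pow, Real.exp_neg, two_mul, Real.exp_add, Real.exp_log hx, sq]
  calc n * Real.exp (-(P.eps * t / 2)) ≤ n * (P.eps / n ^ 12) ^ 2 := by gcongr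
    _ = P.eps ^ 2 * (n / (n ^ 12) ^ 2) := by ring
    _ ≤ P.eps ^ 2 * 1 := by
        gcongr
        rw [div_le_one (by positivity), ← pow_mul]
        exact le_self_pow₀ hn (by norm_num)
    _ ≤ P.eps / 10 := by nlinarith

/-- Either the returned position has acceptance probability at most `1 - ε/4`, or the simulations
erred at a position of larger acceptance probability. The second event has probability at most `ε /
10`, and `1 - ε/4 + ε/10 ≤ 1 - ε/8`. -/
theorem expect_acceptProb_le (h : Admissible f P) [Nonempty E] (S G : Finset E) :
    expect f 0 (calcSampleSize P τ S G) (acceptProb f P τ S G)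
      ≤ ENNReal.ofReal (1 - P.eps / 8) := by
  have h0 := h.eps_pos
  have h1 := h.eps_lt
  classical
  rw [calcSampleSize_eq]
  simp only [expect_bind, expect_pure]
  set t := simCount E P.eps with ht
  let good : ℕ → Prop := fun m => 1 - ENNReal.ofReal (P.eps / 4) < acceptProb f P τ S G m
  have hpt : All f (iterate (applyAndRevert P τ S G) t) fun X =>
      acceptProb f P τ S G (sInf (badPositions P.eps t X)) ≤
        ∑ m ∈ (Finset.range S.card).filter good, (if m ∈ badPositions P.eps t X then 1 else 0)
          + ENNReal.ofReal (1 - P.eps / 4) := by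
    refine (all_iterate (all_applyAndRevert S G) t).mono fun X hX => ?_
    have hcard := card_mem_badPositions h S G t hX.2
    have hmem := Nat.sInf_mem ⟨_, hcard⟩
    have hle := Nat.sInf_le hcard
    set m := sInf (badPositions P.eps t X)
    by_cases hg : good m
    · have hp1 : acceptProb f P τ S G m ≤ 1 := by
        rw [acceptProb, ← avgOrder_const S 1]
        exact avgOrder_mono fun l _ => by split_ifs <;> simp
      -- The extreme position `|S|` is never accepted, hence not `good`; only `|S|` positions enter
      -- the union bound.
      have hlt : m < S.card := by
        refine lt_of_le_of_ne hle fun hm => ?_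
        have : acceptProb f P τ S G m = 0 := by
          rw [acceptProb, ← avgOrder_const S 0]
          refine avgOrder_congr fun l hl => ?_
          rw [List.getD_eq_default _ _ (by rw [length_greedy, length_of_mem_orderings hl, hm])]
          simp
        simp [good, this] at hg
      have := Finset.single_le_sum (f := fun m => if m ∈ badPositions P.eps t X then (1 : ℝ≥0∞) else 0)
        (fun _ _ => zero_le) (Finset.mem_filter.2 ⟨Finset.mem_range.2 hlt, hg⟩)
      simp only [hmem, if_true] at this
      exact hp1.trans (this.trans le_self_add)
    · refine le_add_left ((not_lt.1 hg).trans_eq ?_)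
      rw [ENNReal.ofReal_sub _ (by positivity)]; simp
  refine hpt.expect_le.trans ?_
  rw [expect_add_const, expect_sum]
  calc _ ≤ ∑ m ∈ (Finset.range S.card).filter good,
          ENNReal.ofReal (Real.exp (-(P.eps * t / 2))) + ENNReal.ofReal (1 - P.eps / 4) := by
        gcongr with m hm
        exact rejection_tail h S G m (Finset.mem_filter.1 hm).2
    _ ≤ (Fintype.card E : ℝ≥0∞) * ENNReal.ofReal (Real.exp (-(P.eps * t / 2)))
          + ENNReal.ofReal (1 - P.eps / 4) := by
        rw [Finset.sum_const, nsmul_eq_mul]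
        gcongr
        refine (Finset.card_filter_le _ _).trans ?_
        rw [Finset.card_range]; exact Finset.card_le_univ S
    _ = ENNReal.ofReal ((Fintype.card E : ℝ) * Real.exp (-(P.eps * t / 2)) + (1 - P.eps / 4)) := by
        rw [ENNReal.ofReal_add (by positivity) (by linarith), ENNReal.ofReal_mul (by positivity),
          ENNReal.ofReal_natCast]
    _ ≤ _ := by
        apply ENNReal.ofReal_le_ofReal
        linarith [card_mul_tail_le h]

/-- One pass of the loop: the selection of the next set `G i`. -/
noncomputable def sampleNext (P : Params E) (τ : ℝ) (L G : Finset E) : QueryAlg E (Finset E) := do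
  let buck ← bucketize P τ L G
  let b := largestBucket buck
  let Bi := buck b
  let τi := (1 + P.eps) ^ b.1 * τ
  let m ← calcSampleSize P τi Bi G
  let l ← randomOrder Bi
  let r ← addGreedily P τi G (l.take m)
  return r.2

theorem expect_sampleNext (L G : Finset E) (c : ℝ≥0∞) (g : Finset E → ℝ≥0∞) :
    expect f c (sampleNext P τ L G) g = 2 * L.card * c +
      expect f c (calcSampleSize P (topThreshold f P τ L G) (topBucket f P τ L G) G) fun m =>
        avgOrder (topBucket f P τ L G) fun l =>
          2 * (l.take m).length * c + g (greedy f P (topThreshold f P τ L G) G (l.take m)).2 := by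
  simp only [sampleNext, expect_bind, (computes_bucketize τ L G).1, expect_randomOrder, expect_pure,
    (computes_addGreedily _ _ _).1]
  push_cast
  rfl

theorem topThreshold_pos (h : Admissible f P) (hτ : 0 < τ) (L G : Finset E) :
    0 < topThreshold f P τ L G := by
  have := h.eps_pos
  unfold topThreshold; positivity

theorem expect_survivors_le (h : Admissible f P) (hτ : 0 < τ) [Nonempty E] (L G : Finset E) :
    expect f 0 (sampleNext P τ L G) (fun G' =>
        (((topBucket f P τ L G).filter fun e => topThreshold f P τ L G ≤ dens f P e G').card : ℝ≥0∞))
      ≤ ENNReal.ofReal (1 - P.eps / 8) * (topBucket f P τ L G).card := by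
  rw [expect_sampleNext]
  simp only [mul_zero, zero_add]
  set S := topBucket f P τ L G
  set σ := topThreshold f P τ L G
  calc _ ≤ expect f 0 (calcSampleSize P σ S G) fun m => S.card * acceptProb f P σ S G m := by
        refine expect_mono fun m => (avg_survivors_le h (topThreshold_pos h hτ L G) m S G).trans ?_
        gcongr
        exact Nat.sub_le _ _
    _ ≤ _ := by
        rw [expect_mul_left, mul_comm]
        gcongr
        exact expect_acceptProb_le h S G

theorem cost_calcSampleSize (S G : Finset E) (c : ℝ≥0∞) :
    expect f c (calcSampleSize P τ S G) 0 = simCount E P.eps * (2 * S.card * c) := by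
  rw [calcSampleSize_eq]
  simp only [expect_bind, expect_pure, Pi.zero_apply]
  have := cost_iterate (f := f) (applyAndRevert P τ S G) c (simCount E P.eps)
  rw [expect_applyAndRevert] at this
  simp only [Pi.zero_apply, avgOrder_const, add_zero] at this
  exact this

theorem card_topBucket_le (L G : Finset E) : (topBucket f P τ L G).card ≤ L.card :=
  Finset.card_filter_le _ _

/-- Per element: two queries for bucketing, two in each simulation, and two in the final greedy
pass. -/
theorem cost_sampleNext_le (L G : Finset E) (c : ℝ≥0∞) :
    expect f c (sampleNext P τ L G) 0 ≤ (2 * simCount E P.eps + 4 : ℕ) * L.card * c := by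
  rw [expect_sampleNext]
  have hB : ((topBucket f P τ L G).card : ℝ≥0∞) ≤ L.card := by exact_mod_cast card_topBucket_le L G
  calc _ ≤ 2 * L.card * c +
      expect f c (calcSampleSize P (topThreshold f P τ L G) (topBucket f P τ L G) G) fun m =>
        (0 : ℕ → ℝ≥0∞) m + 2 * L.card * c := by
        gcongr
        refine expect_mono fun m => ?_
        rw [Pi.zero_apply, zero_add]
        rw [← avgOrder_const (topBucket f P τ L G) (2 * L.card * c)]
        refine avgOrder_mono fun l hl => ?_
        rw [Pi.zero_apply, add_zero]
        gcongr
        refine (List.length_take_le' _ _).trans ?_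
        rw [length_of_mem_orderings hl]; exact card_topBucket_le L G
    _ ≤ 2 * L.card * c + (simCount E P.eps * (2 * L.card * c) + 2 * L.card * c) := by
        rw [expect_add_const, cost_calcSampleSize]
        gcongr
    _ = _ := by push_cast; ring

end Sampling

end SubmodularCover

/-! ### The potential and its expected decrease in one pass -/

namespace SubmodularCover

open QueryAlg

section Potential

variable {E : Type} [Fintype E] [DecidableEq E] {f : Finset E → ℝ} {P : Params E} {τ : ℝ}

/-- The quantity `η = (1 + ε) / ε * n * ρ`. -/
noncomputable def eta (P : Params E) : ℝ := (1 + P.eps) / P.eps * Fintype.card E * P.rho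

/-- A bound for each of the two coordinates of the bucket indices. -/
noncomputable def kappa (P : Params E) : ℕ := ⌊Real.logb (1 + P.eps) (eta P)⌋₊ + 1

/-- All elements of `S` are dense with respect to `G`, and none is too dense for the run. -/
def Good (f : Finset E → ℝ) (P : Params E) (τ : ℝ) (S G : Finset E) : Prop :=
  ∀ e ∈ S, τ ≤ dens f P e G ∧ f {e} / P.w e ≤ τ * eta P

/-- The contribution of `e` to the potential: one more than the first coordinate of its bucket. -/
noncomputable def coord (f : Finset E → ℝ) (P : Params E) (τ : ℝ) (G : Finset E) (e : E) : ℕ :=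
  ⌊Real.logb (1 + P.eps) (dens f P e G / τ)⌋.toNat + 1

/-- The potential that decreases from level to level. -/
noncomputable def potential (f : Finset E → ℝ) (P : Params E) (τ : ℝ) (S G : Finset E) : ℕ :=
  ∑ e ∈ S, coord f P τ G e

theorem card_le_potential (S G : Finset E) : S.card ≤ potential f P τ S G := by
  rw [Finset.card_eq_sum_ones, potential]
  exact Finset.sum_le_sum fun e _ => Nat.le_add_left 1 _

/-- For good elements the ratio of density to `τ` lies in `[1, η]`, so its rounded logarithm is
between `0` and `κ - 1`. -/
theorem coord_le (h : Admissible f P) (hτ : 0 < τ) {S G : Finset E} (hS : Good f P τ S G) {e : E}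
    (he : e ∈ S) : coord f P τ G e ≤ kappa P := by
  obtain ⟨h1, h2⟩ := hS e he
  have h0 := h.eps_pos
  have hd : 1 ≤ dens f P e G / τ := by rwa [one_le_div hτ]
  have hd' : dens f P e G / τ ≤ eta P := by
    rw [div_le_iff₀ hτ, mul_comm]; exact (h.dens_le e G).trans h2
  unfold coord kappa
  gcongr
  rw [Int.floor_toNat]
  gcongr
  linarith

theorem potential_le (h : Admissible f P) (hτ : 0 < τ) {S G : Finset E} (hS : Good f P τ S G) :
    potential f P τ S G ≤ kappa P * S.card := by
  rw [potential, mul_comm, ← smul_eq_mul]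
  exact Finset.sum_le_card_nsmul _ _ _ fun e he => coord_le h hτ hS he

theorem rho_le_eta (h : Admissible f P) [Nonempty E] : P.rho ≤ eta P := by
  have h0 := h.eps_pos
  have hn : (1 : ℝ) ≤ Fintype.card E := by exact_mod_cast Fintype.card_pos
  have hr : 1 ≤ P.rho := by
    obtain ⟨e⟩ := ‹Nonempty E›
    exact (h.weight e).1.trans (h.weight e).2
  have : 1 ≤ (1 + P.eps) / P.eps := by rw [one_le_div h0]; linarith
  unfold eta
  have h2 : 1 ≤ (1 + P.eps) / P.eps * Fintype.card E := by nlinarith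
  nlinarith

/-- Only finitely many buckets are nonempty, so a maximum exists and the choice operator in
`largestBucket` attains it. -/
theorem card_buckets_le (L G : Finset E) (c : ℤ × ℤ) :
    (buckets f P τ L G c).card ≤ (topBucket f P τ L G).card := by
  have hex : ∃ b, ∀ c, (buckets f P τ L G c).card ≤ (buckets f P τ L G b).card := by
    rcases L.eq_empty_or_nonempty with rfl | hL
    · exact ⟨0, fun c => by simp [buckets]⟩
    · obtain ⟨b, _, hb⟩ := Finset.exists_max_image (L.image (bucketIndex f P τ G))
        (fun b => (buckets f P τ L G b).card) (hL.image _)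
      refine ⟨b, fun c => ?_⟩
      by_cases hc : c ∈ L.image (bucketIndex f P τ G)
      · exact hb c hc
      · have : buckets f P τ L G c = ∅ := by
          rw [buckets, Finset.filter_eq_empty_iff]
          exact fun e he hec => hc (Finset.mem_image.2 ⟨e, he, hec⟩)
        simp [this]
  exact Classical.epsilon_spec hex c

/-- Pigeonhole: both bucket coordinates take values in `0, …, κ - 1`, the second because the weights
lie in `[1, ρ]` and `ρ ≤ η`. -/
theorem card_le_topBucket (h : Admissible f P) (hτ : 0 < τ) {L G : Finset E}
    (hL : Good f P τ L G) : L.card ≤ kappa P ^ 2 * (topBucket f P τ L G).card := by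
  rcases L.eq_empty_or_nonempty with rfl | ⟨e₀, he₀⟩
  · simp
  have : Nonempty E := ⟨e₀⟩
  have h0 := h.eps_pos
  have hmaps : ∀ e ∈ L, bucketIndex f P τ G e ∈
      Finset.Icc (0 : ℤ) (kappa P - 1) ×ˢ Finset.Icc (0 : ℤ) (kappa P - 1) := by
    intro e he
    have key : ∀ x : ℝ, 1 ≤ x → x ≤ eta P →
        ⌊Real.logb (1 + P.eps) x⌋ ∈ Finset.Icc (0 : ℤ) (kappa P - 1) := by
      intro x h1 h2
      have hx0 : 0 ≤ Real.logb (1 + P.eps) x := Real.logb_nonneg (by linarith) h1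
      have hx1 : Real.logb (1 + P.eps) x ≤ Real.logb (1 + P.eps) (eta P) :=
        Real.logb_le_logb_of_le (by linarith) (by linarith) h2
      rw [Finset.mem_Icc]
      refine ⟨Int.floor_nonneg.2 hx0, ?_⟩
      unfold kappa
      push_cast
      rw [Int.natCast_floor_eq_floor (hx0.trans hx1)]
      have := Int.floor_le_floor hx1
      linarith
    obtain ⟨h1, h2⟩ := hL e he
    rw [Finset.mem_product]
    refine ⟨key _ (by rwa [one_le_div hτ]) ?_, key _ (h.weight e).1
      ((h.weight e).2.trans (rho_le_eta h))⟩
    rw [div_le_iff₀ hτ, mul_comm]; exact (h.dens_le e G).trans h2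
  have := Finset.card_le_mul_card_image_of_maps_to hmaps (topBucket f P τ L G).card
    (fun c _ => card_buckets_le L G c)
  refine this.trans_eq ?_
  rw [Finset.card_product, Int.card_Icc, mul_comm]
  simp [sq]

theorem topThreshold_le (h : Admissible f P) (hτ : 0 < τ) {L G : Finset E}
    (hL : Good f P τ L G) {e : E} (he : e ∈ topBucket f P τ L G) :
    topThreshold f P τ L G ≤ dens f P e G := by
  have h0 := h.eps_pos
  obtain ⟨heL, hb⟩ := Finset.mem_filter.1 he
  have hd : 0 < dens f P e G / τ := by exact div_pos (hτ.trans_le (hL e heL).1) hτ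
  rw [topThreshold, ← hb, ← le_div_iff₀ hτ]
  simp only [bucketIndex]
  rw [← Real.rpow_intCast, ← Real.le_logb_iff_rpow_le (by linarith) hd]
  exact Int.floor_le _

/-- The bucket threshold is an exact power of `1 + ε` times `τ`, so falling below it costs a full
unit of the first coordinate. -/
theorem lt_of_floor_le (h : Admissible f P) (hτ : 0 < τ) {L G : Finset E} {d : ℝ} (hd : 0 < d)
    (hlt : d < topThreshold f P τ L G) :
    ⌊Real.logb (1 + P.eps) (d / τ)⌋ < (topIndex f P τ L G).1 := by
  have h0 := h.eps_pos
  rw [Int.floor_lt, Real.logb_lt_iff_lt_rpow (by linarith) (by positivity), Real.rpow_intCast,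
    div_lt_iff₀ hτ]
  exact hlt

/-- Checked element by element: no coordinate increases, and an element of the sampled bucket that
falls below the bucket threshold loses at least one unit. The `+ 1` in `coord` charges a unit also
to elements that leave the level. The bucket comes from `L`, whereas the potential is taken over a
larger `S`, because elements may have joined the level since it was built. -/
theorem potential_filter_add_le (h : Admissible f P) (hτ : 0 < τ) {L S G G' : Finset E}
    (hLS : L ⊆ S) (hG : G ⊆ G') :
    potential f P τ (S.filter fun e => τ ≤ dens f P e G') G' + (topBucket f P τ L G).card
      ≤ potential f P τ S G +
        ((topBucket f P τ L G).filter fun e => topThreshold f P τ L G ≤ dens f P e G').card := by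
  have h0 := h.eps_pos
  have hB : topBucket f P τ L G ⊆ S := (Finset.filter_subset _ _).trans hLS
  have e1 : (topBucket f P τ L G).card = ∑ e ∈ S, if e ∈ topBucket f P τ L G then 1 else 0 := by
    rw [Finset.sum_boole, Nat.cast_id, Finset.filter_mem_eq_inter, Finset.inter_eq_right.2 hB]
  have e2 : ((topBucket f P τ L G).filter fun e => topThreshold f P τ L G ≤ dens f P e G').card
      = ∑ e ∈ S, if e ∈ topBucket f P τ L G ∧ topThreshold f P τ L G ≤ dens f P e G'
        then 1 else 0 := by
    rw [Finset.sum_boole, Nat.cast_id]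
    congr 1
    ext e
    simp only [Finset.mem_filter]
    exact ⟨fun H => ⟨hB H.1, H⟩, fun H => H.2⟩
  rw [e1, e2, potential, potential, Finset.sum_filter, ← Finset.sum_add_distrib,
    ← Finset.sum_add_distrib]
  refine Finset.sum_le_sum fun e he => ?_
  have hd := h.dens_anti e hG
  have hle : ∀ d, 0 < d → d ≤ dens f P e G →
      ⌊Real.logb (1 + P.eps) (d / τ)⌋ ≤ ⌊Real.logb (1 + P.eps) (dens f P e G / τ)⌋ :=
    fun d h1 h2 => by
      apply Int.floor_le_floor
      apply Real.logb_le_logb_of_le (by linarith) (by positivity)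
      gcongr
  by_cases h1 : τ ≤ dens f P e G'
  · have hpos := hτ.trans_le h1
    have h2 := hle _ hpos hd
    have h3 : 0 ≤ ⌊Real.logb (1 + P.eps) (dens f P e G' / τ)⌋ :=
      Int.floor_nonneg.2 (Real.logb_nonneg (by linarith) (by rwa [one_le_div hτ]))
    rw [if_pos h1]
    unfold coord
    by_cases hb : e ∈ topBucket f P τ L G
    · by_cases ht : topThreshold f P τ L G ≤ dens f P e G'
      · simp only [hb, ht, and_self, if_true]; omega
      · have h4 := lt_of_floor_le h hτ hpos (not_le.1 ht)
        have h5 : ⌊Real.logb (1 + P.eps) (dens f P e G / τ)⌋ = (topIndex f P τ L G).1 :=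
          congrArg Prod.fst (Finset.mem_filter.1 hb).2
        simp only [hb, ht, and_false, if_true, if_false]; omega
    · simp only [hb, false_and, if_false]; omega
  · rw [if_neg h1]
    unfold coord
    split_ifs <;> omega

theorem subset_sampleNext (L G : Finset E) : All f (sampleNext P τ L G) fun G' => G ⊆ G' := by
  simp only [sampleNext, all_bind, all_pure, (computes_bucketize τ L G).2,
    (computes_addGreedily _ _ _).2]
  exact all_of_forall fun m => all_of_forall fun l => subset_greedy _ _ _

/-- The first element of every order is accepted, so position `0` has acceptance fraction `1` and is
never returned. -/
theorem all_calcSampleSize_pos (h : Admissible f P) {S G : Finset E}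
    (hS : S.Nonempty) (hd : ∀ e ∈ S, τ ≤ dens f P e G) :
    All f (calcSampleSize P τ S G) fun m => 0 < m := by
  obtain ⟨e₀, he₀⟩ := hS
  have : Nonempty E := ⟨e₀⟩
  have h0 := h.eps_pos
  rw [calcSampleSize_eq]
  simp only [all_bind, all_pure]
  refine (all_iterate (all_applyAndRevert S G) _).mono fun X hX => ?_
  have hmem := Nat.sInf_mem ⟨_, card_mem_badPositions h S G (simCount E P.eps) hX.2⟩
  refine Nat.pos_of_ne_zero fun hz => ?_
  rw [hz] at hmem
  have hc : X.countP (fun x => x.getD 0 false) = X.length := by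
    rw [List.countP_eq_length]
    intro x hx
    obtain ⟨l, hl, rfl⟩ := hX.2 x hx
    rcases l with _ | ⟨e, l⟩
    · have := (mem_of_mem_orderings hl).2 he₀
      simp at this
    · rw [greedy, if_pos (hd e ((mem_of_mem_orderings hl).1 (by simp)))]
      rfl
  have ht : ((simCount E P.eps : ℕ) : ℝ) ≠ 0 := by exact_mod_cast (simCount_pos h).ne'
  simp only [badPositions, Set.mem_ofPred_eq, hc, hX.1, div_self ht] at hmem
  linarith

/-- Progress of the while loop: the first sampled element is selected, and its density is `0` from
then on. -/
theorem mem_sampleNext (h : Admissible f P) (hτ : 0 < τ) {L G : Finset E} (hL : Good f P τ L G)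
    (hne : L.Nonempty) : All f (sampleNext P τ L G) fun G' => ∃ e ∈ L, e ∈ G' := by
  have hB : (topBucket f P τ L G).Nonempty := by
    rw [← Finset.card_pos]
    have := card_le_topBucket h hτ hL
    have h2 := hne.card_pos
    by_contra h3
    simp only [not_lt, Nat.le_zero] at h3
    rw [h3] at this; omega
  have hd : ∀ e ∈ topBucket f P τ L G, topThreshold f P τ L G ≤ dens f P e G :=
    fun e he => topThreshold_le h hτ hL he
  simp only [sampleNext, all_bind, all_pure, (computes_bucketize τ L G).2,
    (computes_addGreedily _ _ _).2, all_randomOrder]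
  refine (all_calcSampleSize_pos h hB hd).mono fun m hm l hl => ?_
  change l ∈ orderings (topBucket f P τ L G) at hl
  change ∃ e ∈ L, e ∈ (greedy f P (topThreshold f P τ L G) G (l.take m)).2
  obtain ⟨m, rfl⟩ := Nat.exists_eq_succ_of_ne_zero hm.ne'
  rcases l with _ | ⟨e, l⟩
  · obtain ⟨e₀, he₀⟩ := hB
    have := (mem_of_mem_orderings hl).2 he₀
    simp at this
  · have he := (mem_of_mem_orderings hl).1 (List.mem_cons_self (a := e) (l := l))
    refine ⟨e, (Finset.mem_filter.1 he).1, ?_⟩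
    rw [List.take_succ_cons, greedy, if_pos (hd e he)]
    exact subset_greedy _ _ _ (Finset.mem_insert_self _ _)

/-- The inverse of the rate at which the potential decreases. -/
noncomputable def invRate (P : Params E) : ℝ := 12 * (kappa P : ℝ) ^ 3 / P.eps

theorem kappa_pos (P : Params E) : 1 ≤ kappa P := Nat.le_add_left 1 _

/-- The expected drop is at least `(ε/8) |B|`, while `Φ ≤ κ |S| ≤ (3/2) κ |L| ≤ (3/2) κ ^ 3 |B|`;
the quotient of the two bounds is `invRate`. Contraction by `1 - 1 / D` is written as `D x + Φ ≤ D
Φ` to avoid truncated subtraction. The hypothesis `hcard` allows for the growth of a level between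
reconstructions. -/
theorem expect_potential_add_le (h : Admissible f P) (hτ : 0 < τ) {L S G : Finset E}
    (hLS : L ⊆ S) (hS : Good f P τ S G) (hcard : 2 * S.card ≤ 3 * L.card) :
    ENNReal.ofReal (invRate P) * expect f 0 (sampleNext P τ L G)
        (fun G' => (potential f P τ (S.filter fun e => τ ≤ dens f P e G') G' : ℝ≥0∞))
      + potential f P τ S G ≤ ENNReal.ofReal (invRate P) * potential f P τ S G := by
  rcases S.eq_empty_or_nonempty with rfl | ⟨e₀, _⟩
  · simp [potential, expect_const]
  have : Nonempty E := ⟨e₀⟩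
  have h0 := h.eps_pos
  have h1 := h.eps_lt
  set B := topBucket f P τ L G with hBdef
  set x := expect f 0 (sampleNext P τ L G)
        (fun G' => (potential f P τ (S.filter fun e => τ ≤ dens f P e G') G' : ℝ≥0∞)) with hx
  set Φ := potential f P τ S G with hΦ
  have key : x + B.card ≤ Φ + ENNReal.ofReal (1 - P.eps / 8) * B.card := by
    have := expect_survivors_le h hτ L G
    refine le_trans ?_ (add_le_add_right this Φ)
    rw [hx, ← expect_add_const, add_comm, ← expect_add_const]
    refine ((subset_sampleNext L G).mono fun G' hG' => ?_).expect_le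
    have := potential_filter_add_le h hτ hLS hG'
    rw [add_comm (_ : ℝ≥0∞) (Φ : ℝ≥0∞)]
    exact_mod_cast this
  -- Finiteness permits passing to the reals, where the drop can be subtracted.
  have hxtop : x ≠ ⊤ := by
    refine ne_top_of_le_ne_top ?_ (le_self_add.trans key)
    exact ENNReal.add_ne_top.2 ⟨by simp, ENNReal.mul_ne_top (by simp) (by simp)⟩
  lift x to NNReal using hxtop with y
  have hΦB : (Φ : ℝ) ≤ kappa P ^ 3 * (3 / 2) * B.card := by
    have a1 : Φ ≤ kappa P * S.card := potential_le h hτ hS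
    have a2 : L.card ≤ kappa P ^ 2 * B.card :=
      card_le_topBucket h hτ fun e he => hS e (hLS he)
    have a3 : 2 * Φ ≤ 3 * kappa P ^ 3 * B.card := by
      calc 2 * Φ ≤ kappa P * (2 * S.card) := by nlinarith
        _ ≤ kappa P * (3 * (kappa P ^ 2 * B.card)) :=
            Nat.mul_le_mul_left _ (hcard.trans (Nat.mul_le_mul_left _ a2))
        _ = _ := by ring
    have a4 : (2 : ℝ) * Φ ≤ 3 * kappa P ^ 3 * B.card := by exact_mod_cast a3
    linarith
  have hkey : (y : ℝ) + B.card ≤ Φ + (1 - P.eps / 8) * B.card := by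
    have h2 : ENNReal.ofReal ((y : ℝ) + B.card) ≤ ENNReal.ofReal (Φ + (1 - P.eps / 8) * B.card) := by
      rw [ENNReal.ofReal_add (by positivity) (by positivity), ENNReal.ofReal_add (by positivity)
        (mul_nonneg (by linarith) (by positivity)), ENNReal.ofReal_mul (by linarith)]
      simpa using key
    exact (ENNReal.ofReal_le_ofReal_iff
      (add_nonneg (by positivity) (mul_nonneg (by linarith) (by positivity)))).1 h2
  have hk : (1 : ℝ) ≤ kappa P := by exact_mod_cast kappa_pos P
  have hD : 0 < invRate P := by unfold invRate; positivity
  have hfin : invRate P * y + Φ ≤ invRate P * Φ := by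
    have a1 : invRate P * (P.eps / 8 * B.card) = kappa P ^ 3 * (3 / 2) * B.card := by
      unfold invRate; field_simp; ring
    have a2 : invRate P * (y + P.eps / 8 * B.card) ≤ invRate P * Φ := by
      apply mul_le_mul_of_nonneg_left _ hD.le
      linarith
    nlinarith
  have := ENNReal.ofReal_le_ofReal hfin
  rw [ENNReal.ofReal_add (by positivity) (by positivity), ENNReal.ofReal_mul hD.le,
    ENNReal.ofReal_mul hD.le] at this
  simpa using this

end Potential

end SubmodularCover

/-! ### Reconstruction: invariants, cost and stored credit -/

namespace SubmodularCover

open QueryAlg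

section Build

variable {E : Type} [Fintype E] [DecidableEq E] {f : Finset E → ℝ} {P : Params E} {τ : ℝ}

/-- The data structure after one pass of the loop at level `i` that selected `G'`. -/
noncomputable def nextState (f : Finset E → ℝ) (P : Params E) (τ : ℝ) (s : LevelData E) (i : ℕ)
    (G' : Finset E) : LevelData E :=
  { s with
    B := Function.update s.B i (topBucket f P τ (s.L i) (s.G (i - 1)))
    G := Function.update s.G i G'
    L := Function.update s.L (i + 1) ((s.L i).filter fun e => τ ≤ dens f P e G')
    Lbar := Function.update s.Lbar (i + 1) ((s.L i).filter fun e => τ ≤ dens f P e G') }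

/-- All randomness of a pass sits in `sampleNext`; the final filtering is deterministic and costs
two queries per element. -/
theorem expect_buildLevels_succ (fuel i : ℕ) (s : LevelData E) (c : ℝ≥0∞) (g : LevelData E → ℝ≥0∞) :
    expect f c (buildLevels P τ (fuel + 1) i s) g =
      if s.L i = ∅ then g { s with T := i - 1 }
      else expect f c (sampleNext P τ (s.L i) (s.G (i - 1))) fun G' =>
        (2 * (s.L i).card : ℕ) * c +
          expect f c (buildLevels P τ fuel (i + 1) (nextState f P τ s i G')) g := by
  rw [buildLevels]
  split_ifs with h
  · simp
  · simp only [sampleNext, expect_bind, (computes_bucketize _ _ _).1, expect_randomOrder,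
      expect_pure, (computes_addGreedily _ _ _).1, (computes_filterDense _ _ _).1]
    rfl

theorem all_buildLevels_succ (fuel i : ℕ) (s : LevelData E) (Q : LevelData E → Prop) :
    All f (buildLevels P τ (fuel + 1) i s) Q ↔
      if s.L i = ∅ then Q { s with T := i - 1 }
      else All f (sampleNext P τ (s.L i) (s.G (i - 1))) fun G' =>
        All f (buildLevels P τ fuel (i + 1) (nextState f P τ s i G')) Q := by
  rw [buildLevels]
  split_ifs with h
  · simp
  · simp only [sampleNext, all_bind, (computes_bucketize _ _ _).2, all_randomOrder,
      all_pure, (computes_addGreedily _ _ _).2, (computes_filterDense _ _ _).2]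
    rfl

/-- `s'` results from `s` by changes at level `i` and above. -/
structure Frame (i : ℕ) (s s' : LevelData E) : Prop where
  D : s'.D = s.D
  T : i ≤ s'.T + 1
  L : ∀ j ≤ i, s'.L j = s.L j
  Lbar : ∀ j ≤ i, s'.Lbar j = s.Lbar j
  G : ∀ j < i, s'.G j = s.G j
  B : ∀ j < i, s'.B j = s.B j

theorem frame_buildLevels (fuel i : ℕ) (hi : 1 ≤ i) (s : LevelData E) :
    All f (buildLevels P τ fuel i s) (Frame i s) := by
  induction fuel generalizing i s with
  | zero => exact ⟨rfl, by simp; omega, fun _ _ => rfl, fun _ _ => rfl, fun _ _ => rfl, fun _ _ => rfl⟩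
  | succ fuel ih =>
    rw [all_buildLevels_succ]
    split_ifs with hL
    · exact ⟨rfl, by simp; omega, fun _ _ => rfl, fun _ _ => rfl, fun _ _ => rfl, fun _ _ => rfl⟩
    · refine all_of_forall fun G' => (ih (i + 1) (by omega) _).mono fun s' h => ?_
      refine ⟨h.D, by have := h.T; omega, fun j hj => ?_, fun j hj => ?_, fun j hj => ?_,
        fun j hj => ?_⟩
      · rw [h.L j (by omega)]; exact Function.update_of_ne (by omega) _ _
      · rw [h.Lbar j (by omega)]; exact Function.update_of_ne (by omega) _ _
      · rw [h.G j (by omega)]; exact Function.update_of_ne (by omega) _ _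
      · rw [h.B j (by omega)]; exact Function.update_of_ne (by omega) _ _

/-- The invariants of a level. -/
structure LevelOK (f : Finset E → ℝ) (P : Params E) (τ : ℝ) (s : LevelData E) (j : ℕ) : Prop where
  nonempty : (s.L j).Nonempty
  sub : s.L j ⊆ s.Lbar j
  card : 2 * (s.Lbar j).card < 3 * (s.L j).card
  bucket : s.B j = topBucket f P τ (s.L j) (s.G (j - 1))
  good : Good f P τ (s.Lbar j) (s.G (j - 1))
  anti : 2 ≤ j → s.Lbar j ⊆ s.Lbar (j - 1)

theorem LevelOK.congr {s s' : LevelData E} {j : ℕ} (h : LevelOK f P τ s j) (hL : s'.L j = s.L j)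
    (hLbar : s'.Lbar j = s.Lbar j) (hB : s'.B j = s.B j) (hG : s'.G (j - 1) = s.G (j - 1))
    (hLbar' : 2 ≤ j → s'.Lbar (j - 1) = s.Lbar (j - 1)) : LevelOK f P τ s' j := by
  constructor
  · rw [hL]; exact h.nonempty
  · rw [hL, hLbar]; exact h.sub
  · rw [hL, hLbar]; exact h.card
  · rw [hL, hB, hG]; exact h.bucket
  · rw [hLbar, hG]; exact h.good
  · intro hj; rw [hLbar, hLbar' hj]; exact h.anti hj

/-- The invariants of the data structure. -/
structure Inv (f : Finset E → ℝ) (P : Params E) (τ : ℝ) (s : LevelData E) : Prop where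
  level : ∀ j, 1 ≤ j → j ≤ s.T → LevelOK f P τ s j
  last : s.Lbar (s.T + 1) = ∅

theorem inv_empty : Inv f P τ (LevelData.empty E) :=
  ⟨fun j h1 h2 => by simp [LevelData.empty] at h2; omega, rfl⟩

/-- The levels from `i` on are freshly built. -/
structure Fresh (f : Finset E → ℝ) (P : Params E) (τ : ℝ) (i : ℕ) (s : LevelData E) : Prop where
  level : ∀ j, i ≤ j → j ≤ s.T → LevelOK f P τ s j
  Lbar : ∀ j, i ≤ j → j ≤ s.T → s.Lbar j = s.L j
  del : ∀ j, i ≤ j → j ≤ s.T → s.D ∩ s.B j = ∅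
  last : s.Lbar (s.T + 1) = ∅

/-- Each pass removes the selected element from the level, so `hfuel` persists and the loop ends on
an empty level. New levels satisfy `Lbar = L` and avoid `D`, and the filter supplies goodness with
respect to the new `G`. -/
theorem fresh_buildLevels (h : Admissible f P) (hτ : 0 < τ) (fuel i : ℕ) (hi : 1 ≤ i)
    (s : LevelData E) (hL : s.Lbar i = s.L i) (hgood : Good f P τ (s.L i) (s.G (i - 1)))
    (hanti : 2 ≤ i → s.L i ⊆ s.Lbar (i - 1)) (hfuel : (s.L i).card < fuel)
    (hdisj : Disjoint s.D (s.L i)) :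
    All f (buildLevels P τ fuel i s) (Fresh f P τ i) := by
  induction fuel generalizing i s with
  | zero => omega
  | succ fuel ih =>
    rw [all_buildLevels_succ]
    split_ifs with hem
    · refine ⟨fun j h1 h2 => ?_, fun j h1 h2 => ?_, fun j h1 h2 => ?_, ?_⟩
      iterate 3 · simp only at h2; omega
      · simp only [Nat.sub_add_cancel hi, hL, hem]
    · have hne := Finset.nonempty_iff_ne_empty.2 hem
      refine (mem_sampleNext h hτ hgood hne).mono fun G' ⟨e, heL, heG⟩ => ?_
      have hLs : (nextState f P τ s i G').L (i + 1) = (s.L i).filter fun e => τ ≤ dens f P e G' :=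
        Function.update_self _ _ _
      have hLb : (nextState f P τ s i G').Lbar (i + 1) = (s.L i).filter fun e => τ ≤ dens f P e G' :=
        Function.update_self _ _ _
      have hLb' : (nextState f P τ s i G').Lbar i = s.L i := by
        rw [← hL]; exact Function.update_of_ne (by omega) _ _
      have hG : (nextState f P τ s i G').G i = G' := Function.update_self _ _ _
      have hcard : ((s.L i).filter fun e => τ ≤ dens f P e G').card < (s.L i).card := by
        apply Finset.card_lt_card
        rw [Finset.filter_ssubset]
        exact ⟨e, heL, by rw [dens_of_mem heG]; linarith⟩
      have := (ih (i + 1) (by omega) (nextState f P τ s i G') (hLb.trans hLs.symm) (by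
          rw [hLs, Nat.add_sub_cancel, hG]
          exact fun a ha => ⟨(Finset.mem_filter.1 ha).2, (hgood a (Finset.mem_filter.1 ha).1).2⟩)
        (fun _ => by rw [hLs, Nat.add_sub_cancel, hLb']; exact Finset.filter_subset _ _)
        (by rw [hLs]; omega)
        (by rw [hLs]; exact hdisj.mono_right (Finset.filter_subset _ _))).and
          (frame_buildLevels fuel (i + 1) (by omega) (nextState f P τ s i G'))
      refine this.mono fun s' ⟨hf, hfr⟩ => ?_
      have eL : s'.L i = s.L i := by
        rw [hfr.L i (by omega)]; exact Function.update_of_ne (by omega) _ _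
      have eLb : s'.Lbar i = s.L i := by rw [hfr.Lbar i (by omega), hLb']
      have eB : s'.B i = topBucket f P τ (s.L i) (s.G (i - 1)) := by
        rw [hfr.B i (by omega)]; exact Function.update_self _ _ _
      have eG : s'.G (i - 1) = s.G (i - 1) := by
        rw [hfr.G (i - 1) (by omega)]; exact Function.update_of_ne (by omega) _ _
      refine ⟨fun j h1 h2 => ?_, fun j h1 h2 => ?_, fun j h1 h2 => ?_, hf.last⟩
      · rcases h1.eq_or_lt with rfl | h1
        · refine ⟨by rwa [eL], by rw [eL, eLb], by rw [eL, eLb]; have := hne.card_pos; omega,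
            by rw [eB, eL, eG], by rwa [eLb, eG], fun h2 => ?_⟩
          rw [eLb, hfr.Lbar (i - 1) (by omega)]
          exact (hanti h2).trans_eq (Function.update_of_ne (by omega) _ _).symm
        · exact hf.level j h1 h2
      · rcases h1.eq_or_lt with rfl | h1
        · rw [eL, eLb]
        · exact hf.Lbar j h1 h2
      · rcases h1.eq_or_lt with rfl | h1
        · rw [eB, hfr.D, ← Finset.disjoint_iff_inter_eq_empty]
          exact hdisj.mono_right (Finset.filter_subset _ _)
        · exact hf.del j h1 h2

/-- The number of oracle calls of one pass of the loop, per element of the level. -/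
noncomputable def passCost (P : Params E) : ℕ := 2 * simCount E P.eps + 6

/-- A bound for the expected number of oracle calls of a reconstruction, per element. -/
noncomputable def buildCost (P : Params E) : ℝ≥0∞ :=
  passCost P * ENNReal.ofReal (invRate P) * kappa P

/-- The bound `K Φ` reproduces itself: a pass costs at most `passCost * Φ`, and the expected
decrease of `K Φ` is at least that much. -/
theorem cost_buildLevels_le_potential (h : Admissible f P) (hτ : 0 < τ) (fuel i : ℕ) (hi : 1 ≤ i)
    (s : LevelData E) (hgood : Good f P τ (s.L i) (s.G (i - 1))) :
    expect f 1 (buildLevels P τ fuel i s) 0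
      ≤ passCost P * ENNReal.ofReal (invRate P) * potential f P τ (s.L i) (s.G (i - 1)) := by
  induction fuel generalizing i s with
  | zero => exact zero_le
  | succ fuel ih =>
    rw [expect_buildLevels_succ]
    split_ifs with hem
    · exact zero_le
    · set K : ℝ≥0∞ := passCost P * ENNReal.ofReal (invRate P) with hK
      rw [expect_eq_cost_add]
      have step : ∀ G', expect f 1 (buildLevels P τ fuel (i + 1) (nextState f P τ s i G')) 0 ≤
          K * potential f P τ ((s.L i).filter fun e => τ ≤ dens f P e G') G' := by
        intro G'
        have hLs : (nextState f P τ s i G').L (i + 1)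
            = (s.L i).filter fun e => τ ≤ dens f P e G' := Function.update_self _ _ _
        have hG : (nextState f P τ s i G').G i = G' := Function.update_self _ _ _
        have := ih (i + 1) (by omega) (nextState f P τ s i G') (by
          rw [hLs, Nat.add_sub_cancel, hG]
          exact fun a ha => ⟨(Finset.mem_filter.1 ha).2, (hgood a (Finset.mem_filter.1 ha).1).2⟩)
        rwa [hLs, Nat.add_sub_cancel, hG] at this
      have hdrop := expect_potential_add_le h hτ (subset_refl (s.L i)) hgood (by omega)
      set Φ := potential f P τ (s.L i) (s.G (i - 1))
      set x := expect f 0 (sampleNext P τ (s.L i) (s.G (i - 1))) (fun G' =>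
        (potential f P τ ((s.L i).filter fun e => τ ≤ dens f P e G') G' : ℝ≥0∞))
      have hcard : ((s.L i).card : ℝ≥0∞) ≤ Φ := by exact_mod_cast card_le_potential _ _
      calc _ ≤ (2 * simCount E P.eps + 4 : ℕ) * (s.L i).card * 1 +
            expect f 0 (sampleNext P τ (s.L i) (s.G (i - 1))) (fun G' =>
              K * (potential f P τ ((s.L i).filter fun e => τ ≤ dens f P e G') G' : ℝ≥0∞)
                + (2 * (s.L i).card : ℕ) * 1) := by
            gcongr
            · exact cost_sampleNext_le _ _ _
            · refine expect_mono fun G' => ?_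
              rw [add_comm]
              gcongr
              exact step G'
        _ = passCost P * (s.L i).card + K * x := by
            rw [expect_add_const, expect_mul_left]
            unfold passCost; push_cast; ring
        _ ≤ passCost P * Φ + K * x := by gcongr
        _ = passCost P * (ENNReal.ofReal (invRate P) * x + Φ) := by rw [hK]; ring
        _ ≤ passCost P * (ENNReal.ofReal (invRate P) * Φ) := by gcongr
        _ = K * Φ := by rw [hK]; ring

/-- The state at the beginning of the loop of a reconstruction. -/
def reconstructStart (i : ℕ) (s : LevelData E) : LevelData E :=
  { s with
    L := Function.update s.L i (s.Lbar i \ s.D)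
    Lbar := Function.update s.Lbar i (s.Lbar i \ s.D) }

theorem reconstruct_eq (i : ℕ) (s : LevelData E) :
    reconstruct P τ i s
      = buildLevels P τ ((s.Lbar i \ s.D).card + 1) i (reconstructStart i s) := rfl

theorem cost_reconstruct_le (h : Admissible f P) (hτ : 0 < τ) (i : ℕ) (hi : 1 ≤ i)
    (s : LevelData E) (hgood : Good f P τ (s.Lbar i) (s.G (i - 1))) :
    expect f 1 (reconstruct P τ i s) 0 ≤ buildCost P * (s.Lbar i).card := by
  rw [reconstruct_eq]
  have e1 : (reconstructStart i s).L i = s.Lbar i \ s.D := Function.update_self _ _ _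
  have e2 : (reconstructStart i s).G = s.G := rfl
  have hg : Good f P τ (s.Lbar i \ s.D) (s.G (i - 1)) :=
    fun e he => hgood e (Finset.sdiff_subset he)
  refine (cost_buildLevels_le_potential h hτ _ i hi _ (by rwa [e1, e2])).trans ?_
  rw [e1, e2, buildCost, mul_assoc _ (kappa P : ℝ≥0∞)]
  gcongr
  exact_mod_cast (potential_le h hτ hg).trans
    (Nat.mul_le_mul_left _ (Finset.card_le_card Finset.sdiff_subset))

/-- What is known about the result of a reconstruction. -/
structure Rebuilt (f : Finset E → ℝ) (P : Params E) (τ : ℝ) (i : ℕ) (s s' : LevelData E) : Prop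
    extends Fresh f P τ i s' where
  D_eq : s'.D = s.D
  T_le : i ≤ s'.T + 1
  L_eq : ∀ j < i, s'.L j = s.L j
  Lbar_eq : ∀ j < i, s'.Lbar j = s.Lbar j
  G_eq : ∀ j < i, s'.G j = s.G j
  B_eq : ∀ j < i, s'.B j = s.B j

theorem rebuilt_reconstruct (h : Admissible f P) (hτ : 0 < τ) (i : ℕ) (hi : 1 ≤ i)
    (s : LevelData E) (hgood : Good f P τ (s.Lbar i) (s.G (i - 1)))
    (hanti : 2 ≤ i → s.Lbar i ⊆ s.Lbar (i - 1)) :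
    All f (reconstruct P τ i s) (Rebuilt f P τ i s) := by
  rw [reconstruct_eq]
  have e1 : (reconstructStart i s).L i = s.Lbar i \ s.D := Function.update_self _ _ _
  have e2 : (reconstructStart i s).Lbar i = s.Lbar i \ s.D := Function.update_self _ _ _
  have e3 : (reconstructStart i s).G = s.G := rfl
  have e4 : (reconstructStart i s).D = s.D := rfl
  have := (fresh_buildLevels h hτ ((s.Lbar i \ s.D).card + 1) i hi (reconstructStart i s)
    (e2.trans e1.symm)
    (by rw [e1, e3]; exact fun e he => hgood e (Finset.sdiff_subset he))
    (fun hi2 => by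
      rw [e1]
      refine Finset.sdiff_subset.trans ((hanti hi2).trans_eq ?_)
      exact (Function.update_of_ne (by omega) _ _).symm)
    (by rw [e1]; omega) (by rw [e1, e4]; exact Finset.disjoint_sdiff)).and
    (frame_buildLevels ((s.Lbar i \ s.D).card + 1) i hi (reconstructStart i s))
  refine this.mono fun s' ⟨hf, hfr⟩ => ⟨hf, hfr.D, hfr.T, fun j hj => ?_, fun j hj => ?_, hfr.G, hfr.B⟩
  · rw [hfr.L j hj.le]; exact Function.update_of_ne (by omega) _ _
  · rw [hfr.Lbar j hj.le]; exact Function.update_of_ne (by omega) _ _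

theorem Rebuilt.inv {i : ℕ} {s s' : LevelData E} (H : Rebuilt f P τ i s s')
    (hs : ∀ j, 1 ≤ j → j < i → LevelOK f P τ s j) : Inv f P τ s' := by
  refine ⟨fun j h1 h2 => ?_, H.last⟩
  rcases lt_or_ge j i with hj | hj
  · exact (hs j h1 hj).congr (H.L_eq j hj) (H.Lbar_eq j hj) (H.B_eq j hj) (H.G_eq _ (by omega))
      fun _ => H.Lbar_eq _ (by omega)
  · exact H.level j hj h2

/-- The credit stored at level `j`. -/
noncomputable def credit (a b : ℝ≥0∞) (s : LevelData E) (j : ℕ) : ℝ≥0∞ :=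
  a * (s.Lbar j \ s.L j).card + b * (s.D ∩ s.B j).card

/-- The credit stored in the data structure. -/
noncomputable def totalCredit (a b : ℝ≥0∞) (s : LevelData E) : ℝ≥0∞ := ∑ j ∈ Finset.Icc 1 s.T, credit a b s j

/-- Fresh levels carry no credit, since `Lbar = L` and their buckets avoid `D`. All credit from
level `i` upwards is therefore released to pay for the reconstruction. -/
theorem Rebuilt.totalCredit_le {i : ℕ} {s s' : LevelData E} (H : Rebuilt f P τ i s s')
    (a b : ℝ≥0∞) : totalCredit a b s' ≤ ∑ j ∈ Finset.Ico 1 i, credit a b s j := by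
  have hsub : Finset.Ico 1 i ⊆ Finset.Icc 1 s'.T := by
    intro j hj
    have := H.T_le
    rw [Finset.mem_Ico] at hj
    rw [Finset.mem_Icc]; omega
  rw [totalCredit, ← Finset.sum_subset hsub]
  · refine (Finset.sum_congr rfl fun j hj => ?_).le
    have hj := (Finset.mem_Ico.1 hj).2
    rw [credit, credit, H.L_eq j hj, H.Lbar_eq j hj, H.B_eq j hj, H.D_eq]
  · intro j hj hj'
    rw [Finset.mem_Icc] at hj
    rw [Finset.mem_Ico] at hj'
    rw [credit, H.Lbar j (by omega) hj.2, H.del j (by omega) hj.2]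
    simp

theorem expect_reconstruct_le (h : Admissible f P) (hτ : 0 < τ) (i : ℕ) (hi : 1 ≤ i)
    (s : LevelData E) (hgood : Good f P τ (s.Lbar i) (s.G (i - 1)))
    (hanti : 2 ≤ i → s.Lbar i ⊆ s.Lbar (i - 1)) (a b : ℝ≥0∞) :
    expect f 1 (reconstruct P τ i s) (totalCredit a b)
      ≤ buildCost P * (s.Lbar i).card + ∑ j ∈ Finset.Ico 1 i, credit a b s j := by
  rw [expect_eq_cost_add]
  gcongr
  · exact cost_reconstruct_le h hτ i hi s hgood
  · rw [← expect_const f (reconstruct P τ i s) (∑ j ∈ Finset.Ico 1 i, credit a b s j)]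
    exact ((rebuilt_reconstruct h hτ i hi s hgood hanti).mono fun s' H =>
      H.totalCredit_le a b).expect_le

end Build

end SubmodularCover

/-! ### Amortized cost of one update in one run -/

namespace SubmodularCover

open QueryAlg

section Step

variable {E : Type} [Fintype E] [DecidableEq E] {f : Finset E → ℝ} {P : Params E} {τ : ℝ}

/-- Adds `e` to the extension of level `i`. -/
def addTo (e : E) (i : ℕ) (s : LevelData E) : LevelData E :=
  { s with Lbar := Function.update s.Lbar i (insert e (s.Lbar i)) }

theorem addTo_Lbar_self (e : E) (i : ℕ) (s : LevelData E) :
    (addTo e i s).Lbar i = insert e (s.Lbar i) := Function.update_self _ _ _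

theorem insertLoop_succ (e : E) (k i : ℕ) (s : LevelData E) :
    insertLoop P τ e (k + 1) i s = density P e (s.G (i - 1)) >>= fun d =>
      if d < τ then pure s
      else if i = s.T + 1 ∨ (3 / 2 : ℝ) * (s.L i).card ≤ (insert e (s.Lbar i)).card then
        reconstruct P τ i (addTo e i s)
      else insertLoop P τ e k (i + 1) (addTo e i s) := by
  rw [← addTo_Lbar_self]; rfl

theorem expect_insertLoop_succ (e : E) (k i : ℕ) (s : LevelData E) (c : ℝ≥0∞)
    (g : LevelData E → ℝ≥0∞) :
    expect f c (insertLoop P τ e (k + 1) i s) g = 2 * c +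
      if dens f P e (s.G (i - 1)) < τ then g s
      else if i = s.T + 1 ∨ (3 / 2 : ℝ) * (s.L i).card ≤ (insert e (s.Lbar i)).card then
        expect f c (reconstruct P τ i (addTo e i s)) g
      else expect f c (insertLoop P τ e k (i + 1) (addTo e i s)) g := by
  rw [insertLoop_succ, expect_bind, (computes_density _ _).1]
  split_ifs <;> rfl

theorem all_insertLoop_succ (e : E) (k i : ℕ) (s : LevelData E) (Q : LevelData E → Prop) :
    All f (insertLoop P τ e (k + 1) i s) Q ↔
      if dens f P e (s.G (i - 1)) < τ then Q s
      else if i = s.T + 1 ∨ (3 / 2 : ℝ) * (s.L i).card ≤ (insert e (s.Lbar i)).card then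
        All f (reconstruct P τ i (addTo e i s)) Q
      else All f (insertLoop P τ e k (i + 1) (addTo e i s)) Q := by
  rw [insertLoop_succ, all_bind, (computes_density _ _).2]
  split_ifs <;> rfl

theorem addTo_Lbar_of_ne (e : E) {i j : ℕ} (h : j ≠ i) (s : LevelData E) :
    (addTo e i s).Lbar j = s.Lbar j := Function.update_of_ne h _ _

theorem good_addTo {e : E} {i : ℕ} {s : LevelData E} (hs : Inv f P τ s) (hi : 1 ≤ i)
    (hiT : i ≤ s.T + 1) (he : f {e} / P.w e ≤ τ * eta P) (hd : τ ≤ dens f P e (s.G (i - 1))) :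
    Good f P τ ((addTo e i s).Lbar i) (s.G (i - 1)) := by
  rw [addTo_Lbar_self]
  intro a ha
  rcases Finset.mem_insert.1 ha with rfl | ha
  · exact ⟨hd, he⟩
  · rcases hiT.lt_or_eq with h | h
    · exact (hs.level i hi (by omega)).good a ha
    · rw [h, hs.last] at ha; simp at ha

theorem anti_addTo {e : E} {i : ℕ} {s : LevelData E} (hs : Inv f P τ s)
    (hiT : i ≤ s.T + 1) (hmem : 2 ≤ i → e ∈ s.Lbar (i - 1)) (hi2 : 2 ≤ i) :
    (addTo e i s).Lbar i ⊆ (addTo e i s).Lbar (i - 1) := by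
  rw [addTo_Lbar_self, addTo_Lbar_of_ne e (by omega)]
  refine Finset.insert_subset (hmem hi2) ?_
  rcases hiT.lt_or_eq with h | h
  · exact (hs.level i (by omega) (by omega)).anti hi2
  · rw [h, hs.last]; exact Finset.empty_subset _

theorem level_addTo_of_lt {e : E} {i j : ℕ} {s : LevelData E} (hs : Inv f P τ s) (hj : 1 ≤ j)
    (hji : j < i) (hiT : i ≤ s.T + 1) : LevelOK f P τ (addTo e i s) j :=
  (hs.level j hj (by omega)).congr rfl (addTo_Lbar_of_ne e (by omega) s) rfl rfl
    fun _ => addTo_Lbar_of_ne e (by omega) s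

/-- The failed growth test `hcard` is exactly the size invariant, and `hmem` preserves the nesting
of the extended levels. -/
theorem inv_addTo {e : E} {i : ℕ} {s : LevelData E} (hs : Inv f P τ s) (hi : 1 ≤ i)
    (hiT : i ≤ s.T) (he : f {e} / P.w e ≤ τ * eta P) (hd : τ ≤ dens f P e (s.G (i - 1)))
    (hmem : 2 ≤ i → e ∈ s.Lbar (i - 1))
    (hcard : ¬ (3 / 2 : ℝ) * (s.L i).card ≤ (insert e (s.Lbar i)).card) :
    Inv f P τ (addTo e i s) := by
  refine ⟨fun j h1 h2 => ?_, ?_⟩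
  swap
  · change (addTo e i s).Lbar (s.T + 1) = ∅
    rw [addTo_Lbar_of_ne e (by omega)]; exact hs.last
  change j ≤ s.T at h2
  rcases lt_trichotomy j i with h | rfl | h
  · exact level_addTo_of_lt hs h1 h (by omega)
  · have ho := hs.level j h1 h2
    refine ⟨ho.nonempty, ?_, ?_, ho.bucket, good_addTo hs hi (by omega) he hd,
      anti_addTo hs (by omega) hmem⟩
    · rw [addTo_Lbar_self]; exact ho.sub.trans (Finset.subset_insert _ _)
    · rw [addTo_Lbar_self]
      change _ < 3 * (s.L j).card
      rw [not_le] at hcard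
      have : (2 : ℝ) * (insert e (s.Lbar j)).card < 3 * (s.L j).card := by linarith
      exact_mod_cast this
  · have ho := hs.level j h1 h2
    refine ⟨ho.nonempty, ?_, ?_, ho.bucket, ?_, fun h3 => ?_⟩
    · rw [addTo_Lbar_of_ne e (by omega)]; exact ho.sub
    · rw [addTo_Lbar_of_ne e (by omega)]; exact ho.card
    · rw [addTo_Lbar_of_ne e (by omega)]; exact ho.good
    · rw [addTo_Lbar_of_ne e (by omega)]
      refine (ho.anti h3).trans ?_
      by_cases h4 : j - 1 = i
      · rw [h4, addTo_Lbar_self]; exact Finset.subset_insert _ _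
      · rw [addTo_Lbar_of_ne e h4]

/-- The relation `hk` says that the loop counter ends at level `T + 1`, where a reconstruction is
forced unless the density test stops the loop. -/
theorem inv_insertLoop (h : Admissible f P) (hτ : 0 < τ) {e : E}
    (he : f {e} / P.w e ≤ τ * eta P) (k i : ℕ) (hi : 1 ≤ i) (s : LevelData E)
    (hs : Inv f P τ s) (hk : k + i = s.T + 2) (hmem : 2 ≤ i → e ∈ s.Lbar (i - 1)) :
    All f (insertLoop P τ e k i s) (Inv f P τ) := by
  induction k generalizing i s with
  | zero => exact hs
  | succ k ih =>
    rw [all_insertLoop_succ]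
    split_ifs with hd hc
    · exact hs
    · exact (rebuilt_reconstruct h hτ i hi (addTo e i s)
        (good_addTo hs hi (by omega) he (not_lt.1 hd)) (anti_addTo hs (by omega) hmem)).mono
        fun s' H => H.inv fun j h1 h2 => level_addTo_of_lt hs h1 h2 (by omega)
    · rw [not_or] at hc
      refine ih (i + 1) (by omega) (addTo e i s)
        (inv_addTo hs hi (by omega) he (not_lt.1 hd) hmem hc.2) ?_ fun _ => ?_
      · change _ = s.T + 2; omega
      · rw [Nat.add_sub_cancel, addTo_Lbar_self]; exact Finset.mem_insert_self _ _

theorem credit_addTo_of_ne {a b : ℝ≥0∞} {e : E} {i j : ℕ} (hj : j ≠ i) (s : LevelData E) :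
    credit a b (addTo e i s) j = credit a b s j := by
  rw [credit, addTo_Lbar_of_ne e hj]; rfl

theorem credit_addTo_self_le {a b : ℝ≥0∞} {e : E} {i : ℕ} (s : LevelData E) :
    credit a b (addTo e i s) i ≤ credit a b s i + a := by
  rw [credit, addTo_Lbar_self, credit, add_right_comm]
  gcongr
  · have : (insert e (s.Lbar i) \ (addTo e i s).L i).card ≤ (s.Lbar i \ s.L i).card + 1 := by
      refine (Finset.card_le_card ?_).trans (Finset.card_insert_le e _)
      intro x hx
      simp only [Finset.mem_sdiff, Finset.mem_insert] at hx ⊢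
      tauto
    calc a * _ ≤ a * ((s.Lbar i \ s.L i).card + 1 : ℕ) := by gcongr
      _ = _ := by push_cast; ring
  · exact subset_rfl
  · exact subset_rfl

theorem totalCredit_split {a b : ℝ≥0∞} {s : LevelData E} {i : ℕ} (hi : 1 ≤ i) (hiT : i ≤ s.T) :
    ∑ j ∈ Finset.Ico 1 i, credit a b s j + credit a b s i ≤ totalCredit a b s := by
  rw [← Finset.sum_Ico_succ_top hi]
  refine Finset.sum_le_sum_of_subset fun j hj => ?_
  rw [Finset.mem_Ico] at hj
  rw [Finset.mem_Icc]; omega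

theorem totalCredit_addTo_le {a b : ℝ≥0∞} {e : E} {i : ℕ} (s : LevelData E) :
    totalCredit a b (addTo e i s) ≤ totalCredit a b s + a := by
  change ∑ j ∈ Finset.Icc 1 s.T, credit a b (addTo e i s) j ≤ ∑ j ∈ Finset.Icc 1 s.T, _ + a
  by_cases hi : i ∈ Finset.Icc 1 s.T
  · rw [← Finset.add_sum_erase _ _ hi, ← Finset.add_sum_erase _ _ hi]
    rw [Finset.sum_congr rfl fun j hj => credit_addTo_of_ne (Finset.ne_of_mem_erase hj) s]
    calc _ ≤ credit a b s i + a + _ := by gcongr; exact credit_addTo_self_le s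
      _ = _ := by ring
  · rw [Finset.sum_congr rfl fun j hj => credit_addTo_of_ne (ne_of_mem_of_not_mem hj hi) s]
    exact le_self_add

/-- Each visited level is charged two queries and a deposit of `3 * buildCost`. A reconstruction at
a level `≤ T` is paid by the credit stored there; the last summand pays for one at level `T + 1`. -/
theorem expect_insertLoop_le (h : Admissible f P) (hτ : 0 < τ) {e : E}
    (he : f {e} / P.w e ≤ τ * eta P) (b : ℝ≥0∞) (k i : ℕ) (hi : 1 ≤ i) (s : LevelData E)
    (hs : Inv f P τ s) (hk : k + i = s.T + 2) (hmem : 2 ≤ i → e ∈ s.Lbar (i - 1)) :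
    expect f 1 (insertLoop P τ e k i s) (totalCredit (3 * buildCost P) b)
      ≤ totalCredit (3 * buildCost P) b s + k * (2 + 3 * buildCost P) + buildCost P := by
  induction k generalizing i s with
  | zero => simp only [insertLoop, expect_pure, Nat.cast_zero, zero_mul, add_zero]; exact le_self_add
  | succ k ih =>
    rw [expect_insertLoop_succ]
    have hk1 : ((k + 1 : ℕ) : ℝ≥0∞) * (2 + 3 * buildCost P)
        = k * (2 + 3 * buildCost P) + 3 * buildCost P + 2 := by push_cast; ring
    have hgoal : ∀ x, x ≤ totalCredit (3 * buildCost P) b s + k * (2 + 3 * buildCost P)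
        + 3 * buildCost P + buildCost P →
        2 * 1 + x ≤ totalCredit (3 * buildCost P) b s + (k + 1 : ℕ) * (2 + 3 * buildCost P)
          + buildCost P := fun x hx =>
      calc 2 * 1 + x ≤ 2 * 1 + (totalCredit (3 * buildCost P) b s + k * (2 + 3 * buildCost P)
        + 3 * buildCost P + buildCost P) := by gcongr
        _ = _ := by rw [hk1]; ring
    apply hgoal
    split_ifs with hd hc
    · rw [add_assoc, add_assoc]; exact le_self_add
    · refine (expect_reconstruct_le h hτ i hi (addTo e i s)
        (good_addTo hs hi (by omega) he (not_lt.1 hd)) (anti_addTo hs (by omega) hmem) _ _).trans ?_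
      have hsum : ∑ j ∈ Finset.Ico 1 i, credit (3 * buildCost P) b (addTo e i s) j
          = ∑ j ∈ Finset.Ico 1 i, credit (3 * buildCost P) b s j :=
        Finset.sum_congr rfl fun j hj => credit_addTo_of_ne (Finset.mem_Ico.1 hj).2.ne s
      rw [hsum]
      -- Level `T + 1` was empty, so the rebuilt set is contained in `{e}` and costs at most one
      -- `buildCost`.
      by_cases hiT : i = s.T + 1
      · rw [addTo_Lbar_self, hiT, hs.last]
        simp only [insert_empty_eq, Finset.card_singleton, Nat.cast_one, mul_one]
        have : ∑ j ∈ Finset.Ico 1 (s.T + 1), credit (3 * buildCost P) b s j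
            = totalCredit (3 * buildCost P) b s := rfl
        rw [this, add_comm, add_assoc (totalCredit _ _ _), add_assoc (totalCredit _ _ _)]
        gcongr
        exact le_add_self
      · have hc : (3 / 2 : ℝ) * (s.L i).card ≤ (insert e (s.Lbar i)).card := by tauto
        have hc' : 3 * (s.L i).card ≤ 2 * (insert e (s.Lbar i)).card := by
          have : 3 * ((s.L i).card : ℝ) ≤ 2 * (insert e (s.Lbar i)).card := by linarith
          exact_mod_cast this
        -- From `|Lbar| ≥ (3/2) |L|`, at least a third of `Lbar` is new; this is where the credit
        -- factor `3` comes from.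
        have hcard : (insert e (s.Lbar i)).card ≤ 3 * ((addTo e i s).Lbar i \ s.L i).card := by
          rw [addTo_Lbar_self]
          have := Finset.le_card_sdiff (s.L i) (insert e (s.Lbar i))
          omega
        have hcr : buildCost P * (insert e (s.Lbar i)).card
            ≤ credit (3 * buildCost P) b s i + 3 * buildCost P := by
          refine le_trans ?_ (credit_addTo_self_le (e := e) s)
          refine le_trans ?_ le_self_add
          calc buildCost P * (insert e (s.Lbar i)).card
              ≤ buildCost P * (3 * ((addTo e i s).Lbar i \ s.L i).card : ℕ) := by gcongr
            _ = _ := by push_cast; rw [← mul_assoc, mul_comm (buildCost P)]; rfl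
        rw [addTo_Lbar_self]
        calc _ ≤ credit (3 * buildCost P) b s i + 3 * buildCost P
              + ∑ j ∈ Finset.Ico 1 i, credit (3 * buildCost P) b s j := by gcongr
          _ = ∑ j ∈ Finset.Ico 1 i, credit (3 * buildCost P) b s j
              + credit (3 * buildCost P) b s i + 3 * buildCost P := by ring
          _ ≤ totalCredit (3 * buildCost P) b s + 3 * buildCost P := by
            gcongr; exact totalCredit_split hi (by omega)
          _ ≤ _ := by
            rw [add_assoc (totalCredit _ _ _), add_assoc (totalCredit _ _ _)]
            gcongr
            rw [add_comm (_ * _), add_assoc]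
            exact le_self_add
    · rw [not_or] at hc
      refine (ih (i + 1) (by omega) (addTo e i s)
        (inv_addTo hs hi (by omega) he (not_lt.1 hd) hmem hc.2) ?_ fun _ => ?_).trans ?_
      · change _ = s.T + 2; omega
      · rw [Nat.add_sub_cancel, addTo_Lbar_self]; exact Finset.mem_insert_self _ _
      · calc _ ≤ totalCredit (3 * buildCost P) b s + 3 * buildCost P + k * (2 + 3 * buildCost P)
              + buildCost P := by gcongr; exact totalCredit_addTo_le s
          _ = _ := by ring

theorem expect_deleteLoop_succ (k i : ℕ) (s : LevelData E) (c : ℝ≥0∞) (g : LevelData E → ℝ≥0∞) :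
    expect f c (deleteLoop P τ (k + 1) i s) g =
      if P.epsDel * ((s.B i).card : ℝ) ≤ ((s.D ∩ s.B i).card : ℝ) then
        expect f c (reconstruct P τ i s) g
      else expect f c (deleteLoop P τ k (i + 1) s) g := by
  rw [deleteLoop]; split_ifs <;> rfl

theorem all_deleteLoop_succ (k i : ℕ) (s : LevelData E) (Q : LevelData E → Prop) :
    All f (deleteLoop P τ (k + 1) i s) Q ↔
      if P.epsDel * ((s.B i).card : ℝ) ≤ ((s.D ∩ s.B i).card : ℝ) then
        All f (reconstruct P τ i s) Q
      else All f (deleteLoop P τ k (i + 1) s) Q := by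
  rw [deleteLoop]; split_ifs <;> rfl

theorem inv_deleteLoop (h : Admissible f P) (hτ : 0 < τ) (k i : ℕ) (hi : 1 ≤ i)
    (s : LevelData E) (hs : Inv f P τ s) (hk : k + i = s.T + 1) :
    All f (deleteLoop P τ k i s) (Inv f P τ) := by
  induction k generalizing i with
  | zero => exact hs
  | succ k ih =>
    rw [all_deleteLoop_succ]
    have ho := hs.level i hi (by omega)
    split_ifs with hc
    · exact (rebuilt_reconstruct h hτ i hi s ho.good ho.anti).mono
        fun s' H => H.inv fun j h1 h2 => hs.level j h1 (by omega)
    · exact ih (i + 1) (by omega) (by omega)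

/-- The credit per deleted element of a bucket. -/
noncomputable def delCredit (P : Params E) : ℝ≥0∞ :=
  buildCost P * ENNReal.ofReal (3 / 2 * (kappa P : ℝ) ^ 2 / P.epsDel)

/-- The tests cost no queries. When one fires, `|Lbar| ≤ (3/2) |L| ≤ (3/2) κ ^ 2 |B| ≤ (3/2) κ ^ 2
|D ∩ B| / ε_del`, so the credit on the deleted bucket elements covers the reconstruction. -/
theorem expect_deleteLoop_le (h : Admissible f P) (hτ : 0 < τ) (a : ℝ≥0∞) (k i : ℕ) (hi : 1 ≤ i)
    (s : LevelData E) (hs : Inv f P τ s) (hk : k + i = s.T + 1) :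
    expect f 1 (deleteLoop P τ k i s) (totalCredit a (delCredit P))
      ≤ totalCredit a (delCredit P) s := by
  induction k generalizing i with
  | zero => exact le_rfl
  | succ k ih =>
    rw [expect_deleteLoop_succ]
    have ho := hs.level i hi (by omega)
    split_ifs with hc
    · refine (expect_reconstruct_le h hτ i hi s ho.good ho.anti _ _).trans ?_
      refine le_trans ?_ (totalCredit_split hi (by omega))
      rw [add_comm]
      gcongr
      refine le_trans ?_ le_add_self
      rw [delCredit, mul_assoc]
      gcongr
      have h1 : (s.L i).card ≤ kappa P ^ 2 * (s.B i).card := by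
        rw [ho.bucket]
        exact card_le_topBucket h hτ fun e he => ho.good e (ho.sub he)
      have h2 : 2 * (s.Lbar i).card ≤ 3 * (kappa P ^ 2 * (s.B i).card) := by
        have := ho.card; omega
      have h3 : (2 : ℝ) * (s.Lbar i).card ≤ 3 * (kappa P ^ 2 * (s.B i).card) := by
        exact_mod_cast h2
      have hdel := h.del_pos
      have h4 : ((s.B i).card : ℝ) ≤ (s.D ∩ s.B i).card / P.epsDel := by
        rw [le_div_iff₀ hdel, mul_comm]; exact hc
      have h5 : ((s.Lbar i).card : ℝ) ≤ 3 / 2 * (kappa P : ℝ) ^ 2 / P.epsDel * (s.D ∩ s.B i).card := by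
        calc ((s.Lbar i).card : ℝ) ≤ 3 / 2 * (kappa P : ℝ) ^ 2 * (s.B i).card := by linarith
          _ ≤ 3 / 2 * (kappa P : ℝ) ^ 2 * ((s.D ∩ s.B i).card / P.epsDel) := by gcongr
          _ = _ := by ring
      have := ENNReal.ofReal_le_ofReal h5
      rwa [ENNReal.ofReal_mul (by positivity), ENNReal.ofReal_natCast, ENNReal.ofReal_natCast] at this
    · exact ih (i + 1) (by omega) (by omega)

/-- The credit of a run. -/
noncomputable def runCredit (P : Params E) : LevelData E → ℝ≥0∞ :=
  totalCredit (3 * buildCost P) (delCredit P)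

/-- The amortized cost of an update of a run, per level. -/
noncomputable def stepCost (P : Params E) : ℝ≥0∞ := 2 + 4 * buildCost P + delCredit P

/-- The state at the beginning of the loop of an insertion. -/
def insertStart (e : E) (s : LevelData E) : LevelData E :=
  { s with D := s.D.erase e, Lbar := Function.update s.Lbar 0 (insert e (s.Lbar 0)) }

/-- The state at the beginning of the loop of a deletion. -/
def deleteStart (e : E) (s : LevelData E) : LevelData E := { s with D := insert e s.D }

theorem insertStart_Lbar (e : E) (s : LevelData E) {j : ℕ} (hj : 1 ≤ j) :
    (insertStart e s).Lbar j = s.Lbar j := Function.update_of_ne (by omega) _ _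

theorem inv_insertStart {s : LevelData E} (hs : Inv f P τ s) (e : E) :
    Inv f P τ (insertStart e s) :=
  ⟨fun j h1 h2 => (hs.level j h1 h2).congr rfl (insertStart_Lbar e s h1) rfl rfl
      fun hj => insertStart_Lbar e s (by omega),
    (insertStart_Lbar e s (by omega)).trans hs.last⟩

theorem inv_deleteStart {s : LevelData E} (hs : Inv f P τ s) (e : E) :
    Inv f P τ (deleteStart e s) :=
  ⟨fun j h1 h2 => (hs.level j h1 h2).congr rfl rfl rfl rfl fun _ => rfl, hs.last⟩

theorem inv_applyRun (h : Admissible f P) (hτ : 0 < τ) (u : Update E)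
    (hu : f {u.elem} / P.w u.elem ≤ τ * eta P) {s : LevelData E} (hs : Inv f P τ s) :
    All f (u.applyRun P τ s) (Inv f P τ) := by
  cases u with
  | ins e =>
    exact inv_insertLoop h hτ hu _ 1 le_rfl _ (inv_insertStart hs e) (by rfl)
      (by omega)
  | del e => exact inv_deleteLoop h hτ _ 1 le_rfl _ (inv_deleteStart hs e) rfl

/-- An insertion shrinks `D`, which only lowers credit before its loop starts; a deletion adds at
most one element to each `D ∩ B j`, hence at most one `delCredit` per level. -/
theorem expect_applyRun_le (h : Admissible f P) (hτ : 0 < τ) (u : Update E)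
    (hu : f {u.elem} / P.w u.elem ≤ τ * eta P) {s : LevelData E} (hs : Inv f P τ s) :
    expect f 1 (u.applyRun P τ s) (runCredit P) ≤ runCredit P s + (s.T + 1) * stepCost P := by
  cases u with
  | ins e =>
    refine (expect_insertLoop_le h hτ hu (delCredit P) _ 1 le_rfl _ (inv_insertStart hs e)
      (by simp [insertStart]) (by omega)).trans ?_
    have hc : totalCredit (3 * buildCost P) (delCredit P) (insertStart e s) ≤ runCredit P s := by
      refine Finset.sum_le_sum fun j hj => ?_
      rw [Finset.mem_Icc] at hj
      rw [credit, insertStart_Lbar e s hj.1]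
      unfold credit
      gcongr
      · exact le_rfl
      · exact Finset.erase_subset _ _
      · exact subset_rfl
    calc _ ≤ runCredit P s + (s.T + 1 : ℕ) * (2 + 3 * buildCost P) + (s.T + 1) * buildCost P := by
          gcongr
          exact le_mul_of_one_le_left zero_le le_add_self
      _ = runCredit P s + (s.T + 1) * (2 + 4 * buildCost P) := by push_cast; ring
      _ ≤ _ := by
          unfold stepCost
          refine add_le_add le_rfl ?_
          exact mul_le_mul_right le_self_add _
  | del e =>
    refine (expect_deleteLoop_le h hτ (3 * buildCost P) _ 1 le_rfl _ (inv_deleteStart hs e)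
      (by simp [deleteStart])).trans ?_
    have hc : totalCredit (3 * buildCost P) (delCredit P) (deleteStart e s)
        ≤ ∑ j ∈ Finset.Icc 1 s.T, (credit (3 * buildCost P) (delCredit P) s j + delCredit P) := by
      refine Finset.sum_le_sum fun j _ => ?_
      unfold credit
      rw [add_assoc]
      refine add_le_add le_rfl ?_
      have : ((deleteStart e s).D ∩ (deleteStart e s).B j).card ≤ (s.D ∩ s.B j).card + 1 := by
        refine (Finset.card_le_card ?_).trans (Finset.card_insert_le e _)
        intro x hx
        simp only [deleteStart, Finset.mem_inter, Finset.mem_insert] at hx ⊢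
        tauto
      calc _ ≤ delCredit P * ((s.D ∩ s.B j).card + 1 : ℕ) := by gcongr
        _ = _ := by push_cast; ring
    refine hc.trans ?_
    rw [Finset.sum_add_distrib, Finset.sum_const, nsmul_eq_mul, Nat.card_Icc]
    unfold runCredit totalCredit stepCost
    gcongr
    · simp
    · exact le_add_self

end Step

end SubmodularCover

/-! ### Deferred decisions: redrawing the selection at one level -/

namespace SubmodularCover

open QueryAlg

section Resample

variable {E : Type} [Fintype E] [DecidableEq E] {f : Finset E → ℝ} {P : Params E} {τ : ℝ}
  {i : ℕ} {φ : LevelData E → ℝ≥0∞}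

/-- The two states agree on everything that precedes the selection at level `i`. -/
structure Same (i : ℕ) (s s' : LevelData E) : Prop where
  D : s.D = s'.D
  L : ∀ j ≤ i, s.L j = s'.L j
  Lbar : ∀ j ≤ i, s.Lbar j = s'.Lbar j
  G : ∀ j < i, s.G j = s'.G j
  B : ∀ j < i, s.B j = s'.B j

/-- The two states agree up to the selection at level `i`. -/
structure Agree (i : ℕ) (s s' : LevelData E) : Prop extends Same i s s' where
  T : min s.T i = min s'.T i
  Gi : i ≤ s.T → s.G i = s'.G i
  Bi : i ≤ s.T → s.B i = s'.B i

/-- `φ` depends only on the levels up to `i`. -/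
def LocalAt (i : ℕ) (φ : LevelData E → ℝ≥0∞) : Prop := ∀ s s', Agree i s s' → φ s = φ s'

/-- Replaces the set selected at level `i`. -/
def setG (i : ℕ) (G' : Finset E) (s : LevelData E) : LevelData E :=
  { s with G := Function.update s.G i G' }

/-- The average of `φ` when the selection at level `i` is drawn anew. -/
noncomputable def resample (f : Finset E → ℝ) (P : Params E) (τ : ℝ) (i : ℕ)
    (φ : LevelData E → ℝ≥0∞) (s : LevelData E) : ℝ≥0∞ :=
  if i ≤ s.T then
    expect f 0 (sampleNext P τ (s.L i) (s.G (i - 1))) fun G' => φ (setG i G' s)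
  else φ s

theorem Agree.refl (i : ℕ) (s : LevelData E) : Agree i s s :=
  ⟨⟨rfl, fun _ _ => rfl, fun _ _ => rfl, fun _ _ => rfl, fun _ _ => rfl⟩, rfl, fun _ => rfl,
    fun _ => rfl⟩

theorem Agree.trans {s₁ s₂ s₃ : LevelData E} (h : Agree i s₁ s₂) (h' : Agree i s₂ s₃) :
    Agree i s₁ s₃ where
  D := h.D.trans h'.D
  L j hj := (h.L j hj).trans (h'.L j hj)
  Lbar j hj := (h.Lbar j hj).trans (h'.Lbar j hj)
  G j hj := (h.G j hj).trans (h'.G j hj)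
  B j hj := (h.B j hj).trans (h'.B j hj)
  T := h.T.trans h'.T
  Gi hi := (h.Gi hi).trans (h'.Gi (by have := h.T; omega))
  Bi hi := (h.Bi hi).trans (h'.Bi (by have := h.T; omega))

theorem Frame.agree {j : ℕ} {s s' : LevelData E} (h : Frame j s s') (hj : i < j) (hT : i ≤ s.T) :
    Agree i s s' where
  D := h.D.symm
  L k hk := (h.L k (by omega)).symm
  Lbar k hk := (h.Lbar k (by omega)).symm
  G k hk := (h.G k (by omega)).symm
  B k hk := (h.B k (by omega)).symm
  T := by have := h.T; omega
  Gi _ := (h.G i hj).symm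
  Bi _ := (h.B i hj).symm

/-- Building above level `i` is invisible to `φ`, which sees of `T` only whether level `i` is
reached; hence `T` can be reset to `i`. -/
theorem expect_buildLevels_above (hφ : LocalAt i φ) (fuel j : ℕ) (hj : i < j) (s : LevelData E) :
    expect f 0 (buildLevels P τ fuel j s) φ = φ { s with T := i } := by
  rw [← expect_const f (buildLevels P τ fuel j s) (φ { s with T := i })]
  refine ((frame_buildLevels fuel j (by omega) s).mono fun s' h => ?_).expect_eq
  have : Frame j { s with T := i } s' := ⟨h.D, h.T, h.L, h.Lbar, h.G, h.B⟩
  exact (hφ _ _ (this.agree hj le_rfl)).symm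

theorem Same.agree_low {s s' : LevelData E} (h : Same i s s') {t : ℕ} (ht : t < i) :
    Agree i { s with T := t } { s' with T := t } where
  D := h.D
  L := h.L
  Lbar := h.Lbar
  G := h.G
  B := h.B
  T := rfl
  Gi hi := absurd hi (by simpa using ht)
  Bi hi := absurd hi (by simpa using ht)

theorem update_congr_of_eq {α : Type*} {g g' : ℕ → α} {a a' : α} {j k : ℕ} (ha : a = a')
    (hg : k ≠ j → g k = g' k) : Function.update g j a k = Function.update g' j a' k := by
  subst ha
  by_cases hk : k = j
  · subst hk; simp
  · rw [Function.update_of_ne hk, Function.update_of_ne hk, hg hk]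

theorem Same.nextState {s s' : LevelData E} (h : Same i s s') {j : ℕ} (h1 : 1 ≤ j) (hj : j ≤ i)
    (G' : Finset E) : Same i (nextState f P τ s j G') (nextState f P τ s' j G') where
  D := h.D
  L k hk := update_congr_of_eq (by rw [h.L j hj]) fun _ => h.L k hk
  Lbar k hk := update_congr_of_eq (by rw [h.L j hj]) fun _ => h.Lbar k hk
  G k hk := update_congr_of_eq rfl fun _ => h.G k hk
  B k hk := update_congr_of_eq (by rw [h.L j hj, h.G (j - 1) (by omega)]) fun _ => h.B k hk

theorem expect_buildLevels_congr (hφ : LocalAt i φ) (fuel j : ℕ) (h1 : 1 ≤ j) (hj : j ≤ i)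
    {s s' : LevelData E} (h : Same i s s') :
    expect f 0 (buildLevels P τ fuel j s) φ = expect f 0 (buildLevels P τ fuel j s') φ := by
  induction fuel generalizing j s s' with
  | zero => exact hφ _ _ (h.agree_low (by omega))
  | succ fuel ih =>
    rw [expect_buildLevels_succ, expect_buildLevels_succ, h.L j hj, h.G (j - 1) (by omega)]
    split_ifs
    · exact hφ _ _ (h.agree_low (by omega))
    · congr 1
      funext G'
      congr 1
      have hn := h.nextState (f := f) (P := P) (τ := τ) h1 hj G'
      rcases hj.lt_or_eq with hj' | rfl
      · exact ih (j + 1) (by omega) hj' hn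
      · rw [expect_buildLevels_above hφ _ _ (by omega), expect_buildLevels_above hφ _ _ (by omega)]
        refine hφ _ _ ⟨⟨hn.D, hn.L, hn.Lbar, hn.G, hn.B⟩, rfl, fun _ => ?_, fun _ => ?_⟩
        · exact update_congr_of_eq rfl fun hne => absurd rfl hne
        · exact update_congr_of_eq (by rw [h.L j le_rfl, h.G (j - 1) (by omega)])
            fun hne => absurd rfl hne

theorem Agree.setG {s s' : LevelData E} (h : Agree i s s') (G' : Finset E) :
    Agree i (setG i G' s) (setG i G' s') where
  D := h.D
  L := h.L
  Lbar := h.Lbar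
  G k hk := update_congr_of_eq rfl fun _ => h.G k hk
  B := h.B
  T := h.T
  Gi _ := update_congr_of_eq rfl fun hne => absurd rfl hne
  Bi := h.Bi

theorem LocalAt.resample (hi : 1 ≤ i) (hφ : LocalAt i φ) : LocalAt i (resample f P τ i φ) := by
  intro s s' h
  have hT := h.T
  unfold SubmodularCover.resample
  rw [h.L i le_rfl, h.G (i - 1) (by omega), hφ s s' h]
  simp only [fun G' => hφ _ _ (h.setG G')]
  congr 1
  exact propext (by omega)

/-- The redraw uses only `L i` and `G (i - 1)`, so it forgets the old selection and is idempotent.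
-/
theorem resample_setG (hi : 1 ≤ i) (G' : Finset E) {s : LevelData E} (hT : i ≤ s.T) :
    resample f P τ i φ (setG i G' s) = resample f P τ i φ s := by
  have e1 : (setG i G' s).G (i - 1) = s.G (i - 1) := Function.update_of_ne (by omega) _ _
  have e2 : ∀ G'', setG i G'' (setG i G' s) = setG i G'' s := fun G'' => by
    simp [setG]
  unfold resample
  rw [e1]
  simp only [e2]
  rw [if_pos hT, if_pos (show i ≤ (setG i G' s).T from hT)]
  rfl

theorem resample_of_lt {s : LevelData E} (hT : s.T < i) : resample f P τ i φ s = φ s :=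
  if_neg (by omega)

/-- A rebuild from a level `≤ i` either stops before level `i` or draws `G i` from `sampleNext`;
drawing it a second time from the same law changes nothing. -/
theorem expect_buildLevels_resample (hφ : LocalAt i φ) (fuel j : ℕ) (h1 : 1 ≤ j) (hj : j ≤ i)
    (s : LevelData E) :
    expect f 0 (buildLevels P τ fuel j s) φ
      = expect f 0 (buildLevels P τ fuel j s) (resample f P τ i φ) := by
  induction fuel generalizing j s with
  | zero => exact (resample_of_lt (by simp only; omega)).symm
  | succ fuel ih =>
    rw [expect_buildLevels_succ, expect_buildLevels_succ]
    split_ifs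
    · exact (resample_of_lt (by simp only; omega)).symm
    rcases hj.lt_or_eq with hj' | rfl
    · simp only [fun G' => ih (j + 1) (by omega) hj' (nextState f P τ s j G')]
    · simp only [fun G' => expect_buildLevels_above (f := f) (P := P) (τ := τ) hφ fuel (j + 1)
          (by omega) (nextState f P τ s j G'), mul_zero, zero_add,
        fun G' => expect_buildLevels_above (f := f) (P := P) (τ := τ)
          (hφ.resample (f := f) (P := P) (τ := τ) h1) fuel (j + 1) (by omega)
          (nextState f P τ s j G')]
      -- On the resampled side the first draw is overwritten, so it only averages a constant; that
      -- constant is the other side.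
      rw [← expect_const f (sampleNext P τ (s.L j) (s.G (j - 1)))
        (expect f 0 (sampleNext P τ (s.L j) (s.G (j - 1)))
          fun G' => φ { nextState f P τ s j G' with T := j })]
      congr 1
      funext G'
      rw [resample, if_pos le_rfl]
      have e1 : (nextState f P τ s j G').L j = s.L j := Function.update_of_ne (by omega) _ _
      have e2 : (nextState f P τ s j G').G (j - 1) = s.G (j - 1) :=
        Function.update_of_ne (by omega) _ _
      simp only [e1, e2]
      congr 1
      funext G''
      refine hφ _ _ ⟨⟨rfl, fun k hk => ?_, fun k hk => ?_, fun k hk => ?_, fun k hk => rfl⟩, rfl,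
        fun _ => ?_, fun _ => rfl⟩
      · exact (Function.update_of_ne (by omega) _ _).trans (Function.update_of_ne (by omega) _ _).symm
      · exact (Function.update_of_ne (by omega) _ _).trans (Function.update_of_ne (by omega) _ _).symm
      · simp [setG, nextState, Function.update_of_ne hk.ne]
      · simp [setG, nextState]

theorem Same.reconstructStart {s s' : LevelData E} (h : Same i s s') {j : ℕ} (hj : j ≤ i) :
    Same i (reconstructStart j s) (reconstructStart j s') where
  D := h.D
  L k hk := update_congr_of_eq (by rw [h.Lbar j hj, h.D]) fun _ => h.L k hk
  Lbar k hk := update_congr_of_eq (by rw [h.Lbar j hj, h.D]) fun _ => h.Lbar k hk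
  G := h.G
  B := h.B

theorem expect_reconstruct_congr (hφ : LocalAt i φ) {j : ℕ} (h1 : 1 ≤ j) (hj : j ≤ i)
    {s s' : LevelData E} (h : Same i s s') :
    expect f 0 (reconstruct P τ j s) φ = expect f 0 (reconstruct P τ j s') φ := by
  rw [reconstruct_eq, reconstruct_eq, h.Lbar j hj, h.D]
  exact expect_buildLevels_congr hφ _ j h1 hj (h.reconstructStart hj)

theorem expect_reconstruct_resample (hφ : LocalAt i φ) {j : ℕ} (h1 : 1 ≤ j) (hj : j ≤ i)
    (s : LevelData E) :
    expect f 0 (reconstruct P τ j s) φ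
      = expect f 0 (reconstruct P τ j s) (resample f P τ i φ) := by
  rw [reconstruct_eq]
  exact expect_buildLevels_resample hφ _ j h1 hj _

theorem agree_reconstruct {j : ℕ} (hj : i < j) {s : LevelData E} (hT : i ≤ s.T) :
    All f (reconstruct P τ j s) (Agree i s) := by
  rw [reconstruct_eq]
  refine (frame_buildLevels _ j (by omega) _).mono fun s' h => Agree.trans ?_ (h.agree hj hT)
  refine ⟨⟨rfl, fun k hk => ?_, fun k hk => ?_, fun _ _ => rfl, fun _ _ => rfl⟩, rfl, fun _ => rfl,
    fun _ => rfl⟩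
  · exact (Function.update_of_ne (by omega) _ _).symm
  · exact (Function.update_of_ne (by omega) _ _).symm

theorem agree_addTo (e : E) {j : ℕ} (hj : i < j) (s : LevelData E) : Agree i s (addTo e j s) :=
  ⟨⟨rfl, fun _ _ => rfl, fun k hk => (addTo_Lbar_of_ne e (by omega) s).symm, fun _ _ => rfl,
    fun _ _ => rfl⟩, rfl, fun _ => rfl, fun _ => rfl⟩

theorem agree_insertLoop (e : E) (k j : ℕ) (hj : i < j) {s : LevelData E} (hT : i ≤ s.T) :
    All f (insertLoop P τ e k j s) (Agree i s) := by
  induction k generalizing j s with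
  | zero => exact Agree.refl i s
  | succ k ih =>
    rw [all_insertLoop_succ]
    have ha := agree_addTo e hj s
    split_ifs
    · exact Agree.refl i s
    · exact (agree_reconstruct (s := addTo e j s) hj hT).mono fun _ => ha.trans
    · exact (ih (j + 1) (by omega) (s := addTo e j s) hT).mono fun _ => ha.trans

theorem agree_deleteLoop (k j : ℕ) (hj : i < j) {s : LevelData E} (hT : i ≤ s.T) :
    All f (deleteLoop P τ k j s) (Agree i s) := by
  induction k generalizing j with
  | zero => exact Agree.refl i s
  | succ k ih =>
    rw [all_deleteLoop_succ]
    split_ifs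
    · exact agree_reconstruct hj hT
    · exact ih (j + 1) (by omega)

theorem expect_eq_of_agree (hφ : LocalAt i φ) {p : QueryAlg E (LevelData E)} {s : LevelData E}
    (h : All f p (Agree i s)) : expect f 0 p φ = φ s := by
  rw [← expect_const f p (φ s)]
  exact (h.mono fun s' hs' => (hφ s s' hs').symm).expect_eq

theorem Agree.addTo {s s' : LevelData E} (h : Agree i s s') (e : E) {j : ℕ} (hj : j ≤ i) :
    Agree i (addTo e j s) (addTo e j s') where
  D := h.D
  L := h.L
  Lbar k hk := update_congr_of_eq (by rw [h.Lbar j hj]) fun _ => h.Lbar k hk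
  G := h.G
  B := h.B
  T := h.T
  Gi := h.Gi
  Bi := h.Bi

/-- Agreeing states may have different numbers of levels above `i`, hence the two loop lengths; the
extra iterations lie above `i` and do not matter. -/
theorem expect_insertLoop_congr (hφ : LocalAt i φ) (e : E) (k k' j : ℕ) (h1 : 1 ≤ j)
    {s s' : LevelData E} (h : Agree i s s') (hk : k + j = s.T + 2) (hk' : k' + j = s'.T + 2)
    (hjT : j ≤ s.T + 1) :
    expect f 0 (insertLoop P τ e k j s) φ = expect f 0 (insertLoop P τ e k' j s') φ := by
  induction k generalizing k' j s s' with
  | zero => omega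
  | succ k ih =>
    have hT := h.T
    rcases lt_or_ge i j with hj | hj
    · rw [expect_eq_of_agree hφ (agree_insertLoop e (k + 1) j hj (by omega)),
        expect_eq_of_agree hφ (agree_insertLoop e k' j hj (by omega))]
      exact hφ _ _ h
    · obtain ⟨k', rfl⟩ : ∃ l, k' = l + 1 := ⟨k' - 1, by omega⟩
      rw [expect_insertLoop_succ, expect_insertLoop_succ, h.G (j - 1) (by omega), h.L j hj,
        h.Lbar j hj, hφ s s' h, expect_reconstruct_congr hφ h1 hj (h.addTo e hj).toSame]
      have hiff : j = s.T + 1 ↔ j = s'.T + 1 := by omega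
      simp only [hiff]
      split_ifs with hd hc
      · rfl
      · rfl
      · rw [not_or] at hc
        rw [ih k' (j + 1) (by omega) (h.addTo e hj) (by change _ = s.T + 2; omega)
          (by change _ = s'.T + 2; omega) (by change _ ≤ s.T + 1; omega)]

theorem expect_deleteLoop_congr (hφ : LocalAt i φ) (k k' j : ℕ) (h1 : 1 ≤ j)
    {s s' : LevelData E} (h : Agree i s s') (hk : k + j = s.T + 1) (hk' : k' + j = s'.T + 1) :
    expect f 0 (deleteLoop P τ k j s) φ = expect f 0 (deleteLoop P τ k' j s') φ := by
  have hT := h.T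
  induction k generalizing k' j with
  | zero =>
    rcases lt_or_ge s.T i with hT' | hT'
    · obtain rfl : k' = 0 := by omega
      exact hφ _ _ h
    · rw [expect_eq_of_agree hφ (agree_deleteLoop k' j (by omega) (by omega))]
      exact hφ _ _ h
  | succ k ih =>
    rcases lt_or_ge i j with hj | hj
    · rw [expect_eq_of_agree hφ (agree_deleteLoop (k + 1) j hj (by omega)),
        expect_eq_of_agree hφ (agree_deleteLoop k' j hj (by omega))]
      exact hφ _ _ h
    · obtain ⟨k', rfl⟩ : ∃ l, k' = l + 1 := ⟨k' - 1, by omega⟩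
      have hB : s.B j = s'.B j := by
        rcases hj.lt_or_eq with hj' | rfl
        · exact h.B j hj'
        · exact h.Bi (by omega)
      rw [expect_deleteLoop_succ, expect_deleteLoop_succ, hB, h.D,
        expect_reconstruct_congr hφ h1 hj h.toSame, ih k' (j + 1) (by omega) (by omega) (by omega)]

/-- If `p` leaves everything up to level `i` intact, including the drawn `G'`, both sides are the
same average of `φ` over that draw. -/
theorem resample_of_agree (hi : 1 ≤ i) (hφ : LocalAt i φ)
    {p : Finset E → QueryAlg E (LevelData E)} {s : LevelData E} (hT : i ≤ s.T)
    (h : ∀ G', All f (p G') (Agree i (setG i G' s))) :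
    expect f 0 (sampleNext P τ (s.L i) (s.G (i - 1))) (fun G' => expect f 0 (p G') φ)
      = expect f 0 (sampleNext P τ (s.L i) (s.G (i - 1)))
        (fun G' => expect f 0 (p G') (resample f P τ i φ)) := by
  simp only [fun G' => expect_eq_of_agree hφ (h G'),
    fun G' => expect_eq_of_agree (hφ.resample (f := f) (P := P) (τ := τ) hi) (h G'),
    fun G' => resample_setG (f := f) (P := P) (τ := τ) (φ := φ) hi G' hT]
  rw [expect_const, resample, if_pos hT]

/-- At level `j ≤ i` the loop reads `G (j - 1)`, never `G i`, so its branching is independent of the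
draw. It may rebuild from such a level, which redraws `G i`; or it stops or moves above `i`, and
then `G i` is kept. -/
theorem resample_insertLoop (hi : 1 ≤ i) (hφ : LocalAt i φ) (e : E) (k j : ℕ) (h1 : 1 ≤ j)
    {s : LevelData E} (hT : i ≤ s.T) :
    expect f 0 (sampleNext P τ (s.L i) (s.G (i - 1)))
        (fun G' => expect f 0 (insertLoop P τ e k j (setG i G' s)) φ)
      = expect f 0 (sampleNext P τ (s.L i) (s.G (i - 1)))
        (fun G' => expect f 0 (insertLoop P τ e k j (setG i G' s)) (resample f P τ i φ)) := by
  induction k generalizing j s with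
  | zero => exact resample_of_agree hi hφ hT fun G' => Agree.refl _ _
  | succ k ih =>
    rcases lt_or_ge i j with hj | hj
    · exact resample_of_agree hi hφ hT fun G' => agree_insertLoop e (k + 1) j hj hT
    · have e1 : ∀ G', (setG i G' s).G (j - 1) = s.G (j - 1) :=
        fun G' => Function.update_of_ne (by omega) _ _
      simp only [expect_insertLoop_succ, e1, mul_zero, zero_add]
      by_cases hd : dens f P e (s.G (j - 1)) < τ
      · simp only [if_pos hd]
        exact resample_of_agree (p := fun G' => pure (setG i G' s)) hi hφ hT fun G' => Agree.refl _ _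
      · simp only [if_neg hd]
        change expect f 0 _ (fun G' => if j = s.T + 1 ∨ (3 / 2 : ℝ) * (s.L j).card
            ≤ (insert e (s.Lbar j)).card then _ else _) = expect f 0 _ (fun G' =>
            if j = s.T + 1 ∨ (3 / 2 : ℝ) * (s.L j).card ≤ (insert e (s.Lbar j)).card then _ else _)
        split_ifs with hc
        · simp only [← expect_reconstruct_resample hφ h1 hj]
        · exact ih (j + 1) (by omega) (s := addTo e j s) hT

theorem resample_deleteLoop (hi : 1 ≤ i) (hφ : LocalAt i φ) (k j : ℕ) (h1 : 1 ≤ j)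
    {s : LevelData E} (hT : i ≤ s.T) :
    expect f 0 (sampleNext P τ (s.L i) (s.G (i - 1)))
        (fun G' => expect f 0 (deleteLoop P τ k j (setG i G' s)) φ)
      = expect f 0 (sampleNext P τ (s.L i) (s.G (i - 1)))
        (fun G' => expect f 0 (deleteLoop P τ k j (setG i G' s)) (resample f P τ i φ)) := by
  induction k generalizing j with
  | zero => exact resample_of_agree hi hφ hT fun G' => Agree.refl _ _
  | succ k ih =>
    rcases lt_or_ge i j with hj | hj
    · exact resample_of_agree hi hφ hT fun G' => agree_deleteLoop (k + 1) j hj hT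
    · simp only [expect_deleteLoop_succ]
      change expect f 0 _ (fun G' => if P.epsDel * ((s.B j).card : ℝ) ≤ ((s.D ∩ s.B j).card : ℝ)
        then _ else _) = expect f 0 _ (fun G' =>
        if P.epsDel * ((s.B j).card : ℝ) ≤ ((s.D ∩ s.B j).card : ℝ) then _ else _)
      split_ifs with hc
      · simp only [← expect_reconstruct_resample hφ h1 hj]
      · exact ih (j + 1) (by omega)

/-- Without a level `i` at the start, one can only arise from a rebuild at a level `≤ i`, which
draws its selection afresh; if none arises, redrawing does nothing. -/
theorem expect_insertLoop_low (hφ : LocalAt i φ) (e : E) (k j : ℕ) (h1 : 1 ≤ j)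
    {s : LevelData E} (hT : s.T < i) (hk : k + j = s.T + 2) :
    expect f 0 (insertLoop P τ e k j s) φ
      = expect f 0 (insertLoop P τ e k j s) (resample f P τ i φ) := by
  induction k generalizing j s with
  | zero => exact (resample_of_lt hT).symm
  | succ k ih =>
    rw [expect_insertLoop_succ, expect_insertLoop_succ, resample_of_lt hT,
      expect_reconstruct_resample hφ h1 (by omega),
      ih (j + 1) (by omega) (s := addTo e j s) hT (by change _ = s.T + 2; omega)]

theorem expect_deleteLoop_low (hφ : LocalAt i φ) (k j : ℕ) (h1 : 1 ≤ j)
    {s : LevelData E} (hT : s.T < i) (hk : k + j = s.T + 1) :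
    expect f 0 (deleteLoop P τ k j s) φ
      = expect f 0 (deleteLoop P τ k j s) (resample f P τ i φ) := by
  induction k generalizing j with
  | zero => exact (resample_of_lt hT).symm
  | succ k ih =>
    rw [expect_deleteLoop_succ, expect_deleteLoop_succ,
      expect_reconstruct_resample hφ h1 (by omega), ih (j + 1) (by omega) (by omega)]

theorem Agree.insertStart {s s' : LevelData E} (h : Agree i s s') (e : E) :
    Agree i (insertStart e s) (insertStart e s') where
  D := congrArg (fun D => Finset.erase D e) h.D
  L := h.L
  Lbar k hk := update_congr_of_eq (by rw [h.Lbar 0 (by omega)]) fun _ => h.Lbar k hk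
  G := h.G
  B := h.B
  T := h.T
  Gi := h.Gi
  Bi := h.Bi

theorem Agree.deleteStart {s s' : LevelData E} (h : Agree i s s') (e : E) :
    Agree i (deleteStart e s) (deleteStart e s') where
  D := congrArg (fun D => insert e D) h.D
  L := h.L
  Lbar := h.Lbar
  G := h.G
  B := h.B
  T := h.T
  Gi := h.Gi
  Bi := h.Bi

/-- The update operators preserve dependence on the levels up to `i`. -/
theorem localAt_applyRun (hφ : LocalAt i φ) (u : Update E) :
    LocalAt i fun s => expect f 0 (u.applyRun P τ s) φ := by
  intro s s' h
  cases u with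
  | ins e =>
    exact expect_insertLoop_congr hφ e _ _ 1 le_rfl (h.insertStart e) rfl rfl
      (Nat.le_add_left 1 _)
  | del e => exact expect_deleteLoop_congr hφ _ _ 1 le_rfl (h.deleteStart e) rfl rfl

/-- The update operators do not see whether the selection at level `i` is drawn anew. -/
theorem resample_applyRun (hi : 1 ≤ i) (hφ : LocalAt i φ) (u : Update E) (s : LevelData E) :
    resample f P τ i (fun s => expect f 0 (u.applyRun P τ s) φ) s
      = resample f P τ i (fun s => expect f 0 (u.applyRun P τ s) (resample f P τ i φ)) s := by
  rcases lt_or_ge s.T i with hT | hT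
  · rw [resample_of_lt hT, resample_of_lt hT]
    cases u with
    | ins e => exact expect_insertLoop_low hφ e _ 1 le_rfl hT rfl
    | del e => exact expect_deleteLoop_low hφ _ 1 le_rfl hT rfl
  · rw [resample, resample, if_pos hT, if_pos hT]
    cases u with
    | ins e => exact resample_insertLoop hi hφ e (s.T + 1) 1 le_rfl (s := insertStart e s) hT
    | del e => exact resample_deleteLoop hi hφ s.T 1 le_rfl (s := deleteStart e s) hT

end Resample

end SubmodularCover

/-! ### Expected number of levels of a run -/

namespace SubmodularCover

open QueryAlg

section LevelCount

variable {E : Type} [Fintype E] [DecidableEq E] {f : Finset E → ℝ} {P : Params E} {τ : ℝ}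

/-- Runs one data structure on a sequence of updates. -/
noncomputable def runSeq (P : Params E) (τ : ℝ) :
    List (Update E) → LevelData E → QueryAlg E (LevelData E)
  | [], s => pure s
  | u :: us, s => u.applyRun P τ s >>= runSeq P τ us

/-- The initial state is resampled on both sides so that the induction closes, and locality is
carried along because `resample_applyRun` requires it of the expectation over the remaining updates.
-/
theorem resample_runSeq {i : ℕ} (hi : 1 ≤ i) (us : List (Update E)) {φ : LevelData E → ℝ≥0∞}
    (hφ : LocalAt i φ) :
    LocalAt i (fun s => expect f 0 (runSeq P τ us s) φ) ∧
      ∀ s, resample f P τ i (fun s => expect f 0 (runSeq P τ us s) φ) s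
        = resample f P τ i (fun s => expect f 0 (runSeq P τ us s) (resample f P τ i φ)) s := by
  induction us with
  | nil =>
    refine ⟨hφ, fun s => ?_⟩
    change resample f P τ i φ s = resample f P τ i (resample f P τ i φ) s
    rcases lt_or_ge s.T i with hT | hT
    · rw [resample_of_lt hT, resample_of_lt hT, resample_of_lt hT]
    · conv_rhs => rw [resample, if_pos hT]
      simp only [resample_setG hi _ hT, expect_const]
  | cons u us ih =>
    simp only [runSeq, expect_bind]
    have h2 : LocalAt i (fun s => expect f 0 (runSeq P τ us s) (resample f P τ i φ)) ∧
        ∀ s, resample f P τ i (fun s => expect f 0 (runSeq P τ us s) φ) s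
          = resample f P τ i (fun s => expect f 0 (runSeq P τ us s) (resample f P τ i φ)) s :=
      ⟨by
        clear ih
        have hr := hφ.resample (f := f) (P := P) (τ := τ) hi
        generalize resample f P τ i φ = ψ at hr
        induction us with
        | nil => exact hr
        | cons u us ih =>
          simp only [runSeq, expect_bind]
          exact localAt_applyRun ih u, ih.2⟩
    refine ⟨localAt_applyRun ih.1 u, fun s => ?_⟩
    -- A redraw is inserted after the first update on both sides; beneath it the two continuations
    -- coincide by induction.
    rw [resample_applyRun hi ih.1 u s, resample_applyRun hi h2.1 u s, funext h2.2]

/-- From a start without level `i`, the selection there can at any later time be regarded as freshly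
drawn given everything below it. -/
theorem expect_runSeq_resample {i : ℕ} (hi : 1 ≤ i) (us : List (Update E))
    {φ : LevelData E → ℝ≥0∞} (hφ : LocalAt i φ) {s : LevelData E} (hT : s.T < i) :
    expect f 0 (runSeq P τ us s) φ = expect f 0 (runSeq P τ us s) (resample f P τ i φ) := by
  have := (resample_runSeq (f := f) (P := P) (τ := τ) hi us hφ).2 s
  rwa [resample_of_lt hT, resample_of_lt hT] at this

theorem inv_runSeq (h : Admissible f P) (hτ : 0 < τ) (us : List (Update E))
    (hus : ∀ u ∈ us, f {u.elem} / P.w u.elem ≤ τ * eta P) {s : LevelData E} (hs : Inv f P τ s) :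
    All f (runSeq P τ us s) (Inv f P τ) := by
  induction us generalizing s with
  | nil => exact hs
  | cons u us ih =>
    simp only [runSeq, all_bind]
    exact (inv_applyRun h hτ u (hus u (by simp)) hs).mono
      fun s' hs' => ih (fun v hv => hus v (by simp [hv])) hs'

/-- The potential of level `i`. -/
noncomputable def levelPotential (f : Finset E → ℝ) (P : Params E) (τ : ℝ) (i : ℕ)
    (s : LevelData E) : ℝ≥0∞ :=
  if i ≤ s.T then potential f P τ (s.Lbar i) (s.G (i - 1)) else 0

/-- The potential of the elements of level `i` that are still dense after the selection. -/
noncomputable def residualPotential (f : Finset E → ℝ) (P : Params E) (τ : ℝ) (i : ℕ)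
    (s : LevelData E) : ℝ≥0∞ :=
  if i ≤ s.T then
    potential f P τ ((s.Lbar i).filter fun e => τ ≤ dens f P e (s.G i)) (s.G i) else 0

theorem localAt_residualPotential (i : ℕ) : LocalAt i (residualPotential f P τ i) := by
  intro s s' h
  have hT := h.T
  unfold residualPotential
  by_cases hi : i ≤ s.T
  · rw [if_pos hi, if_pos (show i ≤ s'.T by omega), h.Gi hi, h.Lbar i le_rfl]
  · rw [if_neg hi, if_neg (show ¬ i ≤ s'.T by omega)]

theorem potential_mono {S S' G : Finset E} (hS : S ⊆ S') :
    potential f P τ S G ≤ potential f P τ S' G :=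
  Finset.sum_le_sum_of_subset hS

/-- Level `i + 1` consists of elements of level `i` still dense after the selection. The residual
potential, unlike the left side, depends only on levels up to `i`, so it may be resampled. -/
theorem levelPotential_succ_le {i : ℕ} (hi : 1 ≤ i) {s : LevelData E} (hs : Inv f P τ s) :
    levelPotential f P τ (i + 1) s ≤ residualPotential f P τ i s := by
  unfold levelPotential residualPotential
  split_ifs with h1 h2
  · have ho := hs.level (i + 1) (by omega) h1
    rw [Nat.add_sub_cancel]
    refine Nat.cast_le.2 (potential_mono fun e he => ?_)
    exact Finset.mem_filter.2 ⟨ho.anti (by omega) he, (ho.good e he).1⟩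
  · omega
  · exact zero_le
  · exact le_rfl

theorem resample_residualPotential_add_le (h : Admissible f P) (hτ : 0 < τ) {i : ℕ} (hi : 1 ≤ i)
    {s : LevelData E} (hs : Inv f P τ s) :
    ENNReal.ofReal (invRate P) * resample f P τ i (residualPotential f P τ i) s
        + levelPotential f P τ i s
      ≤ ENNReal.ofReal (invRate P) * levelPotential f P τ i s := by
  by_cases hT : i ≤ s.T
  · have ho := hs.level i hi hT
    have hr : ∀ G', residualPotential f P τ i (setG i G' s)
        = potential f P τ ((s.Lbar i).filter fun e => τ ≤ dens f P e G') G' := by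
      intro G'
      rw [residualPotential, if_pos (show i ≤ (setG i G' s).T from hT)]
      have : (setG i G' s).G i = G' := Function.update_self _ _ _
      rw [this]; rfl
    rw [resample, if_pos hT, levelPotential, if_pos hT]
    simp only [hr]
    exact expect_potential_add_le h hτ ho.sub ho.good ho.card.le
  · rw [resample_of_lt (by omega), residualPotential, levelPotential, if_neg hT, if_neg hT]
    simp

/-- Pass from level `i + 1` to the residual potential at `i`, redraw `G i`, and apply the one-pass
decrease in every state. -/
theorem expect_levelPotential_succ (h : Admissible f P) (hτ : 0 < τ) (us : List (Update E))
    (hus : ∀ u ∈ us, f {u.elem} / P.w u.elem ≤ τ * eta P) {i : ℕ} (hi : 1 ≤ i) :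
    ENNReal.ofReal (invRate P)
        * expect f 0 (runSeq P τ us (LevelData.empty E)) (levelPotential f P τ (i + 1))
      + expect f 0 (runSeq P τ us (LevelData.empty E)) (levelPotential f P τ i)
      ≤ ENNReal.ofReal (invRate P)
        * expect f 0 (runSeq P τ us (LevelData.empty E)) (levelPotential f P τ i) := by
  have hinv := inv_runSeq h hτ us hus (s := LevelData.empty E) inv_empty
  have h1 := (hinv.mono fun s hs => levelPotential_succ_le hi hs).expect_le (c := 0)
  rw [expect_runSeq_resample hi us (localAt_residualPotential i)
    (show (LevelData.empty E).T < i from hi)] at h1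
  have h2 := (hinv.mono fun s hs => resample_residualPotential_add_le h hτ hi hs).expect_le (c := 0)
  rw [expect_add, expect_mul_left, expect_mul_left] at h2
  refine le_trans ?_ h2
  gcongr

/-- Cut at `M = ⌈D log A⌉`: earlier terms count at most one each, `y M ≤ 1` by geometric decay, and
the rest telescopes to at most `D * y M`. -/
theorem geometric_partial_sum {y : ℕ → ℝ} {D A : ℝ} (hD : 1 ≤ D) (hA : 1 ≤ A)
    (hy : ∀ k, 0 ≤ y k) (h0 : y 0 ≤ A) (hstep : ∀ k, D * y (k + 1) + y k ≤ D * y k) (N : ℕ) :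
    ∑ k ∈ Finset.range N, min 1 (y k) ≤ D * Real.log A + 1 + D := by
  have hD0 : 0 < D := by linarith
  have hlog : 0 ≤ Real.log A := Real.log_nonneg hA
  set M := ⌈D * Real.log A⌉₊ with hM
  have hM1 : (M : ℝ) < D * Real.log A + 1 := Nat.ceil_lt_add_one (by positivity)
  have hgeo : ∀ k, y k ≤ Real.exp (-(k / D)) * A := by
    intro k
    induction k with
    | zero => simpa using h0
    | succ k ih =>
      have h1 : y (k + 1) ≤ (1 - 1 / D) * y k := by
        have h3 : D * y (k + 1) ≤ D * ((1 - 1 / D) * y k) := by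
          have : D * ((1 - 1 / D) * y k) = D * y k - y k := by field_simp
          linarith [hstep k]
        exact le_of_mul_le_mul_left h3 hD0
      have h2 : 1 - 1 / D ≤ Real.exp (-(1 / D)) := by linarith [Real.add_one_le_exp (-(1 / D))]
      calc y (k + 1) ≤ (1 - 1 / D) * y k := h1
        _ ≤ Real.exp (-(1 / D)) * (Real.exp (-(k / D)) * A) := by
          have := hy k
          gcongr
        _ = _ := by rw [← mul_assoc, ← Real.exp_add]; congr 2; push_cast; ring
  have hyM : y M ≤ 1 := by
    refine (hgeo M).trans ?_
    have h1 : Real.log A ≤ M / D := by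
      rw [le_div_iff₀ hD0, mul_comm]; exact Nat.le_ceil _
    calc Real.exp (-(M / D)) * A ≤ Real.exp (-Real.log A) * A := by gcongr
      _ = 1 := by rw [Real.exp_neg, Real.exp_log (by linarith), inv_mul_cancel₀ (by linarith)]
  have htail : ∀ n, ∑ k ∈ Finset.range n, y (M + k) ≤ D * y M - D * y (M + n) := by
    intro n
    induction n with
    | zero => simp
    | succ n ih =>
      rw [Finset.sum_range_succ]
      have := hstep (M + n)
      rw [← add_assoc]
      linarith
  calc ∑ k ∈ Finset.range N, min 1 (y k) ≤ ∑ k ∈ Finset.range (M + N), min 1 (y k) :=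
        Finset.sum_le_sum_of_subset_of_nonneg (Finset.range_mono (by omega))
          fun k _ _ => le_min zero_le_one (hy k)
    _ = ∑ k ∈ Finset.range M, min 1 (y k) + ∑ k ∈ Finset.range N, min 1 (y (M + k)) :=
        Finset.sum_range_add _ _ _
    _ ≤ ∑ k ∈ Finset.range M, (1 : ℝ) + ∑ k ∈ Finset.range N, y (M + k) := by
        gcongr
        · exact min_le_left _ _
        · exact min_le_right _ _
    _ ≤ M + (D * y M - D * y (M + N)) := by
        gcongr
        · simp
        · exact htail N
    _ ≤ _ := by nlinarith [mul_nonneg hD0.le (hy (M + N))]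

/-- A bound for the expected number of levels. -/
noncomputable def levelBound (P : Params E) : ℝ :=
  invRate P * Real.log (Fintype.card E * kappa P) + 1 + invRate P

theorem one_le_invRate (h : Admissible f P) : 1 ≤ invRate P := by
  have h0 := h.eps_pos
  have h1 := h.eps_lt
  have hk : (1 : ℝ) ≤ kappa P := by exact_mod_cast kappa_pos P
  rw [invRate, one_le_div h0]
  have : (1 : ℝ) ≤ (kappa P : ℝ) ^ 3 := one_le_pow₀ hk
  linarith

/-- Write `T` as a sum of indicators of `k < T`. Level `k + 1` is then nonempty and has potential at
least `1`, so Markov's inequality bounds each probability by the expected potential, which starts at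
most at `n κ`. -/
theorem expect_T_le (h : Admissible f P) [Nonempty E] (hτ : 0 < τ) (us : List (Update E))
    (hus : ∀ u ∈ us, f {u.elem} / P.w u.elem ≤ τ * eta P) :
    expect f 0 (runSeq P τ us (LevelData.empty E)) (fun s => (s.T : ℝ≥0∞))
      ≤ ENNReal.ofReal (levelBound P) := by
  set p := runSeq P τ us (LevelData.empty E) with hp
  have hinv : All f p (Inv f P τ) := inv_runSeq h hτ us hus inv_empty
  set x : ℕ → ℝ≥0∞ := fun k => expect f 0 p (levelPotential f P τ (k + 1)) with hx
  have hn : (1 : ℝ) ≤ Fintype.card E := by exact_mod_cast Fintype.card_pos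
  have hk : (1 : ℝ) ≤ kappa P := by exact_mod_cast kappa_pos P
  have hD := one_le_invRate h
  have hx0 : x 0 ≤ (Fintype.card E * kappa P : ℕ) := by
    rw [hx, ← expect_const f p ((Fintype.card E * kappa P : ℕ) : ℝ≥0∞)]
    refine (hinv.mono fun s hs => ?_).expect_le
    rw [levelPotential]
    split_ifs with h1
    · refine Nat.cast_le.2 ((potential_le h hτ (hs.level _ (by omega) h1).good).trans ?_)
      rw [mul_comm]
      exact Nat.mul_le_mul_right _ (Finset.card_le_univ _)
    · exact zero_le
  have hstep : ∀ k, ENNReal.ofReal (invRate P) * x (k + 1) + x k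
      ≤ ENNReal.ofReal (invRate P) * x k := fun k =>
    expect_levelPotential_succ h hτ us hus (Nat.le_add_left 1 k)
  have hDtop : ENNReal.ofReal (invRate P) ≠ 0 := by
    rw [Ne, ENNReal.ofReal_eq_zero]; linarith
  have hxtop : ∀ k, x k ≠ ⊤ := by
    intro k
    induction k with
    | zero => exact ne_top_of_le_ne_top (ENNReal.natCast_ne_top _) hx0
    | succ k ih =>
      have h2 : ENNReal.ofReal (invRate P) * x (k + 1) ≠ ⊤ :=
        ne_top_of_le_ne_top (ENNReal.mul_ne_top (by simp) ih) (le_self_add.trans (hstep k))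
      intro h3
      rw [h3, ENNReal.mul_top hDtop] at h2
      exact h2 rfl
  have hT : ∀ s : LevelData E, (s.T : ℝ≥0∞) = ∑' k, if k < s.T then 1 else 0 := by
    intro s
    rw [tsum_eq_sum (s := Finset.range s.T) (by intro k hk; simpa using hk),
      Finset.sum_congr rfl fun k hk => if_pos (Finset.mem_range.1 hk)]
    simp
  simp only [hT]
  rw [expect_tsum]
  refine ENNReal.tsum_le_of_sum_range_le fun N => ?_
  have hq : ∀ k, expect f 0 p (fun s => if k < s.T then 1 else 0)
      ≤ ENNReal.ofReal (min 1 (x k).toReal) := by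
    intro k
    rw [ENNReal.ofReal_min, ENNReal.ofReal_one, ENNReal.ofReal_toReal (hxtop k)]
    refine le_min ?_ ?_
    · refine (expect_mono fun s => ?_).trans_eq (expect_const f p 1)
      split_ifs <;> simp
    · refine (hinv.mono fun s hs => ?_).expect_le
      rw [levelPotential]
      split_ifs with h1 h2
      · have ho := hs.level (k + 1) (by omega) h2
        have h3 := (Finset.card_le_card ho.sub).trans (card_le_potential (f := f) (P := P) (τ := τ)
          (s.Lbar (k + 1)) (s.G (k + 1 - 1)))
        have h4 := ho.nonempty.card_pos
        exact_mod_cast (by omega : 1 ≤ potential f P τ (s.Lbar (k + 1)) (s.G (k + 1 - 1)))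
      · omega
      · exact zero_le
      · exact le_rfl
  calc _ ≤ ∑ k ∈ Finset.range N, ENNReal.ofReal (min 1 (x k).toReal) :=
        Finset.sum_le_sum fun k _ => hq k
    _ = ENNReal.ofReal (∑ k ∈ Finset.range N, min 1 (x k).toReal) :=
        (ENNReal.ofReal_sum_of_nonneg fun k _ => le_min zero_le_one ENNReal.toReal_nonneg).symm
    _ ≤ _ := by
        apply ENNReal.ofReal_le_ofReal
        refine geometric_partial_sum hD (by nlinarith) (fun k => ENNReal.toReal_nonneg) ?_
          (fun k => ?_) N
        · have := ENNReal.toReal_mono (ENNReal.natCast_ne_top _) hx0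
          rw [ENNReal.toReal_natCast] at this
          exact_mod_cast this
        · have := ENNReal.toReal_mono (ENNReal.mul_ne_top (by simp) (hxtop k)) (hstep k)
          rw [ENNReal.toReal_add (ENNReal.mul_ne_top (by simp) (hxtop _)) (hxtop k),
            ENNReal.toReal_mul, ENNReal.toReal_mul, ENNReal.toReal_ofReal (by linarith)] at this
          exact this

end LevelCount

end SubmodularCover

/-! ### Parallel runs, retrieval and the whole update sequence -/

namespace SubmodularCover

open QueryAlg

section Global

variable {E : Type} [Fintype E] [DecidableEq E] {f : Finset E → ℝ} {P : Params E}

/-- The threshold of run `i`. -/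
noncomputable def threshold (P : Params E) (i : ℤ) : ℝ := (1 + P.eps) ^ i

theorem threshold_pos (h : Admissible f P) (i : ℤ) : 0 < threshold P i := by
  have := h.eps_pos
  unfold threshold; positivity

theorem eta_pos (h : Admissible f P) [Nonempty E] : 0 < eta P := by
  have hr : 1 ≤ P.rho := by
    obtain ⟨e⟩ := ‹Nonempty E›
    exact (h.weight e).1.trans (h.weight e).2
  linarith [rho_le_eta h]

/-- The runs that are concerned by an update. -/
noncomputable def runsOf (f : Finset E → ℝ) (P : Params E) (u : Update E) : Finset ℤ :=
  relevantRuns P (f {u.elem} / P.w u.elem)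

theorem scaled_eq_div_eta (P : Params E) (d : ℝ) :
    d * P.eps / ((Fintype.card E : ℝ) * P.rho * (1 + P.eps)) = d / eta P := by
  have : eta P = (Fintype.card E : ℝ) * P.rho * (1 + P.eps) / P.eps := by unfold eta; ring
  rw [this, div_div_eq_mul_div]

/-- The lower end of the range of relevant runs is `log (d / η)`; this is the upper density bound
required by `Good`. -/
theorem density_le_of_mem_runsOf (h : Admissible f P) {u : Update E} {i : ℤ}
    (hi : i ∈ runsOf f P u) : f {u.elem} / P.w u.elem ≤ threshold P i * eta P := by
  have : Nonempty E := ⟨u.elem⟩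
  have h0 := h.eps_pos
  have hη := eta_pos h
  unfold runsOf relevantRuns at hi
  rw [scaled_eq_div_eta P] at hi
  split_ifs at hi with hd
  · rw [Finset.mem_Icc, Int.ceil_le] at hi
    have h1 := hi.1
    rw [Real.logb_le_iff_le_rpow (by linarith) (by positivity), Real.rpow_intCast,
      div_le_iff₀ hη] at h1
    exact h1
  · simp at hi

theorem card_runsOf_le (h : Admissible f P) (u : Update E) : (runsOf f P u).card ≤ kappa P := by
  have : Nonempty E := ⟨u.elem⟩
  have h0 := h.eps_pos
  have hη := eta_pos h
  unfold runsOf relevantRuns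
  rw [scaled_eq_div_eta P]
  split_ifs with hd
  · rw [Int.card_Icc, Real.logb_div hd.ne' hη.ne']
    set a := Real.logb (1 + P.eps) (f {u.elem} / P.w u.elem)
    unfold kappa
    set x := Real.logb (1 + P.eps) (eta P)
    have h1 : ⌊a⌋ - ⌈a - x⌉ ≤ ⌊x⌋ := by
      rw [Int.le_floor]; push_cast
      linarith [Int.floor_le a, Int.le_ceil (a - x)]
    have h2 := Int.floor_toNat x
    omega
  · simp

/-- The update of a single run within the global state. -/
noncomputable def updateRun (P : Params E) (u : Update E) (s : State E) (i : ℤ) :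
    QueryAlg E (State E) := do
  let r ← u.applyRun P (threshold P i) (s.inst i)
  return { s with inst := Function.update s.inst i r }

theorem expect_globalUpdate (u : Update E) (s : State E) (c : ℝ≥0∞) (g : State E → ℝ≥0∞) :
    expect f c (globalUpdate P u s) g = c + expect f c ((runsOf f P u).toList.foldlM (updateRun P u)
      { s with V := u.applySet s.V }) g := rfl

theorem all_globalUpdate (u : Update E) (s : State E) (Q : State E → Prop) :
    All f (globalUpdate P u s) Q ↔ All f ((runsOf f P u).toList.foldlM (updateRun P u)
      { s with V := u.applySet s.V }) Q := Iff.rfl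

/-- Runs do not interact: only the unique step for `j`, if present, affects run `j`. -/
theorem expect_foldlM_marginal (u : Update E) (l : List ℤ) (hl : l.Nodup) (s : State E) (j : ℤ)
    (g : LevelData E → ℝ≥0∞) :
    expect f 0 (l.foldlM (updateRun P u) s) (fun s' => g (s'.inst j))
      = if j ∈ l then expect f 0 (u.applyRun P (threshold P j) (s.inst j)) g
        else g (s.inst j) := by
  induction l generalizing s with
  | nil => rfl
  | cons i l ih =>
    rw [List.nodup_cons] at hl
    rw [List.foldlM_cons, expect_bind]
    simp only [ih hl.2, updateRun, expect_bind, expect_pure]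
    by_cases hij : j = i
    · subst hij
      simp [hl.1]
    · simp only [Function.update_of_ne hij, List.mem_cons, hij, false_or]
      exact expect_const f _ _

theorem expect_foldlM_credit_le (h : Admissible f P) (u : Update E) (J : Finset ℤ) (l : List ℤ)
    (hl : l.Nodup) (hJ : ∀ i ∈ l, i ∈ J) (hu : ∀ i ∈ l, i ∈ runsOf f P u) (s : State E)
    (hs : ∀ i ∈ l, Inv f P (threshold P i) (s.inst i)) :
    expect f 1 (l.foldlM (updateRun P u) s) (fun s' => ∑ j ∈ J, runCredit P (s'.inst j))
      ≤ ∑ j ∈ J, runCredit P (s.inst j)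
        + (l.map fun i => (((s.inst i).T : ℝ≥0∞) + 1) * stepCost P).sum := by
  induction l generalizing s with
  | nil => simp
  | cons i l ih =>
    rw [List.nodup_cons] at hl
    rw [List.foldlM_cons, expect_bind]
    simp only [updateRun, expect_bind, expect_pure]
    set R := (l.map fun i => (((s.inst i).T : ℝ≥0∞) + 1) * stepCost P).sum with hR
    have hne : ∀ k ∈ l, k ≠ i := fun k hk hki => hl.1 (hki ▸ hk)
    have step : ∀ r : LevelData E,
        expect f 1 (l.foldlM (updateRun P u) { s with inst := Function.update s.inst i r })
          (fun s' => ∑ j ∈ J, runCredit P (s'.inst j))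
        ≤ runCredit P r + (∑ j ∈ J.erase i, runCredit P (s.inst j) + R) := by
      intro r
      refine (ih hl.2 (fun k hk => hJ k (by simp [hk])) (fun k hk => hu k (by simp [hk]))
        { s with inst := Function.update s.inst i r } fun k hk => ?_).trans ?_
      · simp only [Function.update_of_ne (hne k hk)]
        exact hs k (by simp [hk])
      · rw [← add_assoc]
        refine add_le_add ?_ ?_
        · rw [← Finset.add_sum_erase _ _ (hJ i (by simp))]
          simp only [Function.update_self]
          refine add_le_add le_rfl (Finset.sum_le_sum fun k hk => ?_)
          rw [Function.update_of_ne (Finset.ne_of_mem_erase hk)]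
        · rw [hR, List.map_congr_left]
          intro k hk
          simp only [Function.update_of_ne (hne k hk)]
    have hamort := expect_applyRun_le h (threshold_pos h i) u
      (density_le_of_mem_runsOf h (hu i (by simp))) (hs i (by simp))
    calc _ ≤ expect f 1 (u.applyRun P (threshold P i) (s.inst i)) (fun r => runCredit P r +
            (∑ j ∈ J.erase i, runCredit P (s.inst j) + R)) := expect_mono step
      _ ≤ runCredit P (s.inst i) + ((s.inst i).T + 1) * stepCost P
            + (∑ j ∈ J.erase i, runCredit P (s.inst j) + R) := by
          rw [expect_add_const]; gcongr
      _ = runCredit P (s.inst i) + ∑ j ∈ J.erase i, runCredit P (s.inst j)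
            + (((s.inst i).T + 1) * stepCost P + R) := by ring
      _ = _ := by
          rw [Finset.add_sum_erase J (fun j => runCredit P (s.inst j)) (hJ i (by simp)), List.map_cons, List.sum_cons]

/-- The invariants of all runs. -/
def GlobalInv (f : Finset E → ℝ) (P : Params E) (s : State E) : Prop :=
  ∀ i, Inv f P (threshold P i) (s.inst i)

theorem globalInv_globalUpdate (h : Admissible f P) (u : Update E) {s : State E}
    (hs : GlobalInv f P s) : All f (globalUpdate P u s) (GlobalInv f P) := by
  rw [all_globalUpdate]
  have hl : ∀ i ∈ (runsOf f P u).toList, i ∈ runsOf f P u := fun i hi => Finset.mem_toList.1 hi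
  generalize (runsOf f P u).toList = l at hl
  have hs' : GlobalInv f P { s with V := u.applySet s.V } := hs
  generalize ({ s with V := u.applySet s.V } : State E) = s₁ at hs'
  induction l generalizing s₁ with
  | nil => exact hs'
  | cons i l ih =>
    rw [List.foldlM_cons, all_bind]
    simp only [updateRun, all_bind, all_pure]
    refine (inv_applyRun h (threshold_pos h i) u (density_le_of_mem_runsOf h (hl i (by simp)))
      (hs' i)).mono fun r hr => ih (fun k hk => hl k (by simp [hk])) _ fun j => ?_
    by_cases hj : j = i
    · subst hj; simpa using hr
    · simpa only [Function.update_of_ne hj] using hs' j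

/-- One query for `f(V)` and one for each candidate run; rounding both ends down allows one more run
than `κ`. -/
theorem expect_retrieve_const_le (h : Admissible f P) (s : State E) (a : ℝ≥0∞) :
    expect f 1 (retrieve P s) (fun _ => a) ≤ kappa P + 2 + a := by
  unfold retrieve
  rw [expect_bind, expect_ask]
  split_ifs with hc
  · rw [expect_bind]
    have hcomp := Computes.foldlM (f := f) (n := 1)
      (F := fun (best : Option (Finset E)) (i : ℤ) => (do
        let g ← ask ((s.inst i).G (s.inst i).T)
        return if (1 - P.eps) * f s.V ≤ g ∧ ∀ S ∈ best,
          cost P ((s.inst i).G (s.inst i).T \ (s.inst i).D) < cost P S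
          then some ((s.inst i).G (s.inst i).T \ (s.inst i).D) else best))
      (G := fun best i => if (1 - P.eps) * f s.V ≤ f ((s.inst i).G (s.inst i).T) ∧ ∀ S ∈ best,
          cost P ((s.inst i).G (s.inst i).T \ (s.inst i).D) < cost P S
          then some ((s.inst i).G (s.inst i).T \ (s.inst i).D) else best)
      (fun b i => (Computes.ask _).bind (k := fun g => pure (if (1 - P.eps) * f s.V ≤ g ∧ ∀ S ∈ b,
          cost P ((s.inst i).G (s.inst i).T \ (s.inst i).D) < cost P S
          then some ((s.inst i).G (s.inst i).T \ (s.inst i).D) else b)) (.pure _))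
    have h0 := h.eps_pos
    obtain ⟨e, he⟩ := hc.1
    have : Nonempty E := ⟨e⟩
    have hr : 1 ≤ P.rho := (h.weight e).1.trans (h.weight e).2
    have hV : (1 : ℝ) ≤ s.V.card := by exact_mod_cast hc.1.card_pos
    have hVE : (s.V.card : ℝ) ≤ Fintype.card E := by exact_mod_cast Finset.card_le_univ _
    have hle : (s.V.card : ℝ) * P.rho ≤ eta P := by
      have : 1 ≤ (1 + P.eps) / P.eps := by rw [one_le_div h0]; linarith
      unfold eta
      rw [mul_assoc]
      have h2 : (s.V.card : ℝ) * P.rho ≤ Fintype.card E * P.rho := by gcongr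
      have h3 : 0 ≤ (s.V.card : ℝ) * P.rho := by positivity
      nlinarith
    have hcard : (Finset.Icc ⌊Real.logb (1 + P.eps) (f s.V * P.eps / ((s.V.card : ℝ) * P.rho))⌋
        ⌊Real.logb (1 + P.eps) (f s.V * P.eps)⌋).card ≤ kappa P + 1 := by
      rw [Int.card_Icc, Real.logb_div (by have := hc.2; positivity) (by positivity)]
      set a := Real.logb (1 + P.eps) (f s.V * P.eps)
      unfold kappa
      have hb : Real.logb (1 + P.eps) ((s.V.card : ℝ) * P.rho) ≤ Real.logb (1 + P.eps) (eta P) :=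
        Real.logb_le_logb_of_le (by linarith) (by positivity) hle
      set x := Real.logb (1 + P.eps) (eta P)
      set b := Real.logb (1 + P.eps) ((s.V.card : ℝ) * P.rho)
      have h1 : ⌊a⌋ - ⌊a - b⌋ - 1 ≤ ⌊x⌋ := by
        rw [Int.le_floor]; push_cast
        linarith [Int.floor_le a, Int.lt_floor_add_one (a - b)]
      have h2 := Int.floor_toNat x
      omega
    refine (add_le_add le_rfl (le_of_eq ((hcomp _ none).1 1 _))).trans ?_
    rw [expect_pure, Finset.length_toList, one_mul, mul_one]
    have : ((Finset.Icc ⌊Real.logb (1 + P.eps) (f s.V * P.eps / ((s.V.card : ℝ) * P.rho))⌋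
        ⌊Real.logb (1 + P.eps) (f s.V * P.eps)⌋).card : ℝ≥0∞) ≤ kappa P + 1 := by
      exact_mod_cast hcard
    calc _ ≤ 1 + ((kappa P : ℝ≥0∞) + 1 + a) := by gcongr
      _ = _ := by ring
  · rw [expect_pure]
    gcongr
    exact one_le_two.trans le_add_self

/-- The amortized cost of an update in the state `s`. -/
noncomputable def updateCost (f : Finset E → ℝ) (P : Params E) (u : Update E) (s : State E) :
    ℝ≥0∞ :=
  kappa P + 3 + ∑ i ∈ runsOf f P u, (((s.inst i).T : ℝ≥0∞) + 1) * stepCost P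

/-- The sum of the expected amortized costs of a sequence of updates. -/
noncomputable def runningCost (f : Finset E → ℝ) (P : Params E) :
    List (Update E) → State E → ℝ≥0∞
  | [], _ => 0
  | u :: us, s => updateCost f P u s + expect f 0 (globalUpdate P u s) (runningCost f P us)

/-- The finite set `J` contains every run ever touched, which keeps the global credit a finite sum.
In `updateCost`, the `κ + 3` covers retrieval and the query of `d(e)`. -/
theorem cost_dynamicCover_le (h : Admissible f P) (J : Finset ℤ) (us : List (Update E))
    (hJ : ∀ u ∈ us, runsOf f P u ⊆ J) {s : State E} (hs : GlobalInv f P s) :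
    expect f 1 (dynamicCover P us s) 0
      ≤ ∑ j ∈ J, runCredit P (s.inst j) + runningCost f P us s := by
  induction us generalizing s with
  | nil => exact zero_le
  | cons u us ih =>
    unfold dynamicCover runningCost
    simp only [expect_bind, expect_pure]
    have step : All f (globalUpdate P u s) fun s₁ =>
        expect f 1 (retrieve P s₁) (fun sol => expect f 1 (dynamicCover P us s₁)
          fun rest => (0 : List (Finset E) → ℝ≥0∞) (sol :: rest))
        ≤ ∑ j ∈ J, runCredit P (s₁.inst j) + runningCost f P us s₁ + (kappa P + 2) := by
      refine (globalInv_globalUpdate h u hs).mono fun s₁ hs₁ => ?_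
      refine (expect_retrieve_const_le h s₁ (expect f 1 (dynamicCover P us s₁) 0)).trans ?_
      rw [add_comm]
      gcongr
      exact ih (fun v hv => hJ v (by simp [hv])) hs₁
    refine step.expect_le.trans ?_
    rw [expect_add_const, expect_add, expect_globalUpdate]
    have hmem : ∀ i ∈ (runsOf f P u).toList, i ∈ runsOf f P u := fun i hi => Finset.mem_toList.1 hi
    have hc := expect_foldlM_credit_le h u J (runsOf f P u).toList (Finset.nodup_toList _)
      (fun i hi => hJ u (by simp) (hmem i hi)) hmem { s with V := u.applySet s.V } fun i _ => hs i
    rw [Finset.sum_map_toList] at hc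
    unfold updateCost
    set X := expect f 0 (globalUpdate P u s) (runningCost f P us)
    calc _ ≤ 1 + (∑ j ∈ J, runCredit P (s.inst j)
          + ∑ i ∈ runsOf f P u, (((s.inst i).T : ℝ≥0∞) + 1) * stepCost P) + X
          + (kappa P + 2) := by gcongr
      _ = _ := by ring

/-- Processes a sequence of updates without retrieving solutions. -/
noncomputable def globalSeq (P : Params E) : List (Update E) → State E → QueryAlg E (State E)
  | [], s => pure s
  | u :: us, s => globalUpdate P u s >>= globalSeq P us

theorem expect_globalSeq_append (us : List (Update E)) (u : Update E) (s : State E)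
    (g : State E → ℝ≥0∞) :
    expect f 0 (globalSeq P (us ++ [u]) s) g
      = expect f 0 (globalSeq P us s) fun s' => expect f 0 (globalUpdate P u s') g := by
  induction us generalizing s with
  | nil => simp [globalSeq]
  | cons v us ih =>
    simp only [List.cons_append, globalSeq, expect_bind, ih]

/-- Which updates reach run `i` depends only on `f` and the fixed sequence, not on random choices,
so the run's law is that of a stand-alone run on the filtered sequence. -/
theorem expect_globalSeq_marginal (us : List (Update E)) (s : State E) (i : ℤ)
    (g : LevelData E → ℝ≥0∞) :
    expect f 0 (globalSeq P us s) (fun s' => g (s'.inst i))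
      = expect f 0 (runSeq P (threshold P i) (us.filter fun u => i ∈ runsOf f P u) (s.inst i)) g := by
  induction us generalizing s with
  | nil => rfl
  | cons u us ih =>
    simp only [globalSeq, expect_bind, ih]
    rw [expect_globalUpdate, zero_add, expect_foldlM_marginal u _ (Finset.nodup_toList _) _ i
      (fun x => expect f 0 (runSeq P (threshold P i) (us.filter fun u => i ∈ runsOf f P u) x) g)]
    by_cases hi : i ∈ runsOf f P u
    · simp only [Finset.mem_toList, hi, if_true, decide_true, List.filter_cons_of_pos, runSeq,
        expect_bind]
    · simp [hi]

/-- A bound for the expected amortized cost of an update. -/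
noncomputable def updateBound (P : Params E) : ℝ≥0∞ :=
  kappa P + 3 + kappa P * ((ENNReal.ofReal (levelBound P) + 1) * stepCost P)

theorem expect_updateCost_le (h : Admissible f P) (us : List (Update E)) (u : Update E) :
    expect f 0 (globalSeq P us (State.start E)) (updateCost f P u) ≤ updateBound P := by
  have : Nonempty E := ⟨u.elem⟩
  unfold updateCost updateBound
  simp only [add_comm ((kappa P : ℝ≥0∞) + 3)]
  rw [expect_add_const, expect_sum]
  gcongr
  calc _ ≤ ∑ i ∈ runsOf f P u, (ENNReal.ofReal (levelBound P) + 1) * stepCost P := by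
        refine Finset.sum_le_sum fun i _ => ?_
        simp only [mul_comm _ (stepCost P)]
        rw [expect_mul_left, expect_add_const]
        gcongr
        rw [expect_globalSeq_marginal us (State.start E) i fun x => (x.T : ℝ≥0∞)]
        exact expect_T_le h (threshold_pos h i) _ fun v hv =>
          density_le_of_mem_runsOf h (by simpa using (List.mem_filter.1 hv).2)
    _ ≤ _ := by
        rw [Finset.sum_const, nsmul_eq_mul]
        gcongr
        exact card_runsOf_le h u

/-- The prefix `pre` is generalized so that each update is evaluated at the random state reached
from the empty start, where `expect_T_le` applies. -/
theorem expect_runningCost_le (h : Admissible f P) (us pre : List (Update E)) :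
    expect f 0 (globalSeq P pre (State.start E)) (runningCost f P us)
      ≤ us.length * updateBound P := by
  induction us generalizing pre with
  | nil =>
    simp only [List.length_nil, Nat.cast_zero, zero_mul]
    exact (expect_const f _ 0).le
  | cons u us ih =>
    have : runningCost f P (u :: us) = fun s => updateCost f P u s
      + expect f 0 (globalUpdate P u s) (runningCost f P us) := rfl
    rw [this, expect_add, ← expect_globalSeq_append, List.length_cons]
    push_cast
    rw [add_mul, one_mul, add_comm]
    gcongr
    · exact ih _
    · exact expect_updateCost_le h pre u

theorem expectedQueries_dynamicCover_le (h : Admissible f P) (us : List (Update E)) :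
    expectedQueries f (dynamicCover P us (State.start E)) ≤ us.length * updateBound P := by
  rw [expectedQueries_eq]
  have hs : GlobalInv f P (State.start E) := fun _ => inv_empty
  refine (cost_dynamicCover_le h
    (Finset.univ.biUnion fun e => relevantRuns P (f {e} / P.w e)) us (fun u _ => ?_) hs).trans ?_
  · exact Finset.subset_biUnion_of_mem (fun e => relevantRuns P (f {e} / P.w e))
      (Finset.mem_univ u.elem)
  · have : ∀ j, runCredit P ((State.start E).inst j) = 0 := fun j => by
      simp [runCredit, totalCredit, State.start, LevelData.empty]
    simp only [this, Finset.sum_const_zero, zero_add]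
    exact expect_runningCost_le h us []

end Global

end SubmodularCover

/-! ### Explicit polynomial bounds in `log η` and `1 / ε` -/

namespace SubmodularCover

open QueryAlg

section Bounds

variable {E : Type} [Fintype E] [DecidableEq E] {f : Finset E → ℝ} {P : Params E}

theorem levelBound_nonneg (h : Admissible f P) [Nonempty E] : 0 ≤ levelBound P := by
  have hD := one_le_invRate h
  have hD0 : 0 ≤ invRate P := by linarith
  have hn : (1 : ℝ) ≤ Fintype.card E := by exact_mod_cast Fintype.card_pos
  have hk : (1 : ℝ) ≤ kappa P := by exact_mod_cast kappa_pos P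
  have : 0 ≤ Real.log (Fintype.card E * kappa P) := Real.log_nonneg (by nlinarith)
  unfold levelBound; positivity

theorem updateBound_eq (h : Admissible f P) [Nonempty E] :
    updateBound P = ENNReal.ofReal (kappa P + 3 + kappa P * ((levelBound P + 1) *
      (2 + 4 * (passCost P * invRate P * kappa P) + passCost P * invRate P * kappa P *
        (3 / 2 * (kappa P : ℝ) ^ 2 / P.epsDel)))) := by
  have hD := one_le_invRate h
  have hdel := h.del_pos
  have hD0 : 0 ≤ invRate P := by linarith
  have hA := levelBound_nonneg h
  have hC : buildCost P = ENNReal.ofReal (passCost P * invRate P * kappa P) := by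
    rw [buildCost, ENNReal.ofReal_mul (by positivity), ENNReal.ofReal_mul (by positivity),
      ENNReal.ofReal_natCast, ENNReal.ofReal_natCast]
  have hstep : stepCost P = ENNReal.ofReal (2 + 4 * (passCost P * invRate P * kappa P)
      + passCost P * invRate P * kappa P * (3 / 2 * (kappa P : ℝ) ^ 2 / P.epsDel)) := by
    rw [stepCost, delCredit, hC, ENNReal.ofReal_add (by positivity) (by positivity),
      ENNReal.ofReal_add (by positivity) (by positivity), ENNReal.ofReal_mul (p := 4) (by positivity),
      ENNReal.ofReal_mul (p := passCost P * invRate P * kappa P) (by positivity)]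
    norm_num
  rw [updateBound, hstep]
  have hK : 0 ≤ 2 + 4 * (passCost P * invRate P * kappa P)
      + passCost P * invRate P * kappa P * (3 / 2 * (kappa P : ℝ) ^ 2 / P.epsDel) := by positivity
  generalize 2 + 4 * (passCost P * invRate P * kappa P)
      + passCost P * invRate P * kappa P * (3 / 2 * (kappa P : ℝ) ^ 2 / P.epsDel) = K at hK
  rw [ENNReal.ofReal_add (by positivity) (by positivity),
    ENNReal.ofReal_add (by positivity) (by positivity), ENNReal.ofReal_mul (by positivity),
    ENNReal.ofReal_mul (by positivity), ENNReal.ofReal_add hA (by positivity),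
    ENNReal.ofReal_natCast]
  norm_num

theorem one_le_log_eta (h : Admissible f P) [Nonempty E] : 1 ≤ Real.log (eta P) := by
  have h0 := h.eps_pos
  have h1 := h.eps_lt
  have hr : 1 ≤ P.rho := by
    obtain ⟨e⟩ := ‹Nonempty E›
    exact (h.weight e).1.trans (h.weight e).2
  have hn : (1 : ℝ) ≤ Fintype.card E := by exact_mod_cast Fintype.card_pos
  rw [Real.le_log_iff_exp_le (eta_pos h)]
  have h3 : Real.exp 1 ≤ 3 := by linarith [Real.exp_one_lt_d9]
  have h4 : 3 ≤ (1 + P.eps) / P.eps := by rw [le_div_iff₀ h0]; linarith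
  unfold eta
  have h5 : 1 ≤ (Fintype.card E : ℝ) * P.rho := by nlinarith
  rw [mul_assoc]
  nlinarith

/-- Changing the base of the logarithm costs a factor `2 / ε`, since `log (1 + ε) ≥ ε / 2`. -/
theorem kappa_le (h : Admissible f P) [Nonempty E] :
    (kappa P : ℝ) ≤ 3 * (Real.log (eta P) * (1 / P.eps)) := by
  have h0 := h.eps_pos
  have h1 := h.eps_lt
  have hx := one_le_log_eta h
  have hy : 10 ≤ 1 / P.eps := by rw [le_div_iff₀ h0]; linarith
  have hlog : P.eps / 2 ≤ Real.log (1 + P.eps) := by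
    refine le_trans ?_ (Real.one_sub_inv_le_log_of_pos (by linarith))
    rw [← one_div, one_sub_div (by linarith), add_sub_cancel_left]
    gcongr
    linarith
  have hb : Real.logb (1 + P.eps) (eta P) ≤ 2 * (Real.log (eta P) * (1 / P.eps)) := by
    rw [Real.logb, div_le_iff₀ (by linarith)]
    have : Real.log (eta P) = 2 * (Real.log (eta P) * (1 / P.eps)) * (P.eps / 2) := by field_simp
    calc Real.log (eta P) = 2 * (Real.log (eta P) * (1 / P.eps)) * (P.eps / 2) := this
      _ ≤ _ := by gcongr
  have hb0 : 0 ≤ Real.logb (1 + P.eps) (eta P) := by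
    rw [Real.logb]
    exact div_nonneg (by linarith) (by linarith)
  unfold kappa
  push_cast
  have := Nat.floor_le hb0
  nlinarith

theorem card_le_eta (h : Admissible f P) [Nonempty E] :
    (Fintype.card E : ℝ) / P.eps ≤ eta P := by
  have h0 := h.eps_pos
  have hr : 1 ≤ P.rho := by
    obtain ⟨e⟩ := ‹Nonempty E›
    exact (h.weight e).1.trans (h.weight e).2
  have hn : (1 : ℝ) ≤ Fintype.card E := by exact_mod_cast Fintype.card_pos
  have : eta P = (Fintype.card E : ℝ) / P.eps * ((1 + P.eps) * P.rho) := by unfold eta; ring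
  rw [this]
  exact le_mul_of_one_le_right (by positivity) (by nlinarith)

/-- As `n / ε ≤ η`, the logarithm in the number of simulations is at most `12 log η`. The constant
is `2 * 48` plus `2` for the ceiling and `6` for the rest of a pass. -/
theorem passCost_le (h : Admissible f P) [Nonempty E] :
    (passCost P : ℝ) ≤ 104 * (Real.log (eta P) * (1 / P.eps) ^ 2) := by
  have h0 := h.eps_pos
  have h1 := h.eps_lt
  have hx := one_le_log_eta h
  have hy : 10 ≤ 1 / P.eps := by rw [le_div_iff₀ h0]; linarith
  have hn : (1 : ℝ) ≤ Fintype.card E := by exact_mod_cast Fintype.card_pos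
  have hl0 := log_simCount_pos h
  have hl : Real.log ((Fintype.card E : ℝ) ^ 12 / P.eps) ≤ 12 * Real.log (eta P) := by
    rw [← Real.log_rpow (eta_pos h)]
    apply Real.log_le_log (by positivity)
    calc (Fintype.card E : ℝ) ^ 12 / P.eps ≤ (Fintype.card E : ℝ) ^ 12 / P.eps ^ 12 := by
          gcongr
          exact pow_le_of_le_one h0.le (by linarith) (by norm_num)
      _ = ((Fintype.card E : ℝ) / P.eps) ^ 12 := by rw [div_pow]
      _ ≤ eta P ^ 12 := by gcongr; exact card_le_eta h
      _ = _ := by norm_cast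
  have ht : (simCount E P.eps : ℝ) < 4 / P.eps ^ 2 *
      Real.log ((Fintype.card E : ℝ) ^ 12 / P.eps) + 1 := Nat.ceil_lt_add_one (by positivity)
  have h2 : 4 / P.eps ^ 2 * Real.log ((Fintype.card E : ℝ) ^ 12 / P.eps)
      ≤ 48 * (Real.log (eta P) * (1 / P.eps) ^ 2) := by
    calc _ ≤ 4 / P.eps ^ 2 * (12 * Real.log (eta P)) := by gcongr
      _ = _ := by ring
  have h3 : 1 ≤ Real.log (eta P) * (1 / P.eps) ^ 2 := one_le_mul_of_one_le_of_one_le hx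
    (one_le_pow₀ (by linarith))
  unfold passCost
  push_cast
  linarith

theorem levelBound_le (h : Admissible f P) [Nonempty E] :
    levelBound P + 1 ≤ invRate P * (6 * (Real.log (eta P) * (1 / P.eps))) := by
  have h0 := h.eps_pos
  have h1 := h.eps_lt
  have hx := one_le_log_eta h
  have hy : 10 ≤ 1 / P.eps := by rw [le_div_iff₀ h0]; linarith
  have hn : (1 : ℝ) ≤ Fintype.card E := by exact_mod_cast Fintype.card_pos
  have hk : (1 : ℝ) ≤ kappa P := by exact_mod_cast kappa_pos P
  have hD := one_le_invRate h
  have hl1 : Real.log (Fintype.card E) ≤ Real.log (eta P) := by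
    apply Real.log_le_log (by linarith)
    refine le_trans ?_ (card_le_eta h)
    rw [le_div_iff₀ h0]
    nlinarith
  have hl2 : Real.log (kappa P) ≤ kappa P - 1 := Real.log_le_sub_one_of_pos (by linarith)
  have hl : Real.log (Fintype.card E * kappa P) ≤ 4 * (Real.log (eta P) * (1 / P.eps)) - 1 := by
    rw [Real.log_mul (by linarith) (by linarith)]
    have := kappa_le h
    nlinarith
  have hxy : 10 ≤ Real.log (eta P) * (1 / P.eps) := by nlinarith
  unfold levelBound
  have := mul_le_mul_of_nonneg_left hl (by linarith : 0 ≤ invRate P)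
  nlinarith

/-- With `x = log η` and `y = 1 / ε`, the exponents `(12, 16)` of `(x, y)` add up from `(1, 1)` for
the runs, `(4, 5)` for the levels and `(7, 10)` for the cost per level, where deletion credit
dominates and brings in `z = ε / ε_del`. -/
theorem updateBound_le (h : Admissible f P) [Nonempty E] :
    updateBound P ≤ ENNReal.ofReal
      (10 ^ 11 * Real.log (eta P) ^ 12 * (1 / P.eps) ^ 16 * (P.eps / P.epsDel)) := by
  rw [updateBound_eq h]
  apply ENNReal.ofReal_le_ofReal
  have h0 := h.eps_pos
  have h1 := h.eps_lt
  have hd0 := h.del_pos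
  have hk := kappa_le h
  have hp := passCost_le h
  have hL := levelBound_le h
  have hA0 := levelBound_nonneg h
  have hD1 := one_le_invRate h
  have hx := one_le_log_eta h
  have hy : 1 ≤ 1 / P.eps := by rw [le_div_iff₀ h0]; linarith
  have hz : 1 ≤ P.eps / P.epsDel := by rw [le_div_iff₀ hd0]; linarith [h.del_lt]
  have hdz : 1 / P.epsDel = 1 / P.eps * (P.eps / P.epsDel) := by field_simp
  have hDdef : invRate P = 12 * (kappa P : ℝ) ^ 3 * (1 / P.eps) := by unfold invRate; ring
  rw [div_eq_mul_one_div _ P.epsDel, hdz]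
  generalize Real.log (eta P) = x at *
  generalize 1 / P.eps = y at *
  generalize P.eps / P.epsDel = z at *
  have hk0 : (0 : ℝ) ≤ kappa P := by positivity
  have hp0 : (0 : ℝ) ≤ passCost P := by positivity
  generalize (kappa P : ℝ) = k at *
  generalize (passCost P : ℝ) = c at *
  generalize levelBound P = A at *
  generalize invRate P = D at *
  have hx0 : 0 ≤ x := by linarith
  have hy0 : 0 ≤ y := by linarith
  have hz0 : 0 ≤ z := by linarith
  have hD0 : 0 ≤ D := by linarith
  have hD : D ≤ 324 * (x ^ 3 * y ^ 4) := by
    calc D = 12 * k ^ 3 * y := hDdef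
      _ ≤ 12 * (3 * (x * y)) ^ 3 * y := by gcongr
      _ = _ := by ring
  have hA : A + 1 ≤ 1944 * (x ^ 4 * y ^ 5) := by
    calc A + 1 ≤ D * (6 * (x * y)) := hL
      _ ≤ 324 * (x ^ 3 * y ^ 4) * (6 * (x * y)) := by gcongr
      _ = _ := by ring
  have hC : c * D * k ≤ 101088 * (x ^ 5 * y ^ 7) := by
    calc c * D * k ≤ 104 * (x * y ^ 2) * (324 * (x ^ 3 * y ^ 4)) * (3 * (x * y)) := by gcongr
      _ = _ := by ring
  have hdel : c * D * k * (3 / 2 * k ^ 2 * (y * z)) ≤ 1364688 * (x ^ 7 * y ^ 10 * z) := by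
    calc c * D * k * (3 / 2 * k ^ 2 * (y * z))
        ≤ 101088 * (x ^ 5 * y ^ 7) * (3 / 2 * (3 * (x * y)) ^ 2 * (y * z)) := by gcongr
      _ = _ := by ring
  have m1 : x ^ 5 * y ^ 7 ≤ x ^ 7 * y ^ 10 * z := by
    calc x ^ 5 * y ^ 7 = x ^ 5 * y ^ 7 * 1 := by ring
      _ ≤ _ := by gcongr <;> first | assumption | norm_num
  have m2 : 1 ≤ x ^ 7 * y ^ 10 * z :=
    one_le_mul_of_one_le_of_one_le (one_le_mul_of_one_le_of_one_le (one_le_pow₀ hx)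
      (one_le_pow₀ hy)) hz
  have hK : 2 + 4 * (c * D * k) + c * D * k * (3 / 2 * k ^ 2 * (y * z))
      ≤ 1769042 * (x ^ 7 * y ^ 10 * z) := by linarith
  have m3 : x * y ≤ x ^ 12 * y ^ 16 * z := by
    calc x * y = x ^ 1 * y ^ 1 * 1 := by ring
      _ ≤ _ := by gcongr <;> first | assumption | norm_num
  have m4 : 1 ≤ x ^ 12 * y ^ 16 * z :=
    one_le_mul_of_one_le_of_one_le (one_le_mul_of_one_le_of_one_le (one_le_pow₀ hx)
      (one_le_pow₀ hy)) hz
  have hmain : k * ((A + 1) * (2 + 4 * (c * D * k) + c * D * k * (3 / 2 * k ^ 2 * (y * z))))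
      ≤ 10317052944 * (x ^ 12 * y ^ 16 * z) := by
    calc _ ≤ 3 * (x * y) * (1944 * (x ^ 4 * y ^ 5) * (1769042 * (x ^ 7 * y ^ 10 * z))) := by
          have : 0 ≤ A + 1 := by linarith
          have : 0 ≤ y * z := mul_nonneg hy0 hz0
          gcongr
      _ = _ := by ring
  calc _ ≤ 3 * (x ^ 12 * y ^ 16 * z) + 3 * (x ^ 12 * y ^ 16 * z)
        + 10317052944 * (x ^ 12 * y ^ 16 * z) := by linarith
    _ ≤ 10 ^ 11 * (x ^ 12 * y ^ 16 * z) := by linarith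
    _ = _ := by ring

end Bounds

end SubmodularCover

theorem mainTheorem3 :
    ∃ p : MvPolynomial (Fin 2) ℝ,
      ∀ (E : Type) [Fintype E] [DecidableEq E] (f : Finset E → ℝ) (w : E → ℝ) (ρ ε εdel : ℝ),
        (∀ A, 0 ≤ f A) →
        (∀ A B, A ⊆ B → f A ≤ f B) →
        (∀ A B, f (A ∪ B) + f (A ∩ B) ≤ f A + f B) →
        (∀ e, 1 ≤ w e ∧ w e ≤ ρ) →
        0 < ε → ε < 1 / 10 → 0 < εdel → εdel < ε / 16 →
        ∀ updates : List (SubmodularCover.Update E),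
          QueryAlg.expectedQueries f
              (SubmodularCover.dynamicCover ⟨w, ρ, ε, εdel⟩ updates
                (SubmodularCover.State.start E)) ≤
            (updates.length : ENNReal) *
              ENNReal.ofReal
                (MvPolynomial.eval ![Real.log ((1 + ε) / ε * Fintype.card E * ρ), 1 / ε] p *
                  (ε / εdel)) := by
  refine ⟨MvPolynomial.C (10 ^ 11) * MvPolynomial.X 0 ^ 12 * MvPolynomial.X 1 ^ 16, ?_⟩
  intro E _ _ f w ρ ε εdel hnonneg hmono hsub hw h0 h1 hd hdel updates
  have h : SubmodularCover.Admissible f (⟨w, ρ, ε, εdel⟩ : SubmodularCover.Params E) :=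
    ⟨hnonneg, hmono, hsub, hw, h0, h1, hd, hdel⟩
  refine (SubmodularCover.expectedQueries_dynamicCover_le h updates).trans ?_
  -- Without updates `E` may be empty and `log η` meaningless, but no query is made; any update
  -- provides an element of `E`.
  rcases updates with _ | ⟨u, us⟩
  · simp
  have : Nonempty E := ⟨u.elem⟩
  gcongr
  refine (SubmodularCover.updateBound_le h).trans_eq ?_
  simp [SubmodularCover.eta]
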